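/- **Setting.** Let $m\ge 1$ and let $F_{(m)}$ be the cdf of the $\chi^2_m$ distribution. A Dirichlet process $P\sim DP(a,H)$ with $a>0$ and base probability measure $H$ is a random probability measure such that for every finite measurable partition $A_1,\dots,A_k$, $k\ge2$, the vector $(P(A_1),\dots,P(A_k))$ has the Dirichlet distribution with parameters $aH(A_1),\dots,aH(A_k)$ (a coordinate with parameter $0$ being almost surely $0$). For a sample $d=(d_1,\dots,d_n)$ of real numbers with empirical distribution $F_n$, the posterior of $P\sim DP(a,F_{(m)})$ given $d$ is $$P_d\sim DP(a+n,H_d),\qquad H_d=\frac{a}{a+n}F_{(m)}+\frac{n}{a+n}F_n .$$ The Anderson–Darling distance between cdfs is $d_{AD}(F,G)=\int_{-\infty}^{\infty}\frac{(F(t)-G(t))^2}{G(t)(1-G(t))}\,dG(t)\in[0,\infty]$. Limits "as $a\to\infty$" and "as $n\to\infty$" concern sequences of random measures $P_d$ defined on one probability space; only the law of each $P_d$ is prescribed (given the data), and nothing is assumed about their joint law. As almost sure convergence depends on the joint law, "as $a\to\infty$" means along any sequence $(a_k)$ of positive numbers with $\sum_k a_k^{-2}<\infty$ (for instance $a_k=kc$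 with $c>0$). **Data.** In (ii)–(iv), for each $n$ the sample $d=(d_1,\dots,d_n)$ is of one of the following two kinds, with true distribution $P_{\rm true}$: * (independent sample) $d_1,\dots,d_n$ are the first $n$ terms of an i.i.d. sequence of real random variables with law $P_{\rm true}$; * (sample Mahalanobis distances) $d_i=(\mathbf Y_i-\overline{\mathbf Y})^{T}S^{-1}(\mathbf Y_i-\overline{\mathbf Y})$, where $\overline{\mathbf Y}$ and $S$ are the sample mean and the sample covariance matrix (normalised by $n-1$; the inverse of a singular matrix is read as $0$, which matters only for finitely many $n$ almost surely) of the first $n$ terms of an i.i.d. sequence $\mathbf Y_1,\mathbf Y_2,\dots$ of random vectors in $\mathbb R^m$ with finite second moments, mean $\boldsymbol\mu$ and positive definite covariance matrix $\Sigma$, and $P_{\rm true}$ is the law of $(\mathbf Y_1-\boldsymbol\mu)^T\Sigma^{-1}(\mathbf Y_1-\boldsymbol\mu)$. The hypothesis $\mathcal H_0$ is $P_{\rm true}=F_{(m)}$. **Claim.** 1. For every fixed $n\ge 0$ and every fixed sample $d\in(0,\infty)^n$, $d_{AD}(P_d,F_{(m)})\to0$ almost surely as $a\to\infty$. 2. If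 $\mathcal H_0$ is true and $a>0$ is fixed, then for almost every data sequence, $d_{AD}(P_d,F_{(m)})\to0$ almost surely as $n\to\infty$. 3. If $\mathcal H_0$ is not true and $a>0$ is fixed, then for almost every data sequence, $\liminf_{n\to\infty} d_{AD}(P_d,F_{(m)})>0$ almost surely. 4. If $\mathcal H_0$ is not true and $a>0$ is fixed, then for almost every data sequence, $\liminf_{n\to\infty}E_{P_d}\big(d_{AD}(P_d,F_{(m)})\big)>0$, where $E_{P_d}$ is the expectation under the posterior law of $P_d$ given the data. -/

import Mathlib

open MeasureTheory ProbabilityTheory Filter Topology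
open scoped ENNReal

noncomputable section

/-- The chi-square distribution with `m` degrees of freedom: the gamma law with shape `m / 2` and
rate `1 / 2`. -/
def chiSquared (m : ℕ) : Measure ℝ := gammaMeasure ((m : ℝ) / 2) (1 / 2)

/-- The gamma law with shape `α` and rate `1`; for `α = 0` it is the point mass at `0`. -/
def gammaLaw (α : ℝ) : Measure ℝ := if α = 0 then Measure.dirac 0 else gammaMeasure α 1

/-- The Dirichlet distribution with parameters `α i ≥ 0`, not all of them `0`: the law of
`(g i / ∑ j, g j)_i` for independent `g i` with gamma law of shape `α i`. In particular a
coordinate whose parameter is `0` vanishes almost surely. -/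
def dirichletLaw {k : ℕ} (α : Fin k → ℝ) : Measure (Fin k → ℝ) :=
  (Measure.pi fun i => gammaLaw (α i)).map fun g i => g i / ∑ j, g j

/-- `P` is a Dirichlet process with concentration parameter `a` and base measure `H` on the
probability space `(Ω, μ)`: a random probability measure such that for every finite measurable
partition `A` the vector of the `P (A i)` has the Dirichlet distribution with parameters
`a * H (A i)`. -/
structure IsDirichletProcess {Ω X : Type*} [MeasurableSpace Ω] [MeasurableSpace X]
    (μ : Measure Ω) (P : Ω → Measure X) (a : ℝ) (H : Measure X) : Prop where
  measurable : Measurable P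
  isProbabilityMeasure : ∀ ω, IsProbabilityMeasure (P ω)
  map_partition : ∀ (k : ℕ) (A : Fin k → Set X), 2 ≤ k → (∀ i, MeasurableSet (A i)) →
    Pairwise (fun i j => Disjoint (A i) (A j)) → (⋃ i, A i) = Set.univ →
    μ.map (fun ω i => (P ω).real (A i)) = dirichletLaw fun i => a * H.real (A i)

/-- The empirical distribution of `x 0, …, x (n - 1)`. -/
def empirical {n : ℕ} (x : Fin n → ℝ) : Measure ℝ :=
  (n : ℝ≥0∞)⁻¹ • ∑ i, Measure.dirac (x i)

/-- The base measure `a / (a + n) * H + n / (a + n) * F_n` of the posterior of a Dirichlet process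
with parameters `a` and `H`, given the sample `x`, where `F_n` is the empirical distribution. -/
def posteriorBase (a : ℝ) (H : Measure ℝ) {n : ℕ} (x : Fin n → ℝ) : Measure ℝ :=
  ENNReal.ofReal (a / (a + n)) • H + ENNReal.ofReal (n / (a + n)) • empirical x

/-- `P` has the law of the posterior process `DP(a + n, H_x)` given the sample `x`. -/
def IsPosterior {Ω : Type*} [MeasurableSpace Ω] (μ : Measure Ω) (P : Ω → Measure ℝ)
    (a : ℝ) (H : Measure ℝ) {n : ℕ} (x : Fin n → ℝ) : Prop :=
  IsDirichletProcess μ P (a + n) (posteriorBase a H x)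

/-- The Anderson-Darling distance `∫ (F - G) ^ 2 / (G * (1 - G)) dG` between the cdfs `F` and `G`
of `P` and `Q`, with values in `[0, ∞]`. -/
def andersonDarling (P Q : Measure ℝ) : ℝ≥0∞ :=
  ∫⁻ t, ENNReal.ofReal ((cdf P t - cdf Q t) ^ 2) /
    ENNReal.ofReal (cdf Q t * (1 - cdf Q t)) ∂Q

/-- The squared Mahalanobis distance of `y` to `c` with respect to the matrix `S`. -/
def mahalanobisSq {m : ℕ} (S : Matrix (Fin m) (Fin m) ℝ) (c y : Fin m → ℝ) : ℝ :=
  dotProduct (y - c) (Matrix.mulVec S⁻¹ (y - c))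

/-- The mean vector of the random vector `Y`. -/
def meanVector {Ω : Type*} [MeasurableSpace Ω] {m : ℕ} (μ : Measure Ω)
    (Y : Ω → Fin m → ℝ) : Fin m → ℝ :=
  fun r => ∫ ω, Y ω r ∂μ

/-- The covariance matrix of the random vector `Y`. -/
def covMatrix {Ω : Type*} [MeasurableSpace Ω] {m : ℕ} (μ : Measure Ω)
    (Y : Ω → Fin m → ℝ) : Matrix (Fin m) (Fin m) ℝ :=
  Matrix.of fun r s => covariance (fun ω => Y ω r) (fun ω => Y ω s) μ

/-- The sample mean of `y 0, …, y (n - 1)`. -/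
def sampleMean {m n : ℕ} (y : Fin n → Fin m → ℝ) : Fin m → ℝ :=
  fun r => (∑ i, y i r) / n

/-- The sample covariance matrix of `y 0, …, y (n - 1)`. -/
def sampleCov {m n : ℕ} (y : Fin n → Fin m → ℝ) : Matrix (Fin m) (Fin m) ℝ :=
  Matrix.of fun r s =>
    (∑ i, (y i r - sampleMean y r) * (y i s - sampleMean y s)) / ((n : ℝ) - 1)

/-- The vector `d` of the first `n` observations, `n = 0, 1, 2, …`, comes from an i.i.d. sequence
with law `Q`. -/
def IsIIDSample {Ω : Type*} [MeasurableSpace Ω] (μ : Measure Ω)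
    (d : (n : ℕ) → Ω → Fin n → ℝ) (Q : Measure ℝ) : Prop :=
  ∃ X : ℕ → Ω → ℝ, (∀ i, Measurable (X i)) ∧ iIndepFun X μ ∧ (∀ i, μ.map (X i) = Q) ∧
    ∀ (n : ℕ) (ω : Ω) (i : Fin n), d n ω i = X i ω

/-- `d n` is the vector of the squared sample Mahalanobis distances (with estimated mean and
covariance) of the first `n` terms of an i.i.d. sequence of `m`-variate random vectors with finite
second moments and nonsingular covariance matrix, and `Q` is the law of the squared Mahalanobis
distance of one such vector to its mean. -/
def IsMahalanobisSample {Ω : Type*} [MeasurableSpace Ω] (μ : Measure Ω) (m : ℕ)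
    (d : (n : ℕ) → Ω → Fin n → ℝ) (Q : Measure ℝ) : Prop :=
  ∃ Y : ℕ → Ω → Fin m → ℝ, (∀ i, Measurable (Y i)) ∧ iIndepFun Y μ ∧
    (∀ i, IdentDistrib (Y i) (Y 0) μ μ) ∧ MemLp (Y 0) 2 μ ∧ (covMatrix μ (Y 0)).PosDef ∧
    Q = μ.map (fun ω => mahalanobisSq (covMatrix μ (Y 0)) (meanVector μ (Y 0)) (Y 0 ω)) ∧
    ∀ (n : ℕ) (ω : Ω) (i : Fin n), d n ω i =
      mahalanobisSq (sampleCov fun j : Fin n => Y j ω) (sampleMean fun j : Fin n => Y j ω) (Y i ω)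

end

/-!
Write `F` for the chi-square cdf, `w = F (1 - F)`, and `H` for the cdf of the base measure of a
Dirichlet process `P` with concentration parameter `A`. The Anderson-Darling distance of `P` to `F`
is at most twice the sum of a fluctuation `∫ (P - H)² / w dF` and a bias `∫ (H - F)² / w dF`.

*Fluctuation.* For each `t`, `P(t)` has a beta law, whose fourth central moment is at most
`3 H(t) (1 - H(t)) / A²` (`IsDirichletProcess.lintegral_sub_pow_four_le`). If `H ≤ C F ^ γ` and
`1 - H ≤ C (1 - F) ^ γ` with `γ > 0`, then `H (1 - H)` is at most a multiple of `w ^ γ`, and the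
Cauchy-Schwarz inequality with weights `w ^ (-1 ± γ / 2)` bounds the second moment of the
fluctuation by a multiple of `A⁻²`; the integrals of `w ^ p` with `p > -1` are finite because `F` is
uniformly distributed under its own law. Hence the fluctuation vanishes almost surely along every
sequence with `∑ A⁻² < ∞`, whatever the joint law (`ae_tendsto_fluctuation`).

*Bias.* Under the same tail condition the integrand is at most a multiple of `w ^ (2 γ - 1)`, so
pointwise convergence of `H` to `F` suffices, by dominated convergence. Both parts together give
`ae_tendsto_andersonDarling`. For a fixed positive sample the tail condition holds with `γ = 1`.

*Growing samples.* Both kinds of data are close, in the relative sense of `IsApproximation`, to an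
i.i.d. sequence `D` with the true law, so their empirical cdfs converge to the true cdf at its
continuity points. Under an alternative, Fatou's lemma bounds the lower limit of the distances, and
of their expectations, below by the distance of the true law, which is positive
(`andersonDarling_chiSquared_pos`). Under the null hypothesis the tail condition has to be verified
(`exists_empiricalCdf_tail_le`). It follows from the law of large numbers for `D ^ (-1 / 4)` and
`exp (D / 8)`, once `d ≤ t` is known to force `D ≤ 16 t ^ (1 / 24)` for small `t`. For the sample
Mahalanobis distances this is the delicate point, as an observation near the sample mean has a very
small distance. Let `Z i` be the whitened centred observations, so that `D i = ‖Z i‖²` and `d i` is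
comparable to `‖Z i - mean‖²`. The norm `‖Z i‖` has a bounded density and `Z i` is independent of
the sum of the other vectors, hence no `Z i` comes closer to the mean than `n ^ (-3)`
(`ae_eventually_le_norm_sub_vecMean`), while the mean itself has norm at most `n ^ (-1 / 8)`
(`ae_eventually_norm_vecMean_le`); comparing the two scales gives the claim.
-/

/-! ### Gamma laws and the moments of the beta law -/

theorem lintegral_gammaMeasure {a r : ℝ} (f : ℝ → ℝ≥0∞) (hf : Measurable f) :
    ∫⁻ x, f x ∂(gammaMeasure a r) =
      ∫⁻ x in Set.Ioi 0, ENNReal.ofReal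
        (r ^ a / Real.Gamma a * x ^ (a - 1) * Real.exp (-(r * x))) * f x := by
  have hm : Measurable (gammaPDF a r) := (measurable_gammaPDFReal a r).ennreal_ofReal
  rw [gammaMeasure, lintegral_withDensity_eq_lintegral_mul _ hm hf,
    ← lintegral_indicator measurableSet_Ioi]
  refine lintegral_congr_ae ?_
  filter_upwards [Measure.ae_ne volume (0 : ℝ)] with x hx
  rcases lt_or_gt_of_ne hx with h | h
  · simp [gammaPDF_of_neg h, h.le]
  · simp [gammaPDF_of_nonneg h.le, h]

theorem gammaMeasure_Iic_zero (a r : ℝ) : gammaMeasure a r (Set.Iic 0) = 0 := by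
  rw [← lintegral_indicator_one measurableSet_Iic,
    lintegral_gammaMeasure _ (measurable_one.indicator measurableSet_Iic)]
  refine setLIntegral_eq_zero measurableSet_Ioi fun x hx => ?_
  have : ¬ x ≤ 0 := not_le.2 hx
  simp [this]

theorem ae_pos_gammaMeasure (a r : ℝ) : ∀ᵐ x ∂(gammaMeasure a r), 0 < x := by
  rw [ae_iff]
  simpa [Set.Iic_def] using gammaMeasure_Iic_zero a r

theorem lintegral_rpow_mul_exp_neg_Ioi {s v : ℝ} (hs : 0 < s) (hv : 0 < v) :
    ∫⁻ x in Set.Ioi (0 : ℝ), ENNReal.ofReal (x ^ (s - 1) * Real.exp (-(v * x))) =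
      ENNReal.ofReal ((1 / v) ^ s * Real.Gamma s) := by
  rw [← Real.integral_rpow_mul_exp_neg_mul_Ioi hs hv, ofReal_integral_eq_lintegral_ofReal]
  · have := integrableOn_rpow_mul_exp_neg_mul_rpow (s := s - 1) (p := 1) (b := v) (by linarith)
      one_pos hv
    simpa [IntegrableOn] using this
  · filter_upwards [ae_restrict_mem measurableSet_Ioi] with x hx
    have : (0 : ℝ) < x := hx
    positivity

/-- Exponentially tilted moments of the gamma law, fractional and negative orders included. -/
theorem lintegral_rpow_mul_exp_gammaMeasure {a r θ u : ℝ} (ha : 0 < a) (hr : 0 < r)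
    (hθ : 0 < a + θ) (hu : 0 < r + u) :
    ∫⁻ x, ENNReal.ofReal (x ^ θ * Real.exp (-(u * x))) ∂(gammaMeasure a r) =
      ENNReal.ofReal (r ^ a / Real.Gamma a * ((1 / (r + u)) ^ (a + θ) * Real.Gamma (a + θ))) := by
  have hΓ := Real.Gamma_pos_of_pos ha
  rw [lintegral_gammaMeasure _ (by fun_prop), ENNReal.ofReal_mul (by positivity),
    ← lintegral_rpow_mul_exp_neg_Ioi hθ hu, ← lintegral_const_mul _ (by fun_prop)]
  refine setLIntegral_congr_fun measurableSet_Ioi fun x hx => ?_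
  have hx : (0 : ℝ) < x := hx
  rw [← ENNReal.ofReal_mul (by positivity), ← ENNReal.ofReal_mul (by positivity)]
  congr 1
  have h1 : x ^ (a + θ - 1) = x ^ (a - 1) * x ^ θ := by
    rw [← Real.rpow_add hx]; ring_nf
  have h2 : Real.exp (-((r + u) * x)) = Real.exp (-(r * x)) * Real.exp (-(u * x)) := by
    rw [← Real.exp_add]; ring_nf
  rw [h1, h2]; ring

instance isProbabilityMeasure_gammaLaw (α : ℝ) [h : Fact (0 ≤ α)] :
    IsProbabilityMeasure (gammaLaw α) := by
  unfold gammaLaw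
  split_ifs with h0
  · infer_instance
  · exact isProbabilityMeasure_gammaMeasure (lt_of_le_of_ne h.out (Ne.symm h0)) one_pos

theorem gammaLaw_ae_nonneg (α : ℝ) : ∀ᵐ x ∂(gammaLaw α), 0 ≤ x := by
  unfold gammaLaw
  split_ifs with h0
  · rw [ae_dirac_iff measurableSet_Ici]
  · filter_upwards [ae_pos_gammaMeasure α 1] with x hx using hx.le

/-- The rising factorial `α (α + 1) ⋯ (α + j - 1)` of a real number. -/
noncomputable def risingFactorial (α : ℝ) (j : ℕ) : ℝ := ∏ i ∈ Finset.range j, (α + i)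

theorem Gamma_add_nat_eq_risingFactorial_mul {α : ℝ} (hα : 0 < α) (j : ℕ) :
    Real.Gamma (α + j) = risingFactorial α j * Real.Gamma α := by
  induction j with
  | zero => simp [risingFactorial]
  | succ j ih =>
    have : α + (j + 1 : ℕ) = (α + j) + 1 := by push_cast; ring
    rw [this, Real.Gamma_add_one (by positivity), ih, risingFactorial, risingFactorial,
      Finset.prod_range_succ]
    ring

theorem risingFactorial_nonneg {α : ℝ} (hα : 0 ≤ α) (j : ℕ) : 0 ≤ risingFactorial α j :=
  Finset.prod_nonneg fun i _ => by positivity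

/-- Tilted integer moments of the gamma law; for shape `0` both sides vanish when `1 ≤ j`. -/
theorem lintegral_pow_mul_exp_gammaLaw {α u : ℝ} (hα : 0 ≤ α) (hu : 0 ≤ u) (j : ℕ) :
    ∫⁻ x, ENNReal.ofReal (x ^ j * Real.exp (-(u * x))) ∂(gammaLaw α) =
      ENNReal.ofReal (risingFactorial α j * (1 / (1 + u)) ^ (α + j)) := by
  unfold gammaLaw
  split_ifs with h0
  · rw [lintegral_dirac' _ (by fun_prop)]
    subst h0
    cases j with
    | zero => simp [risingFactorial]
    | succ j => simp [risingFactorial, Finset.prod_range_succ']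
  · have hα : 0 < α := lt_of_le_of_ne hα (Ne.symm h0)
    have h := lintegral_rpow_mul_exp_gammaMeasure (θ := j) hα one_pos (by positivity)
      (show 0 < 1 + u by positivity)
    simp only [Real.rpow_natCast] at h
    rw [h, Gamma_add_nat_eq_risingFactorial_mul hα]
    have := (Real.Gamma_pos_of_pos hα).ne'
    congr 1
    simp only [Real.one_rpow]
    field_simp

theorem ofReal_inv_pow_eq_lintegral_exp {s : ℝ} (hs : 0 < s) {j : ℕ} (hj : 1 ≤ j) :
    ∫⁻ u in Set.Ioi (0 : ℝ), ENNReal.ofReal (u ^ (j - 1) * Real.exp (-(u * s))) =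
      ENNReal.ofReal ((j - 1).factorial / s ^ j) := by
  have h := lintegral_rpow_mul_exp_neg_Ioi (s := j) (v := s) (by positivity) hs
  have hG : Real.Gamma j = (j - 1).factorial := by
    obtain ⟨k, rfl⟩ := Nat.exists_eq_add_of_le' hj
    simpa using Real.Gamma_nat_eq_factorial k
  have hj' : (j : ℝ) - 1 = ((j - 1 : ℕ) : ℝ) := by push_cast [hj]; ring
  rw [hG, hj', Real.rpow_natCast] at h
  simp only [Real.rpow_natCast] at h
  simp_rw [mul_comm _ s, h]
  congr 1
  rw [one_div, inv_pow]
  field_simp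

/-- Moments of the beta law, as the law of `x / (x + y)` for independent gamma variables: writing
`s⁻ʲ` as a Laplace integral in `s = x + y` makes the integrand a product. -/
theorem lintegral_ratio_pow_gammaLaw {α β : ℝ} (hα : 0 ≤ α) (hβ : 0 ≤ β) (hαβ : 0 < α + β)
    {j : ℕ} (hj : 1 ≤ j) :
    ∫⁻ x, ∫⁻ y, ENNReal.ofReal ((x / (x + y)) ^ j) ∂(gammaLaw β) ∂(gammaLaw α) =
      ENNReal.ofReal (risingFactorial α j / risingFactorial (α + β) j) := by
  have : Fact (0 ≤ α) := ⟨hα⟩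
  have : Fact (0 ≤ β) := ⟨hβ⟩
  have hfac : (0 : ℝ) < (j - 1).factorial := by positivity
  have hrf : 0 < risingFactorial (α + β) j := Finset.prod_pos fun i _ => by positivity
  -- the value of the remaining integral in `u`
  have hbeta : ∫⁻ u in Set.Ioi (0 : ℝ), ENNReal.ofReal (u ^ (j - 1) *
      (1 / (1 + u)) ^ (α + β + j)) =
        ENNReal.ofReal ((j - 1).factorial / risingFactorial (α + β) j) := by
    have h1 : ∀ u ∈ Set.Ioi (0 : ℝ), ENNReal.ofReal (u ^ (j - 1) * (1 / (1 + u)) ^ (α + β + j)) =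
        ∫⁻ s, ENNReal.ofReal (u ^ (j - 1) * Real.exp (-(u * s))) ∂(gammaMeasure (α + β + j) 1) := by
      intro u hu
      have hu : (0 : ℝ) < u := hu
      have h := lintegral_rpow_mul_exp_gammaMeasure (a := α + β + j) (r := 1) (θ := 0) (u := u)
        (by positivity) one_pos (by positivity) (by positivity)
      have hG := (Real.Gamma_pos_of_pos (show 0 < α + β + j by positivity)).ne'
      simp only [Real.rpow_zero, one_mul, Real.one_rpow, add_zero] at h
      simp_rw [ENNReal.ofReal_mul (pow_nonneg hu.le (j - 1))]
      rw [lintegral_const_mul _ (by fun_prop), h]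
      congr 2
      field_simp
    have : IsProbabilityMeasure (gammaMeasure (α + β + j) 1) :=
      isProbabilityMeasure_gammaMeasure (by positivity) one_pos
    rw [setLIntegral_congr_fun measurableSet_Ioi h1, lintegral_lintegral_swap (by fun_prop)]
    have h2 : ∀ᵐ s ∂(gammaMeasure (α + β + j) 1),
        ∫⁻ u in Set.Ioi (0 : ℝ), ENNReal.ofReal (u ^ (j - 1) * Real.exp (-(u * s))) =
        ENNReal.ofReal ((j - 1).factorial) *
          ENNReal.ofReal (s ^ (-(j : ℝ)) * Real.exp (-(0 * s))) := by
      filter_upwards [ae_pos_gammaMeasure (α + β + j) 1] with s hs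
      rw [ofReal_inv_pow_eq_lintegral_exp hs hj, ← ENNReal.ofReal_mul (by positivity)]
      congr 1
      rw [Real.rpow_neg hs.le, Real.rpow_natCast]
      simp; rfl
    rw [lintegral_congr_ae h2, lintegral_const_mul _ (by fun_prop),
      lintegral_rpow_mul_exp_gammaMeasure (by positivity) one_pos (by simpa using hαβ) (by simp),
      ← ENNReal.ofReal_mul (by positivity)]
    congr 1
    have hG := (Real.Gamma_pos_of_pos hαβ).ne'
    rw [Gamma_add_nat_eq_risingFactorial_mul hαβ]
    simp
    field_simp
  have h3 : ∀ᵐ x ∂(gammaLaw α), ∀ᵐ y ∂(gammaLaw β),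
      ENNReal.ofReal ((x / (x + y)) ^ j) = ENNReal.ofReal (1 / (j - 1).factorial) *
        ∫⁻ u in Set.Ioi (0 : ℝ), ENNReal.ofReal (x ^ j * Real.exp (-(u * x))) *
          ENNReal.ofReal (u ^ (j - 1) * (y ^ 0 * Real.exp (-(u * y)))) := by
    filter_upwards [gammaLaw_ae_nonneg α] with x hx
    filter_upwards [gammaLaw_ae_nonneg β] with y hy
    rcases hx.eq_or_lt with rfl | hx
    · have : j ≠ 0 := by omega
      simp [this]
    · have hs : 0 < x + y := by positivity
      have : ∀ u ∈ Set.Ioi (0 : ℝ), ENNReal.ofReal (x ^ j * Real.exp (-(u * x))) *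
          ENNReal.ofReal (u ^ (j - 1) * (y ^ 0 * Real.exp (-(u * y)))) =
          ENNReal.ofReal (x ^ j) * ENNReal.ofReal (u ^ (j - 1) * Real.exp (-(u * (x + y)))) := by
        intro u hu
        rw [← ENNReal.ofReal_mul (by positivity), ← ENNReal.ofReal_mul (by positivity)]
        congr 1
        rw [mul_add, neg_add, Real.exp_add]
        ring
      rw [setLIntegral_congr_fun measurableSet_Ioi this, lintegral_const_mul _ (by fun_prop),
        ofReal_inv_pow_eq_lintegral_exp hs hj, ← ENNReal.ofReal_mul (by positivity),
        ← ENNReal.ofReal_mul (by positivity)]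
      congr 1
      rw [div_pow]
      field_simp
  rw [lintegral_congr_ae (h3.mono fun x hx => lintegral_congr_ae hx)]
  have h4 : ∀ x, ∫⁻ y, (ENNReal.ofReal (1 / (j - 1).factorial) *
      ∫⁻ u in Set.Ioi (0 : ℝ), ENNReal.ofReal (x ^ j * Real.exp (-(u * x))) *
        ENNReal.ofReal (u ^ (j - 1) * (y ^ 0 * Real.exp (-(u * y))))) ∂(gammaLaw β) =
      ENNReal.ofReal (1 / (j - 1).factorial) *
        ∫⁻ u in Set.Ioi (0 : ℝ), ENNReal.ofReal (x ^ j * Real.exp (-(u * x))) *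
          ENNReal.ofReal (u ^ (j - 1) * (1 / (1 + u)) ^ β) := by
    intro x
    rw [lintegral_const_mul _ (by fun_prop), lintegral_lintegral_swap (by fun_prop)]
    congr 1
    refine setLIntegral_congr_fun measurableSet_Ioi fun u hu => ?_
    have hu : (0 : ℝ) < u := hu
    rw [lintegral_const_mul _ (by fun_prop)]
    simp_rw [ENNReal.ofReal_mul (pow_nonneg hu.le (j - 1))]
    rw [lintegral_const_mul _ (by fun_prop), lintegral_pow_mul_exp_gammaLaw hβ hu.le]
    simp [risingFactorial]
  simp_rw [h4]
  rw [lintegral_const_mul _ (by fun_prop), lintegral_lintegral_swap (by fun_prop)]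
  have h5 : ∀ u ∈ Set.Ioi (0 : ℝ), ∫⁻ x, ENNReal.ofReal (x ^ j * Real.exp (-(u * x))) *
        ENNReal.ofReal (u ^ (j - 1) * (1 / (1 + u)) ^ β) ∂(gammaLaw α) =
      ENNReal.ofReal (risingFactorial α j) *
        ENNReal.ofReal (u ^ (j - 1) * (1 / (1 + u)) ^ (α + β + j)) := by
    intro u hu
    have hu : (0 : ℝ) < u := hu
    have := risingFactorial_nonneg hα j
    rw [lintegral_mul_const _ (by fun_prop), lintegral_pow_mul_exp_gammaLaw hα hu.le,
      ← ENNReal.ofReal_mul (by positivity), ← ENNReal.ofReal_mul (by positivity)]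
    congr 1
    rw [show α + β + j = (α + j) + β by ring, Real.rpow_add (by positivity) (α + j) β]
    ring
  rw [setLIntegral_congr_fun measurableSet_Ioi h5, lintegral_const_mul _ (by fun_prop), hbeta,
    ← ENNReal.ofReal_mul (risingFactorial_nonneg hα j), ← ENNReal.ofReal_mul (by positivity)]
  congr 1
  field_simp

/-! ### Central moments of a Dirichlet process -/

theorem IsDirichletProcess.measurable_real {Ω X : Type*} [MeasurableSpace Ω] [MeasurableSpace X]
    {μ : Measure Ω} {P : Ω → Measure X} {A : ℝ} {H : Measure X}
    (hP : IsDirichletProcess μ P A H) {B : Set X} (hB : MeasurableSet B) :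
    Measurable fun ω => (P ω).real B :=
  ((Measure.measurable_coe hB).comp hP.measurable).ennreal_toReal

/-- The mass which a Dirichlet process gives to a set has the moments of a beta law. -/
theorem IsDirichletProcess.lintegral_real_pow {Ω X : Type*} [MeasurableSpace Ω]
    [MeasurableSpace X] {μ : Measure Ω} {P : Ω → Measure X} {A : ℝ} {H : Measure X}
    [IsProbabilityMeasure H] (hP : IsDirichletProcess μ P A H) (hA : 0 < A) {B : Set X}
    (hB : MeasurableSet B) {j : ℕ} (hj : 1 ≤ j) :
    ∫⁻ ω, ENNReal.ofReal ((P ω).real B ^ j) ∂μ =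
      ENNReal.ofReal (risingFactorial (A * H.real B) j / risingFactorial A j) := by
  have hpart := hP.map_partition 2 ![B, Bᶜ] le_rfl
    (by intro i; fin_cases i <;> simp [hB])
    (by intro i k hik
        fin_cases i <;> fin_cases k <;> simp_all [disjoint_compl_left, disjoint_compl_right])
    (by
      ext x
      simp [Fin.exists_fin_two, em])
  have hα : 0 ≤ A * H.real B := by positivity
  have hβ : 0 ≤ A * H.real Bᶜ := by positivity
  have hsum : A * H.real B + A * H.real Bᶜ = A := by
    rw [← mul_add, probReal_add_probReal_compl hB, mul_one]
  have : Fact (0 ≤ A * H.real B) := ⟨hα⟩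
  have : Fact (0 ≤ A * H.real Bᶜ) := ⟨hβ⟩
  have hmeas : Measurable fun ω (i : Fin 2) => (P ω).real ((![B, Bᶜ] : Fin 2 → Set X) i) := by
    refine measurable_pi_lambda _ fun i => hP.measurable_real ?_
    fin_cases i <;> simp [hB]
  have e1 : ∫⁻ ω, ENNReal.ofReal ((P ω).real B ^ j) ∂μ =
      ∫⁻ v : Fin 2 → ℝ, ENNReal.ofReal (v 0 ^ j)
        ∂(μ.map fun ω (i : Fin 2) => (P ω).real ((![B, Bᶜ] : Fin 2 → Set X) i)) := by
    rw [lintegral_map (by fun_prop) hmeas]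
    simp
  have hα' : ∀ i : Fin 2, SigmaFinite
      (gammaLaw (A * H.real ((![B, Bᶜ] : Fin 2 → Set X) i))) := by
    intro i
    fin_cases i <;> simp <;> infer_instance
  rw [e1, hpart, dirichletLaw, lintegral_map (by fun_prop) (by fun_prop)]
  have hmp := measurePreserving_piFinTwo
    (fun i : Fin 2 => gammaLaw (A * H.real ((![B, Bᶜ] : Fin 2 → Set X) i)))
  have e2 := hmp.lintegral_comp
    (f := fun q : ℝ × ℝ => ENNReal.ofReal ((q.1 / (q.1 + q.2)) ^ j)) (by fun_prop)
  simp only [MeasurableEquiv.piFinTwo_apply] at e2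
  simp only [Fin.sum_univ_two]
  rw [e2, lintegral_prod _ (by fun_prop)]
  simp only [Matrix.cons_val_zero, Matrix.cons_val_one]
  rw [lintegral_ratio_pow_gammaLaw hα hβ (by rw [hsum]; exact hA) hj, hsum]

theorem IsDirichletProcess.integral_real_pow {Ω X : Type*} [MeasurableSpace Ω]
    [MeasurableSpace X] {μ : Measure Ω} {P : Ω → Measure X} {A : ℝ} {H : Measure X}
    [IsProbabilityMeasure H] (hP : IsDirichletProcess μ P A H) (hA : 0 < A) {B : Set X}
    (hB : MeasurableSet B) {j : ℕ} (hj : 1 ≤ j) :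
    ∫ ω, (P ω).real B ^ j ∂μ = risingFactorial (A * H.real B) j / risingFactorial A j := by
  rw [integral_eq_lintegral_of_nonneg_ae (ae_of_all _ fun ω => by positivity)
    ((hP.measurable_real hB).pow_const j).aestronglyMeasurable, hP.lintegral_real_pow hA hB hj,
    ENNReal.toReal_ofReal]
  exact div_nonneg (risingFactorial_nonneg (by positivity) j) (risingFactorial_nonneg hA.le j)

/-- Fourth central moments of a Dirichlet process. The factor `H(B) (1 - H(B))` controls the tails
and the factor `A⁻²` makes the bound summable along the sequences of interest. -/
theorem IsDirichletProcess.lintegral_sub_pow_four_le {Ω X : Type*} [MeasurableSpace Ω]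
    [MeasurableSpace X] {μ : Measure Ω} [IsProbabilityMeasure μ] {P : Ω → Measure X} {A : ℝ}
    {H : Measure X} [IsProbabilityMeasure H] (hP : IsDirichletProcess μ P A H) (hA : 0 < A)
    {B : Set X} (hB : MeasurableSet B) :
    ∫⁻ ω, ENNReal.ofReal (((P ω).real B - H.real B) ^ 4) ∂μ ≤
      ENNReal.ofReal (3 * (H.real B * (1 - H.real B)) / A ^ 2) := by
  have hint : ∀ j : ℕ, Integrable (fun ω => (P ω).real B ^ j) μ := by
    intro j
    refine Integrable.of_bound ((hP.measurable_real hB).pow_const j).aestronglyMeasurable 1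
      (ae_of_all _ fun ω => ?_)
    have := hP.isProbabilityMeasure ω
    rw [Real.norm_of_nonneg (by positivity)]
    exact pow_le_one₀ measureReal_nonneg measureReal_le_one
  have hm := fun (j : ℕ) (hj : 1 ≤ j) => hP.integral_real_pow hA hB hj
  set p := H.real B with hp
  have hp0 : 0 ≤ p := measureReal_nonneg
  have hp1 : p ≤ 1 := measureReal_le_one
  have hexp : ∀ ω, ((P ω).real B - p) ^ 4 = (P ω).real B ^ 4 - 4 * p * (P ω).real B ^ 3 +
      6 * p ^ 2 * (P ω).real B ^ 2 - 4 * p ^ 3 * (P ω).real B ^ 1 + p ^ 4 := fun ω => by ring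
  have hint' : Integrable (fun ω => ((P ω).real B - p) ^ 4) μ := by
    simp_rw [hexp]
    exact (((((hint 4).sub ((hint 3).const_mul _)).add ((hint 2).const_mul _)).sub
      ((hint 1).const_mul _)).add (integrable_const _))
  rw [← ofReal_integral_eq_lintegral_ofReal hint' (ae_of_all _ fun ω => by positivity)]
  refine ENNReal.ofReal_le_ofReal ?_
  have i4 := hint 4
  have i3 := (hint 3).const_mul (4 * p)
  have i2 := (hint 2).const_mul (6 * p ^ 2)
  have i1 := (hint 1).const_mul (4 * p ^ 3)
  have s3 : Integrable (fun ω => (P ω).real B ^ 4 - 4 * p * (P ω).real B ^ 3) μ := i4.sub i3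
  have s2 : Integrable (fun ω => (P ω).real B ^ 4 - 4 * p * (P ω).real B ^ 3 +
      6 * p ^ 2 * (P ω).real B ^ 2) μ := s3.add i2
  have s1 : Integrable (fun ω => (P ω).real B ^ 4 - 4 * p * (P ω).real B ^ 3 +
      6 * p ^ 2 * (P ω).real B ^ 2 - 4 * p ^ 3 * (P ω).real B ^ 1) μ := s2.sub i1
  simp_rw [hexp]
  rw [integral_add s1 (integrable_const _), integral_sub s2 i1, integral_add s3 i2,
    integral_sub i4 i3,
    integral_const_mul, integral_const_mul, integral_const_mul, hm 4 (by norm_num),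
    hm 3 (by norm_num), hm 2 (by norm_num), hm 1 le_rfl]
  simp only [risingFactorial, Finset.prod_range_succ, Finset.prod_range_zero, integral_const,
    probReal_univ, smul_eq_mul]
  have key : 3 * (p * (1 - p)) * (p * (1 - p) * (A - 6) + 2) / ((A + 1) * (A + 2) * (A + 3)) ≤
      3 * (p * (1 - p)) / A ^ 2 := by
    have hq : 0 ≤ p * (1 - p) := mul_nonneg hp0 (by linarith)
    have hq1 : p * (1 - p) ≤ 1 := by nlinarith
    rw [div_le_div_iff₀ (by positivity) (by positivity), mul_assoc (3 * (p * (1 - p)))]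
    refine mul_le_mul_of_nonneg_left ?_ (by positivity)
    have h1 : p * (1 - p) * (A - 6) + 2 ≤ A + 2 := by nlinarith
    calc (p * (1 - p) * (A - 6) + 2) * A ^ 2 ≤ (A + 2) * A ^ 2 := by gcongr
      _ ≤ (A + 1) * (A + 2) * (A + 3) := by nlinarith
  refine le_of_eq_of_le ?_ key
  push_cast
  field_simp
  ring

/-! ### The weight `F (1 - F)` -/

theorem measure_cdf_le_le (Q : Measure ℝ) [IsProbabilityMeasure Q] [NullSingletonClass Q] (u : ℝ) :
    Q {t | cdf Q t ≤ u} ≤ ENNReal.ofReal u := by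
  -- up to its greatest element, if any, the set is a directed union of half-lines `Iic q`
  have hsub : {t | cdf Q t ≤ u} ⊆
      (⋃ q : {q : ℚ // cdf Q q ≤ u}, Set.Iic ((q : ℚ) : ℝ)) ∪
        {t | cdf Q t ≤ u ∧ ∀ s, cdf Q s ≤ u → s ≤ t} := by
    intro t ht
    by_cases h : ∀ s, cdf Q s ≤ u → s ≤ t
    · exact Or.inr ⟨ht, h⟩
    · push Not at h
      obtain ⟨s, hs, hts⟩ := h
      obtain ⟨q, hq1, hq2⟩ := exists_rat_btwn hts
      refine Or.inl (Set.mem_iUnion.2 ⟨⟨q, (monotone_cdf Q hq2.le).trans hs⟩, hq1.le⟩)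
  have hnull : Q {t | cdf Q t ≤ u ∧ ∀ s, cdf Q s ≤ u → s ≤ t} = 0 :=
    Set.Subsingleton.measure_zero
      (fun a ha b hb => le_antisymm (hb.2 a ha.1) (ha.2 b hb.1)) Q
  refine (measure_mono hsub).trans ((measure_union_le _ _).trans ?_)
  rw [hnull, add_zero, Directed.measure_iUnion]
  · refine iSup_le fun q => ?_
    rw [← ofReal_cdf]
    exact ENNReal.ofReal_le_ofReal q.2
  · exact Monotone.directed_le fun a b hab => Set.Iic_subset_Iic.2 (by exact_mod_cast hab)

theorem measure_one_sub_cdf_le_le (Q : Measure ℝ) [IsProbabilityMeasure Q] [NullSingletonClass Q]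
    (u : ℝ) : Q {t | 1 - cdf Q t ≤ u} ≤ ENNReal.ofReal u := by
  have hp : IsProbabilityMeasure (Q.map Neg.neg) :=
    Measure.isProbabilityMeasure_map measurable_neg.aemeasurable
  have hn : NullSingletonClass (Q.map Neg.neg) := ⟨fun x => by
    rw [Measure.map_apply measurable_neg (measurableSet_singleton x)]
    refine Set.Subsingleton.measure_zero (fun a ha b hb => ?_) Q
    have ha : -a = x := ha
    have hb : -b = x := hb
    linarith⟩
  have hcdf : ∀ t, cdf (Q.map Neg.neg) t = 1 - cdf Q (-t) := by
    intro t
    rw [cdf_eq_real, cdf_eq_real, ← probReal_compl_eq_one_sub measurableSet_Iic,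
      map_measureReal_apply measurable_neg measurableSet_Iic, measureReal_def, measureReal_def]
    congr 1
    have : Neg.neg ⁻¹' Set.Iic t = Set.Ici (-t) := by
      ext x; simp
    rw [this, Set.compl_Iic]
    exact (measure_congr Ioi_ae_eq_Ici).symm
  have h := measure_cdf_le_le (Q.map Neg.neg) u
  have hm : MeasurableSet {t | cdf (Q.map Neg.neg) t ≤ u} :=
    measurableSet_le (monotone_cdf _).measurable measurable_const
  rw [Measure.map_apply measurable_neg hm] at h
  convert h using 2
  ext t
  simp [hcdf]

/-- A function which is at most `u` with probability at most `u` has finite moments of all orders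
above `-1`. -/
theorem lintegral_rpow_neg_lt_top_of_measure_le {α : Type*} [MeasurableSpace α] {Q : Measure α}
    [IsProbabilityMeasure Q] {f : α → ℝ} (hf : Measurable f) (hf0 : ∀ t, 0 ≤ f t)
    (h : ∀ u, Q {t | f t ≤ u} ≤ ENNReal.ofReal u) {θ : ℝ} (hθ0 : 0 < θ) (hθ1 : θ < 1) :
    ∫⁻ t, ENNReal.ofReal (f t ^ (-θ)) ∂Q < ∞ := by
  have e : ∀ t, f t ^ (-θ) = (f t)⁻¹ ^ θ := fun t => by
    rw [Real.rpow_neg (hf0 t), Real.inv_rpow (hf0 t)]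
  simp_rw [e]
  rw [lintegral_rpow_eq_lintegral_meas_lt_mul Q
    (ae_of_all _ fun t => inv_nonneg.2 (hf0 t)) hf.inv.aemeasurable hθ0]
  refine ENNReal.mul_lt_top ENNReal.ofReal_lt_top ?_
  rw [← Set.Ioc_union_Ioi_eq_Ioi zero_le_one]
  refine (lintegral_union_le _ _ _).trans_lt (ENNReal.add_lt_top.2 ⟨?_, ?_⟩)
  · have hi : IntegrableOn (fun t : ℝ => t ^ (θ - 1)) (Set.Ioc 0 1) := by
      rw [← intervalIntegrable_iff_integrableOn_Ioc_of_le zero_le_one]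
      exact intervalIntegral.intervalIntegrable_rpow' (by linarith)
    refine lt_of_le_of_lt (lintegral_mono fun t => ?_) hi.lintegral_lt_top
    calc _ ≤ 1 * ENNReal.ofReal (t ^ (θ - 1)) := by gcongr; exact prob_le_one
      _ = _ := one_mul _
  · have hi : IntegrableOn (fun t : ℝ => t ^ (θ - 2)) (Set.Ioi 1) :=
      integrableOn_Ioi_rpow_of_lt (by linarith) one_pos
    refine lt_of_le_of_lt (setLIntegral_mono' measurableSet_Ioi fun t ht => ?_)
      hi.lintegral_lt_top
    have ht0 : (0 : ℝ) < t := one_pos.trans ht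
    calc Q {a | t < (f a)⁻¹} * ENNReal.ofReal (t ^ (θ - 1))
        ≤ ENNReal.ofReal t⁻¹ * ENNReal.ofReal (t ^ (θ - 1)) := by
          gcongr
          refine (measure_mono fun a ha => ?_).trans (h t⁻¹)
          have ha : t < (f a)⁻¹ := ha
          have h0 : 0 < f a := inv_pos.1 (ht0.trans ha)
          exact ((lt_inv_comm₀ ht0 h0).1 ha).le
      _ = ENNReal.ofReal (t ^ (θ - 2)) := by
          rw [← ENNReal.ofReal_mul (by positivity), ← Real.rpow_neg_one, ← Real.rpow_add ht0]
          ring_nf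

/-- The weight `F (1 - F)` of the Anderson-Darling distance to the law `Q` with cdf `F`. -/
noncomputable def cdfWeight (Q : Measure ℝ) (t : ℝ) : ℝ := cdf Q t * (1 - cdf Q t)

theorem cdfWeight_nonneg (Q : Measure ℝ) (t : ℝ) : 0 ≤ cdfWeight Q t :=
  mul_nonneg (cdf_nonneg Q t) (sub_nonneg.2 (cdf_le_one Q t))

theorem cdfWeight_le_one (Q : Measure ℝ) (t : ℝ) : cdfWeight Q t ≤ 1 :=
  mul_le_one₀ (cdf_le_one Q t) (sub_nonneg.2 (cdf_le_one Q t)) (by linarith [cdf_nonneg Q t])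

@[fun_prop]
theorem measurable_cdf (Q : Measure ℝ) : Measurable (cdf Q) := (monotone_cdf Q).measurable

@[fun_prop]
theorem measurable_cdfWeight (Q : Measure ℝ) : Measurable (cdfWeight Q) := by
  unfold cdfWeight
  fun_prop

theorem ae_cdfWeight_pos (Q : Measure ℝ) [IsProbabilityMeasure Q] [NullSingletonClass Q] :
    ∀ᵐ t ∂Q, 0 < cdfWeight Q t := by
  have h1 : ∀ᵐ t ∂Q, 0 < cdf Q t := by
    simp only [ae_iff, not_lt]
    simpa using measure_cdf_le_le Q 0
  have h2 : ∀ᵐ t ∂Q, 0 < 1 - cdf Q t := by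
    simp only [ae_iff, not_lt]
    simpa using measure_one_sub_cdf_le_le Q 0
  filter_upwards [h1, h2] with t h1 h2 using mul_pos h1 h2

/-- Since `F` is uniformly distributed under `Q`, the weight `F (1 - F)` has finite moments of all
orders above `-1`. -/
theorem lintegral_cdfWeight_rpow_lt_top (Q : Measure ℝ) [IsProbabilityMeasure Q]
    [NullSingletonClass Q] {p : ℝ} (hp : -1 < p) :
    ∫⁻ t, ENNReal.ofReal (cdfWeight Q t ^ p) ∂Q < ∞ := by
  rcases le_or_gt 0 p with h0 | h0
  · calc _ ≤ ∫⁻ t, 1 ∂Q := by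
          refine lintegral_mono fun t => ?_
          rw [← ENNReal.ofReal_one]
          exact ENNReal.ofReal_le_ofReal
            (Real.rpow_le_one (cdfWeight_nonneg Q t) (cdfWeight_le_one Q t) h0)
      _ < ∞ := by simp
  · obtain ⟨θ, rfl⟩ : ∃ θ, p = -θ := ⟨-p, by ring⟩
    have h1 := lintegral_rpow_neg_lt_top_of_measure_le (measurable_cdf Q) (cdf_nonneg Q)
      (measure_cdf_le_le Q) (θ := θ) (by linarith) (by linarith)
    have h2 := lintegral_rpow_neg_lt_top_of_measure_le (f := fun t => 1 - cdf Q t) (by fun_prop)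
      (fun t => sub_nonneg.2 (cdf_le_one Q t))
      (measure_one_sub_cdf_le_le Q) (θ := θ) (by linarith) (by linarith)
    refine lt_of_le_of_lt ?_ (ENNReal.add_lt_top.2 ⟨h1, h2⟩)
    rw [← lintegral_add_left (by fun_prop)]
    refine lintegral_mono_ae ?_
    filter_upwards [ae_cdfWeight_pos Q] with t ht
    have hF := cdf_nonneg Q t
    have hF' := sub_nonneg.2 (cdf_le_one Q t)
    have hF0 : 0 < cdf Q t := lt_of_le_of_ne hF fun h => by simp [cdfWeight, ← h] at ht
    have hF1 : 0 < 1 - cdf Q t := lt_of_le_of_ne hF' fun h => by simp [cdfWeight, ← h] at ht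
    rw [← ENNReal.ofReal_add (by positivity) (by positivity)]
    refine ENNReal.ofReal_le_ofReal ?_
    rw [Real.rpow_neg ht.le, Real.rpow_neg hF, Real.rpow_neg hF', ← Real.inv_rpow ht.le,
      ← Real.inv_rpow hF, ← Real.inv_rpow hF']
    have : (cdfWeight Q t)⁻¹ = (cdf Q t)⁻¹ + (1 - cdf Q t)⁻¹ := by
      unfold cdfWeight
      field_simp
      ring
    rw [this]
    exact Real.rpow_add_le_add_rpow (by positivity) (by positivity) (by linarith) (by linarith)

theorem ae_tendsto_zero_of_tsum_lintegral_ne_top {α : Type*} [MeasurableSpace α] {μ : Measure α}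
    {f : ℕ → α → ℝ≥0∞} (hf : ∀ n, AEMeasurable (f n) μ) (h : ∑' n, ∫⁻ x, f n x ∂μ ≠ ∞) :
    ∀ᵐ x ∂μ, Tendsto (fun n => f n x) atTop (𝓝 0) := by
  rw [← lintegral_tsum hf] at h
  filter_upwards [ae_lt_top' (AEMeasurable.tsum hf) h] with x hx
  exact ENNReal.tendsto_atTop_zero_of_tsum_ne_top hx.ne

theorem measurable_cdf_uncurry {Ω : Type*} [MeasurableSpace Ω] {P : Ω → Measure ℝ}
    (hP : Measurable P) (hprob : ∀ ω, IsProbabilityMeasure (P ω)) :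
    Measurable fun q : Ω × ℝ => cdf (P q.1) q.2 := by
  let κ : Kernel (Ω × ℝ) ℝ := ⟨fun q => P q.1, hP.comp measurable_fst⟩
  have : IsMarkovKernel κ := ⟨fun q => hprob q.1⟩
  have hs : MeasurableSet {z : (Ω × ℝ) × ℝ | z.2 ≤ z.1.2} :=
    measurableSet_le measurable_snd (measurable_snd.comp measurable_fst)
  have h := (Kernel.measurable_kernel_prodMk_left (κ := κ) hs).ennreal_toReal
  convert h using 2 with q
  have := hprob q.1
  rw [cdf_eq_real]
  rfl

/-! ### Convergence of Dirichlet processes in Anderson-Darling distance -/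

theorem andersonDarling_eq (P Q : Measure ℝ) :
    andersonDarling P Q = ∫⁻ t, ENNReal.ofReal ((cdf P t - cdf Q t) ^ 2) /
      ENNReal.ofReal (cdfWeight Q t) ∂Q := rfl

theorem measurable_andersonDarling {Ω : Type*} [MeasurableSpace Ω] {P : Ω → Measure ℝ}
    (hP : Measurable P) (hprob : ∀ ω, IsProbabilityMeasure (P ω)) (Q : Measure ℝ)
    [IsProbabilityMeasure Q] : Measurable fun ω => andersonDarling (P ω) Q := by
  have := measurable_cdf_uncurry hP hprob
  simp only [andersonDarling_eq]
  refine Measurable.lintegral_prod_right' (f := fun q : Ω × ℝ =>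
    ENNReal.ofReal ((cdf (P q.1) q.2 - cdf Q q.2) ^ 2) / ENNReal.ofReal (cdfWeight Q q.2)) ?_
  fun_prop

/-- Cauchy-Schwarz with the weights `w ^ ((-1 + κ) / 2)` and `w ^ ((-1 - κ) / 2)`. -/
theorem sq_lintegral_sq_div_le {α : Type*} [MeasurableSpace α] {Q : Measure α} {D w : α → ℝ}
    (hD : Measurable D) (hw : Measurable w) (hw0 : ∀ᵐ t ∂Q, 0 < w t) (κ : ℝ) :
    (∫⁻ t, ENNReal.ofReal (D t ^ 2) / ENNReal.ofReal (w t) ∂Q) ^ 2 ≤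
      (∫⁻ t, ENNReal.ofReal (w t ^ (-1 + κ)) ∂Q) *
        ∫⁻ t, ENNReal.ofReal (D t ^ 4 * w t ^ (-1 - κ)) ∂Q := by
  have h := ENNReal.lintegral_mul_le_Lp_mul_Lq Q Real.HolderConjugate.two_two
    (f := fun t => ENNReal.ofReal (w t ^ ((-1 + κ) / 2)))
    (g := fun t => ENNReal.ofReal (D t ^ 2 * w t ^ ((-1 - κ) / 2)))
    (by fun_prop) (by fun_prop)
  have e0 : ∫⁻ t, ENNReal.ofReal (D t ^ 2) / ENNReal.ofReal (w t) ∂Q =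
      ∫⁻ t, ((fun t => ENNReal.ofReal (w t ^ ((-1 + κ) / 2))) *
        (fun t => ENNReal.ofReal (D t ^ 2 * w t ^ ((-1 - κ) / 2)))) t ∂Q := by
    refine lintegral_congr_ae ?_
    filter_upwards [hw0] with t ht
    simp only [Pi.mul_apply]
    rw [← ENNReal.ofReal_div_of_pos ht, ← ENNReal.ofReal_mul (by positivity)]
    congr 1
    rw [mul_left_comm, ← Real.rpow_add ht, div_eq_mul_inv, ← Real.rpow_neg_one]
    ring_nf
  have e1 : ∫⁻ t, ENNReal.ofReal (w t ^ ((-1 + κ) / 2)) ^ (2 : ℝ) ∂Q =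
      ∫⁻ t, ENNReal.ofReal (w t ^ (-1 + κ)) ∂Q := by
    refine lintegral_congr_ae ?_
    filter_upwards [hw0] with t ht
    rw [ENNReal.ofReal_rpow_of_nonneg (by positivity) (by norm_num), ← Real.rpow_mul ht.le]
    ring_nf
  have e2 : ∫⁻ t, ENNReal.ofReal (D t ^ 2 * w t ^ ((-1 - κ) / 2)) ^ (2 : ℝ) ∂Q =
      ∫⁻ t, ENNReal.ofReal (D t ^ 4 * w t ^ (-1 - κ)) ∂Q := by
    refine lintegral_congr_ae ?_
    filter_upwards [hw0] with t ht
    rw [ENNReal.ofReal_rpow_of_nonneg (by positivity) (by norm_num),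
      Real.mul_rpow (by positivity) (by positivity), ← Real.rpow_mul ht.le]
    norm_num
    ring_nf
  rw [← e0, e1, e2] at h
  calc _ ≤ ((∫⁻ t, ENNReal.ofReal (w t ^ (-1 + κ)) ∂Q) ^ (1 / 2 : ℝ) *
        (∫⁻ t, ENNReal.ofReal (D t ^ 4 * w t ^ (-1 - κ)) ∂Q) ^ (1 / 2 : ℝ)) ^ 2 := by gcongr
    _ = _ := by
      rw [mul_pow, ← ENNReal.rpow_natCast, ← ENNReal.rpow_natCast, ← ENNReal.rpow_mul,
        ← ENNReal.rpow_mul]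
      norm_num

theorem IsDirichletProcess.lintegral_cdf_sub_pow_four_le {Ω : Type*} [MeasurableSpace Ω]
    {ν : Measure Ω} [IsProbabilityMeasure ν] {P : Ω → Measure ℝ} {A : ℝ} {H : Measure ℝ}
    [IsProbabilityMeasure H] (hP : IsDirichletProcess ν P A H) (hA : 0 < A) (t : ℝ) :
    ∫⁻ ω, ENNReal.ofReal ((cdf (P ω) t - cdf H t) ^ 4) ∂ν ≤
      ENNReal.ofReal (3 * cdfWeight H t / A ^ 2) := by
  have h := hP.lintegral_sub_pow_four_le hA (measurableSet_Iic (a := t))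
  have := hP.isProbabilityMeasure
  simpa only [cdfWeight, cdf_eq_real] using h

/-- The second moment of the weighted squared fluctuation of a Dirichlet process around its base
measure is of order `A⁻²`, provided that the base measure has light tails with respect to `Q`. -/
theorem IsDirichletProcess.lintegral_sq_fluctuation_le {Ω : Type*} [MeasurableSpace Ω]
    {ν : Measure Ω} [IsProbabilityMeasure ν] {P : Ω → Measure ℝ} {A : ℝ} {H : Measure ℝ}
    [IsProbabilityMeasure H] (hP : IsDirichletProcess ν P A H) (hA : 0 < A)
    {Q : Measure ℝ} [IsProbabilityMeasure Q] [NullSingletonClass Q] {C γ : ℝ} (hC : 0 ≤ C)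
    (hH : ∀ t, cdfWeight H t ≤ C * cdfWeight Q t ^ γ) :
    ∫⁻ ω, (∫⁻ t, ENNReal.ofReal ((cdf (P ω) t - cdf H t) ^ 2) /
        ENNReal.ofReal (cdfWeight Q t) ∂Q) ^ 2 ∂ν ≤
      ENNReal.ofReal (3 * C / A ^ 2) *
        (∫⁻ t, ENNReal.ofReal (cdfWeight Q t ^ (-1 + γ / 2)) ∂Q) ^ 2 := by
  have hm := measurable_cdf_uncurry hP.measurable hP.isProbabilityMeasure
  have hmω : ∀ ω, Measurable fun t => cdf (P ω) t - cdf H t := fun ω => by fun_prop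
  have hm2 : Measurable fun q : Ω × ℝ => ENNReal.ofReal
      ((cdf (P q.1) q.2 - cdf H q.2) ^ 4 * cdfWeight Q q.2 ^ (-1 - γ / 2)) := by fun_prop
  have hmt : ∀ t, Measurable fun ω => ENNReal.ofReal ((cdf (P ω) t - cdf H t) ^ 4) := fun t => by
    have : Measurable fun ω => cdf (P ω) t := hm.comp (measurable_id.prodMk measurable_const)
    fun_prop
  calc _ ≤ ∫⁻ ω, (∫⁻ t, ENNReal.ofReal (cdfWeight Q t ^ (-1 + γ / 2)) ∂Q) *
        ∫⁻ t, ENNReal.ofReal ((cdf (P ω) t - cdf H t) ^ 4 * cdfWeight Q t ^ (-1 - γ / 2)) ∂Q ∂ν :=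
        lintegral_mono fun ω => sq_lintegral_sq_div_le (hmω ω) (measurable_cdfWeight Q)
          (ae_cdfWeight_pos Q) (γ / 2)
    _ = (∫⁻ t, ENNReal.ofReal (cdfWeight Q t ^ (-1 + γ / 2)) ∂Q) *
        ∫⁻ t, ∫⁻ ω, ENNReal.ofReal ((cdf (P ω) t - cdf H t) ^ 4 *
          cdfWeight Q t ^ (-1 - γ / 2)) ∂ν ∂Q := by
        rw [lintegral_const_mul _ (Measurable.lintegral_prod_right' hm2),
          lintegral_lintegral_swap hm2.aemeasurable]
    _ ≤ (∫⁻ t, ENNReal.ofReal (cdfWeight Q t ^ (-1 + γ / 2)) ∂Q) *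
        ∫⁻ t, ENNReal.ofReal (3 * C / A ^ 2) *
          ENNReal.ofReal (cdfWeight Q t ^ (-1 + γ / 2)) ∂Q := by
        gcongr 1
        refine lintegral_mono_ae ?_
        filter_upwards [ae_cdfWeight_pos Q] with t ht
        have : ∀ ω, ENNReal.ofReal ((cdf (P ω) t - cdf H t) ^ 4 * cdfWeight Q t ^ (-1 - γ / 2)) =
            ENNReal.ofReal ((cdf (P ω) t - cdf H t) ^ 4) *
              ENNReal.ofReal (cdfWeight Q t ^ (-1 - γ / 2)) :=
          fun ω => ENNReal.ofReal_mul (by positivity)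
        simp_rw [this]
        rw [lintegral_mul_const _ (hmt t)]
        calc _ ≤ ENNReal.ofReal (3 * (C * cdfWeight Q t ^ γ) / A ^ 2) *
              ENNReal.ofReal (cdfWeight Q t ^ (-1 - γ / 2)) := by
              gcongr
              refine (hP.lintegral_cdf_sub_pow_four_le hA t).trans ?_
              refine ENNReal.ofReal_le_ofReal ?_
              have := hH t
              gcongr
          _ = _ := by
              rw [← ENNReal.ofReal_mul (by positivity), ← ENNReal.ofReal_mul (by positivity)]
              congr 1
              rw [show (-1 + γ / 2) = γ + (-1 - γ / 2) by ring, Real.rpow_add ht]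
              ring
    _ = _ := by
        rw [lintegral_const_mul _ (by fun_prop)]
        ring

theorem tsum_ofReal_div_sq_ne_top {A : ℕ → ℝ} (c : ℝ)
    (hs : Summable fun k => 1 / A k ^ 2) : ∑' k, ENNReal.ofReal (c / A k ^ 2) ≠ ∞ := by
  have := (hs.mul_left c).tsum_ofReal_ne_top
  simpa [div_eq_mul_inv] using this

/-- Along a sequence with `∑ A⁻² < ∞`, the weighted squared fluctuation vanishes almost surely. -/
theorem ae_tendsto_fluctuation {Ω : Type*} [MeasurableSpace Ω]
    {ν : Measure Ω} [IsProbabilityMeasure ν] {P : ℕ → Ω → Measure ℝ} {A : ℕ → ℝ}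
    {H : ℕ → Measure ℝ} [∀ k, IsProbabilityMeasure (H k)]
    (hP : ∀ k, IsDirichletProcess ν (P k) (A k) (H k)) (hA : ∀ k, 0 < A k)
    (hs : Summable fun k => 1 / A k ^ 2)
    {Q : Measure ℝ} [IsProbabilityMeasure Q] [NullSingletonClass Q] {C γ : ℝ} (hC : 0 ≤ C)
    (hγ : 0 < γ) (hH : ∀ k t, cdfWeight (H k) t ≤ C * cdfWeight Q t ^ γ) :
    ∀ᵐ ω ∂ν, Tendsto (fun k => ∫⁻ t, ENNReal.ofReal ((cdf (P k ω) t - cdf (H k) t) ^ 2) /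
        ENNReal.ofReal (cdfWeight Q t) ∂Q) atTop (𝓝 0) := by
  have hmeas : ∀ k, Measurable fun ω => ∫⁻ t, ENNReal.ofReal ((cdf (P k ω) t - cdf (H k) t) ^ 2) /
        ENNReal.ofReal (cdfWeight Q t) ∂Q := fun k => by
    have := measurable_cdf_uncurry (hP k).measurable (hP k).isProbabilityMeasure
    refine Measurable.lintegral_prod_right' (f := fun q : Ω × ℝ =>
      ENNReal.ofReal ((cdf (P k q.1) q.2 - cdf (H k) q.2) ^ 2) /
        ENNReal.ofReal (cdfWeight Q q.2)) ?_
    fun_prop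
  have hsum : ∑' k, ∫⁻ ω, (∫⁻ t, ENNReal.ofReal ((cdf (P k ω) t - cdf (H k) t) ^ 2) /
        ENNReal.ofReal (cdfWeight Q t) ∂Q) ^ 2 ∂ν ≠ ∞ := by
    refine ne_top_of_le_ne_top ?_ (ENNReal.tsum_le_tsum fun k =>
      (hP k).lintegral_sq_fluctuation_le (hA k) hC (hH k))
    rw [ENNReal.tsum_mul_right]
    refine ENNReal.mul_ne_top (tsum_ofReal_div_sq_ne_top _ hs) (ENNReal.pow_ne_top ?_)
    exact (lintegral_cdfWeight_rpow_lt_top Q (by linarith)).ne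
  filter_upwards [ae_tendsto_zero_of_tsum_lintegral_ne_top
    (fun k => ((hmeas k).pow_const 2).aemeasurable) hsum] with ω hω
  have h := (ENNReal.continuous_rpow_const (y := 1 / 2)).continuousAt.tendsto.comp hω
  rw [ENNReal.zero_rpow_of_pos (by norm_num)] at h
  refine h.congr fun k => ?_
  simp only [Function.comp]
  rw [← ENNReal.rpow_natCast, ← ENNReal.rpow_mul]
  norm_num

/-- Along a sequence with `∑ A⁻² < ∞`, the cdfs of the Dirichlet processes almost surely approach
those of the base measures at almost every point. -/
theorem ae_ae_tendsto_cdf_sub {Ω : Type*} [MeasurableSpace Ω]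
    {ν : Measure Ω} [IsProbabilityMeasure ν] {P : ℕ → Ω → Measure ℝ} {A : ℕ → ℝ}
    {H : ℕ → Measure ℝ} [∀ k, IsProbabilityMeasure (H k)]
    (hP : ∀ k, IsDirichletProcess ν (P k) (A k) (H k)) (hA : ∀ k, 0 < A k)
    (hs : Summable fun k => 1 / A k ^ 2) (Q : Measure ℝ) [IsProbabilityMeasure Q] :
    ∀ᵐ ω ∂ν, ∀ᵐ t ∂Q, Tendsto (fun k => cdf (P k ω) t - cdf (H k) t) atTop (𝓝 0) := by
  have hmeas : ∀ k, Measurable fun q : Ω × ℝ =>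
      ENNReal.ofReal ((cdf (P k q.1) q.2 - cdf (H k) q.2) ^ 4) := fun k => by
    have := measurable_cdf_uncurry (hP k).measurable (hP k).isProbabilityMeasure
    fun_prop
  have hsum : ∑' k, ∫⁻ q, ENNReal.ofReal ((cdf (P k q.1) q.2 - cdf (H k) q.2) ^ 4)
      ∂(ν.prod Q) ≠ ∞ := by
    refine ne_top_of_le_ne_top (tsum_ofReal_div_sq_ne_top 3 hs)
      (ENNReal.tsum_le_tsum fun k => ?_)
    rw [lintegral_prod_symm' _ (hmeas k)]
    calc _ ≤ ∫⁻ t, ENNReal.ofReal (3 / A k ^ 2) ∂Q := by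
          refine lintegral_mono fun t => ?_
          refine ((hP k).lintegral_cdf_sub_pow_four_le (hA k) t).trans ?_
          refine ENNReal.ofReal_le_ofReal ?_
          have := cdfWeight_le_one (H k) t
          gcongr
          linarith
      _ = _ := by simp
  refine Measure.ae_ae_of_ae_prod (p := fun q : Ω × ℝ =>
    Tendsto (fun k => cdf (P k q.1) q.2 - cdf (H k) q.2) atTop (𝓝 0)) ?_
  filter_upwards [ae_tendsto_zero_of_tsum_lintegral_ne_top
    (fun k => (hmeas k).aemeasurable) hsum] with q hq
  have h4 : Tendsto (fun k => (cdf (P k q.1) q.2 - cdf (H k) q.2) ^ 4) atTop (𝓝 0) := by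
    have := (ENNReal.tendsto_toReal ENNReal.zero_ne_top).comp hq
    refine this.congr fun k => ?_
    simp only [Function.comp]
    exact ENNReal.toReal_ofReal (by positivity)
  rw [tendsto_zero_iff_abs_tendsto_zero]
  have h := h4.sqrt.sqrt
  simp only [Real.sqrt_zero] at h
  refine h.congr fun k => ?_
  rw [show ∀ x : ℝ, x ^ 4 = (x ^ 2) ^ 2 from fun x => by ring, Real.sqrt_sq (by positivity),
    Real.sqrt_sq_eq_abs]
  rfl

/-- Light tails of `H` with respect to `Q` bound both the weight of `H` and the difference of the
cdfs by a power of the weight of `Q`. -/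
theorem cdf_bounds_of_tail_le {H Q : Measure ℝ} {C γ : ℝ} (hγ0 : 0 < γ) (hγ1 : γ ≤ 1) (hC : 1 ≤ C)
    {t : ℝ} (h1 : cdf H t ≤ C * cdf Q t ^ γ) (h2 : 1 - cdf H t ≤ C * (1 - cdf Q t) ^ γ) :
    cdfWeight H t ≤ 2 * C * cdfWeight Q t ^ γ ∧
      |cdf H t - cdf Q t| ≤ 2 * C * cdfWeight Q t ^ γ := by
  have hH0 := cdf_nonneg H t
  have hH1 := cdf_le_one H t
  have hQ0 := cdf_nonneg Q t
  have hQ1 := cdf_le_one Q t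
  have hw := cdfWeight_nonneg Q t
  have hself : ∀ x : ℝ, 0 ≤ x → x ≤ 1 → x ≤ C * x ^ γ := fun x h0 h1 =>
    calc x = 1 * x ^ (1 : ℝ) := by simp
      _ ≤ C * x ^ γ := by
        gcongr 1
        rcases h0.eq_or_lt with rfl | h0
        · simp [hγ0.ne']
        · exact Real.rpow_le_rpow_of_exponent_ge h0 h1 hγ1
  have key : ∀ x : ℝ, 0 ≤ x → x ≤ 2 * cdfWeight Q t → C * x ^ γ ≤ 2 * C * cdfWeight Q t ^ γ := by
    intro x hx0 hx
    calc C * x ^ γ ≤ C * (2 * cdfWeight Q t) ^ γ := by gcongr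
      _ = C * (2 ^ γ * cdfWeight Q t ^ γ) := by rw [Real.mul_rpow (by norm_num) hw]
      _ ≤ C * (2 ^ (1 : ℝ) * cdfWeight Q t ^ γ) := by gcongr; norm_num
      _ = _ := by rw [Real.rpow_one]; ring
  rcases le_total (cdf Q t) (1 / 2) with h | h
  · have hk := key _ hQ0 (by unfold cdfWeight; nlinarith)
    have hs := hself _ hQ0 hQ1
    refine ⟨?_, ?_⟩
    · refine le_trans ?_ (h1.trans hk)
      unfold cdfWeight; nlinarith
    · rw [abs_le]; constructor <;> linarith
  · have hk := key (1 - cdf Q t) (by linarith) (by unfold cdfWeight; nlinarith)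
    have hs := hself (1 - cdf Q t) (by linarith) (by linarith)
    refine ⟨?_, ?_⟩
    · refine le_trans ?_ (h2.trans hk)
      unfold cdfWeight; nlinarith
    · rw [abs_le]; constructor <;> linarith

/-- The bias converges to `0` by dominated convergence. -/
theorem tendsto_andersonDarling_zero {H : ℕ → Measure ℝ} {Q : Measure ℝ} [IsProbabilityMeasure Q]
    [NullSingletonClass Q] {C γ : ℝ} (hγ : 0 < γ)
    (hH : ∀ k t, |cdf (H k) t - cdf Q t| ≤ C * cdfWeight Q t ^ γ)
    (hlim : ∀ᵐ t ∂Q, Tendsto (fun k => cdf (H k) t) atTop (𝓝 (cdf Q t))) :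
    Tendsto (fun k => andersonDarling (H k) Q) atTop (𝓝 0) := by
  have h0 : ∫⁻ _ : ℝ, (0 : ℝ≥0∞) ∂Q = 0 := by simp
  rw [← h0]
  simp only [andersonDarling_eq]
  refine tendsto_lintegral_of_dominated_convergence
    (fun t => ENNReal.ofReal (C ^ 2) * ENNReal.ofReal (cdfWeight Q t ^ (-1 + 2 * γ)))
    (fun k => by fun_prop) (fun k => ?_) ?_ ?_
  · filter_upwards [ae_cdfWeight_pos Q] with t ht
    rw [← ENNReal.ofReal_div_of_pos ht, ← ENNReal.ofReal_mul (by positivity)]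
    refine ENNReal.ofReal_le_ofReal ?_
    rw [div_le_iff₀ ht]
    calc (cdf (H k) t - cdf Q t) ^ 2 ≤ (C * cdfWeight Q t ^ γ) ^ 2 := by
          rw [← sq_abs (cdf (H k) t - cdf Q t)]
          exact pow_le_pow_left₀ (abs_nonneg _) (hH k t) 2
      _ = C ^ 2 * cdfWeight Q t ^ (-1 + 2 * γ) * cdfWeight Q t ^ (1 : ℝ) := by
          rw [mul_assoc, ← Real.rpow_add ht, mul_pow, ← Real.rpow_natCast (_ ^ γ),
            ← Real.rpow_mul ht.le]
          push_cast
          ring_nf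
      _ = _ := by rw [Real.rpow_one]
  · rw [lintegral_const_mul _ (by fun_prop)]
    exact ENNReal.mul_ne_top ENNReal.ofReal_ne_top
      (lintegral_cdfWeight_rpow_lt_top Q (by linarith)).ne
  · filter_upwards [hlim, ae_cdfWeight_pos Q] with t ht hw
    have h1 : Tendsto (fun k => (cdf (H k) t - cdf Q t) ^ 2 / cdfWeight Q t) atTop (𝓝 0) := by
      have := ((ht.sub_const (cdf Q t)).pow 2).div_const (cdfWeight Q t)
      simpa using this
    have h2 := ENNReal.tendsto_ofReal h1
    rw [ENNReal.ofReal_zero] at h2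
    refine h2.congr fun k => ?_
    rw [ENNReal.ofReal_div_of_pos hw]

/-- Triangle inequality for the Anderson-Darling distance, split at the cdf of `H`. -/
theorem andersonDarling_le_add (P H Q : Measure ℝ) :
    andersonDarling P Q ≤ 2 * (∫⁻ t, ENNReal.ofReal ((cdf P t - cdf H t) ^ 2) /
      ENNReal.ofReal (cdfWeight Q t) ∂Q) + 2 * andersonDarling H Q := by
  simp only [andersonDarling_eq]
  rw [← lintegral_const_mul _ (by fun_prop), ← lintegral_const_mul _ (by fun_prop),
    ← lintegral_add_left (by fun_prop)]
  refine lintegral_mono fun t => ?_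
  simp only [← mul_div_assoc]
  rw [ENNReal.div_add_div_same]
  gcongr
  have h2 : (2 : ℝ≥0∞) = ENNReal.ofReal 2 := by simp
  rw [h2, ← ENNReal.ofReal_mul (by norm_num), ← ENNReal.ofReal_mul (by norm_num),
    ← ENNReal.ofReal_add (by positivity) (by positivity)]
  refine ENNReal.ofReal_le_ofReal ?_
  nlinarith [sq_nonneg ((cdf P t - cdf H t) - (cdf H t - cdf Q t))]

/-- Consistency: Dirichlet processes whose base measures converge to `Q`, with tails dominated by a
power of those of `Q`, converge to `Q` in Anderson-Darling distance. -/
theorem ae_tendsto_andersonDarling {Ω : Type*} [MeasurableSpace Ω]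
    {ν : Measure Ω} [IsProbabilityMeasure ν] {P : ℕ → Ω → Measure ℝ} {A : ℕ → ℝ}
    {H : ℕ → Measure ℝ} [∀ k, IsProbabilityMeasure (H k)]
    (hP : ∀ k, IsDirichletProcess ν (P k) (A k) (H k)) (hA : ∀ k, 0 < A k)
    (hs : Summable fun k => 1 / A k ^ 2)
    {Q : Measure ℝ} [IsProbabilityMeasure Q] [NullSingletonClass Q] {C γ : ℝ} (hC : 1 ≤ C)
    (hγ0 : 0 < γ) (hγ1 : γ ≤ 1)
    (hH : ∀ᶠ k in atTop, ∀ t, cdf (H k) t ≤ C * cdf Q t ^ γ ∧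
      1 - cdf (H k) t ≤ C * (1 - cdf Q t) ^ γ)
    (hlim : ∀ᵐ t ∂Q, Tendsto (fun k => cdf (H k) t) atTop (𝓝 (cdf Q t))) :
    ∀ᵐ ω ∂ν, Tendsto (fun k => andersonDarling (P k ω) Q) atTop (𝓝 0) := by
  obtain ⟨N, hN⟩ := eventually_atTop.1 hH
  have hb := fun k t => cdf_bounds_of_tail_le hγ0 hγ1 hC (hN (k + N) (Nat.le_add_left N k) t).1
    (hN (k + N) (Nat.le_add_left N k) t).2
  have hs' : Summable fun k => 1 / A (k + N) ^ 2 :=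
    (summable_nat_add_iff (f := fun k => 1 / A k ^ 2) N).2 hs
  have hbias := tendsto_andersonDarling_zero (H := fun k => H (k + N)) hγ0
    (fun k t => (hb k t).2) (hlim.mono fun t ht => ht.comp (tendsto_add_atTop_nat N))
  filter_upwards [ae_tendsto_fluctuation (P := fun k => P (k + N)) (A := fun k => A (k + N))
    (H := fun k => H (k + N)) (fun k => hP _) (fun k => hA _) hs'
    (by positivity : (0 : ℝ) ≤ 2 * C) hγ0 (fun k t => (hb k t).1)] with ω hω
  rw [← tendsto_add_atTop_iff_nat N]
  have h0 : Tendsto (fun k => 2 * (∫⁻ t, ENNReal.ofReal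
      ((cdf (P (k + N) ω) t - cdf (H (k + N)) t) ^ 2) / ENNReal.ofReal (cdfWeight Q t) ∂Q) +
      2 * andersonDarling (H (k + N)) Q) atTop (𝓝 (2 * 0 + 2 * 0)) :=
    (ENNReal.Tendsto.const_mul hω (Or.inr (by simp))).add
      (ENNReal.Tendsto.const_mul hbias (Or.inr (by simp)))
  simp only [mul_zero, add_zero] at h0
  exact tendsto_of_tendsto_of_tendsto_of_le_of_le tendsto_const_nhds h0 (fun _ => zero_le)
    fun k => andersonDarling_le_add _ _ _

/-- Lower bound, by Fatou's lemma: if the cdfs of the base measures converge `Q`-almost everywhere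
to that of `R`, the Anderson-Darling distances to `Q` are asymptotically at least that of `R`. -/
theorem ae_andersonDarling_le_liminf {Ω : Type*} [MeasurableSpace Ω]
    {ν : Measure Ω} [IsProbabilityMeasure ν] {P : ℕ → Ω → Measure ℝ} {A : ℕ → ℝ}
    {H : ℕ → Measure ℝ} [∀ k, IsProbabilityMeasure (H k)]
    (hP : ∀ k, IsDirichletProcess ν (P k) (A k) (H k)) (hA : ∀ k, 0 < A k)
    (hs : Summable fun k => 1 / A k ^ 2)
    {Q R : Measure ℝ} [IsProbabilityMeasure Q] [NullSingletonClass Q]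
    (hlim : ∀ᵐ t ∂Q, Tendsto (fun k => cdf (H k) t) atTop (𝓝 (cdf R t))) :
    ∀ᵐ ω ∂ν, andersonDarling R Q ≤ liminf (fun k => andersonDarling (P k ω) Q) atTop := by
  filter_upwards [ae_ae_tendsto_cdf_sub hP hA hs Q] with ω hω
  simp only [andersonDarling_eq]
  refine le_trans ?_ (lintegral_liminf_le fun k => by fun_prop)
  refine lintegral_mono_ae ?_
  filter_upwards [hω, hlim, ae_cdfWeight_pos Q] with t h1 h2 hw
  have h3 : Tendsto (fun k => (cdf (P k ω) t - cdf Q t) ^ 2 / cdfWeight Q t) atTop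
      (𝓝 ((cdf R t - cdf Q t) ^ 2 / cdfWeight Q t)) := by
    have := (((h1.add h2).sub_const (cdf Q t)).pow 2).div_const (cdfWeight Q t)
    simpa using this
  have h4 := ENNReal.tendsto_ofReal h3
  simp only [ENNReal.ofReal_div_of_pos hw] at h4
  exact h4.liminf_eq.ge

/-! ### The posterior base measure and the chi-square law -/

/-- The empirical cdf: the proportion of the `x i` which are at most `t`. -/
noncomputable def empiricalCdf {n : ℕ} (x : Fin n → ℝ) (t : ℝ) : ℝ :=
  (∑ i, if x i ≤ t then (1 : ℝ) else 0) / n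

theorem empiricalCdf_nonneg {n : ℕ} (x : Fin n → ℝ) (t : ℝ) : 0 ≤ empiricalCdf x t :=
  div_nonneg (Finset.sum_nonneg fun i _ => by split_ifs <;> norm_num) (by positivity)

theorem empiricalCdf_le_one {n : ℕ} (x : Fin n → ℝ) (t : ℝ) : empiricalCdf x t ≤ 1 := by
  refine div_le_one_of_le₀ ?_ (by positivity)
  calc _ ≤ ∑ _i : Fin n, (1 : ℝ) := Finset.sum_le_sum fun i _ => by split_ifs <;> norm_num
    _ = n := by simp

theorem one_sub_empiricalCdf {n : ℕ} (hn : n ≠ 0) (x : Fin n → ℝ) (t : ℝ) :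
    1 - empiricalCdf x t = (∑ i, if t < x i then (1 : ℝ) else 0) / n := by
  have hn' : (n : ℝ) ≠ 0 := by exact_mod_cast hn
  rw [empiricalCdf, eq_div_iff hn', sub_mul, div_mul_cancel₀ _ hn', sub_eq_iff_eq_add,
    ← Finset.sum_add_distrib]
  have : ∀ i, (if t < x i then (1 : ℝ) else 0) + (if x i ≤ t then (1 : ℝ) else 0) = 1 := by
    intro i
    rcases lt_or_ge t (x i) with h | h
    · simp [h, not_le.2 h]
    · simp [h, not_lt.2 h]
  simp [this]

theorem empirical_apply {n : ℕ} (x : Fin n → ℝ) (S : Set ℝ) (hS : MeasurableSet S) :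
    empirical x S = (n : ℝ≥0∞)⁻¹ * ∑ i, S.indicator 1 (x i) := by
  simp [empirical, Measure.dirac_apply' _ hS]

theorem isProbabilityMeasure_posteriorBase {a : ℝ} (ha : 0 < a) (H : Measure ℝ)
    [IsProbabilityMeasure H] {n : ℕ} (x : Fin n → ℝ) :
    IsProbabilityMeasure (posteriorBase a H x) := by
  constructor
  rw [posteriorBase]
  simp only [Measure.coe_add, Measure.coe_smul, Pi.add_apply, Pi.smul_apply, measure_univ,
    smul_eq_mul, mul_one, empirical_apply x _ MeasurableSet.univ, Set.indicator_univ,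
    Pi.one_apply, Finset.sum_const, Finset.card_univ, Fintype.card_fin, nsmul_eq_mul]
  rcases Nat.eq_zero_or_pos n with rfl | hn
  · simp [ha.ne']
  · rw [ENNReal.inv_mul_cancel (by simpa using hn.ne') (by simp), mul_one,
      ← ENNReal.ofReal_add (by positivity) (by positivity), ← add_div, div_self (by positivity),
      ENNReal.ofReal_one]

theorem cdf_posteriorBase {a : ℝ} (ha : 0 < a) (H : Measure ℝ) [IsProbabilityMeasure H] {n : ℕ}
    (x : Fin n → ℝ) (t : ℝ) :
    cdf (posteriorBase a H x) t = a / (a + n) * cdf H t + n / (a + n) * empiricalCdf x t := by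
  have := isProbabilityMeasure_posteriorBase ha H x
  have hr : 0 ≤ a / (a + n) * cdf H t + n / (a + n) * empiricalCdf x t :=
    add_nonneg (mul_nonneg (by positivity) (cdf_nonneg H t))
      (mul_nonneg (by positivity) (empiricalCdf_nonneg x t))
  rw [cdf_eq_real, measureReal_def, ← ENNReal.toReal_ofReal hr]
  congr 1
  rw [ENNReal.ofReal_add (mul_nonneg (by positivity) (cdf_nonneg H t))
      (mul_nonneg (by positivity) (empiricalCdf_nonneg x t)), ENNReal.ofReal_mul (by positivity),
    ENNReal.ofReal_mul (by positivity), ofReal_cdf, posteriorBase]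
  simp only [Measure.coe_add, Measure.coe_smul, Pi.add_apply, Pi.smul_apply, smul_eq_mul,
    empirical_apply x _ measurableSet_Iic]
  rcases Nat.eq_zero_or_pos n with rfl | hn
  · simp
  congr 2
  have hn' : (0 : ℝ) < n := by exact_mod_cast hn
  rw [empiricalCdf, ENNReal.ofReal_div_of_pos hn', ENNReal.ofReal_natCast, mul_comm,
    ← div_eq_mul_inv, ENNReal.ofReal_sum_of_nonneg fun i _ => by split_ifs <;> norm_num]
  congr 1
  refine Finset.sum_congr rfl fun i _ => ?_
  by_cases h : x i ≤ t <;> simp [h]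

theorem cdf_posteriorBase_tail_le {a : ℝ} (ha : 0 < a) (H : Measure ℝ) [IsProbabilityMeasure H]
    {n : ℕ} (x : Fin n → ℝ) (t : ℝ) {b₁ b₂ : ℝ} (h1 : cdf H t ≤ b₁) (h1' : empiricalCdf x t ≤ b₁)
    (h2 : 1 - cdf H t ≤ b₂) (h2' : n ≠ 0 → 1 - empiricalCdf x t ≤ b₂) :
    cdf (posteriorBase a H x) t ≤ b₁ ∧ 1 - cdf (posteriorBase a H x) t ≤ b₂ := by
  rw [cdf_posteriorBase ha]
  have hsum : a / (a + n) + n / (a + n) = 1 := by rw [← add_div, div_self (by positivity)]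
  have e : 1 - (a / (a + n) * cdf H t + n / (a + n) * empiricalCdf x t) =
      a / (a + n) * (1 - cdf H t) + n / (a + n) * (1 - empiricalCdf x t) := by
    linear_combination (-1 : ℝ) * hsum
  have e1 : ∀ b : ℝ, b = a / (a + n) * b + n / (a + n) * b := fun b => by
    rw [← add_mul, hsum, one_mul]
  refine ⟨?_, ?_⟩
  · rw [e1 b₁]; gcongr
  · rw [e, e1 b₂]
    rcases Nat.eq_zero_or_pos n with rfl | hn
    · simp only [Nat.cast_zero, zero_div, zero_mul, add_zero]; gcongr
    · have := h2' hn.ne'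
      gcongr

theorem isProbabilityMeasure_chiSquared {m : ℕ} (hm : 1 ≤ m) :
    IsProbabilityMeasure (chiSquared m) :=
  isProbabilityMeasure_gammaMeasure (by positivity) (by norm_num)

instance nullSingletonClass_chiSquared (m : ℕ) : NullSingletonClass (chiSquared m) := by
  unfold chiSquared gammaMeasure
  infer_instance

/-- The normalising constant of the density of the chi-square law. -/
noncomputable def chiSquaredConst (m : ℕ) : ℝ :=
  (1 / 2) ^ ((m : ℝ) / 2) / Real.Gamma ((m : ℝ) / 2)

theorem chiSquaredConst_pos {m : ℕ} (hm : 1 ≤ m) : 0 < chiSquaredConst m := by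
  have := Real.Gamma_pos_of_pos (show 0 < (m : ℝ) / 2 by positivity)
  unfold chiSquaredConst
  positivity

theorem chiSquared_apply {m : ℕ} {S : Set ℝ} (hS : MeasurableSet S) (hpos : S ⊆ Set.Ioi 0) :
    chiSquared m S = ∫⁻ x in S, ENNReal.ofReal
      (chiSquaredConst m * x ^ ((m : ℝ) / 2 - 1) * Real.exp (-(1 / 2 * x))) := by
  rw [chiSquared, ← lintegral_indicator_one hS,
    lintegral_gammaMeasure _ (measurable_one.indicator hS)]
  have : ∀ x, ENNReal.ofReal ((1 / 2) ^ ((m : ℝ) / 2) / Real.Gamma ((m : ℝ) / 2) *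
      x ^ ((m : ℝ) / 2 - 1) * Real.exp (-(1 / 2 * x))) * S.indicator 1 x =
      S.indicator (fun x => ENNReal.ofReal
      (chiSquaredConst m * x ^ ((m : ℝ) / 2 - 1) * Real.exp (-(1 / 2 * x)))) x := by
    intro x
    by_cases h : x ∈ S <;> simp [h, chiSquaredConst]
  simp_rw [this]
  rw [lintegral_indicator hS, Measure.restrict_restrict hS, Set.inter_eq_left.2 hpos]

theorem ae_pos_chiSquared (m : ℕ) : ∀ᵐ x ∂(chiSquared m), 0 < x := ae_pos_gammaMeasure _ _

theorem cdf_chiSquared_of_nonpos {m : ℕ} (hm : 1 ≤ m) {t : ℝ} (ht : t ≤ 0) :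
    cdf (chiSquared m) t = 0 := by
  have := isProbabilityMeasure_chiSquared hm
  have h0 : chiSquared m (Set.Iic 0) = 0 := gammaMeasure_Iic_zero _ _
  rw [cdf_eq_real, measureReal_def, measure_mono_null (Set.Iic_subset_Iic.2 ht) h0,
    ENNReal.toReal_zero]

/-- A lower bound `ρ` for the density gives a lower bound for the mass of an interval. -/
theorem mul_le_chiSquared_Ioc {m : ℕ} {u v ρ : ℝ} (hu : 0 ≤ u)
    (hρ : ∀ x ∈ Set.Ioc u v,
      ρ ≤ chiSquaredConst m * x ^ ((m : ℝ) / 2 - 1) * Real.exp (-(1 / 2 * x))) :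
    ENNReal.ofReal ρ * ENNReal.ofReal (v - u) ≤ chiSquared m (Set.Ioc u v) := by
  rw [chiSquared_apply measurableSet_Ioc fun x hx => lt_of_le_of_lt hu hx.1, ← Real.volume_Ioc]
  rw [← setLIntegral_const]
  exact setLIntegral_mono' measurableSet_Ioc fun x hx => ENNReal.ofReal_le_ofReal (hρ x hx)

theorem chiSquared_Ioc_pos {m : ℕ} (hm : 1 ≤ m) {u v : ℝ} (hu : 0 ≤ u) (huv : u < v) :
    0 < chiSquared m (Set.Ioc u v) := by
  rw [chiSquared_apply measurableSet_Ioc fun x hx => lt_of_le_of_lt hu hx.1,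
    setLIntegral_pos_iff (by fun_prop)]
  have : Set.Ioc u v ⊆ (Function.support fun x : ℝ => ENNReal.ofReal
      (chiSquaredConst m * x ^ ((m : ℝ) / 2 - 1) * Real.exp (-(1 / 2 * x)))) ∩ Set.Ioc u v := by
    intro x hx
    have hx0 : 0 < x := lt_of_le_of_lt hu hx.1
    have := chiSquaredConst_pos hm
    refine ⟨?_, hx⟩
    rw [Function.mem_support]
    exact (ENNReal.ofReal_pos.2 (by positivity)).ne'
  refine lt_of_lt_of_le ?_ (measure_mono this)
  rw [Real.volume_Ioc]
  exact ENNReal.ofReal_pos.2 (by linarith)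

/-- The chi-square cdf decays at most polynomially at `0`. -/
theorem exists_rpow_le_cdf_chiSquared {m : ℕ} (hm : 1 ≤ m) :
    ∃ c, 0 < c ∧ ∀ t, 0 ≤ t → t ≤ 1 → c * t ^ ((m : ℝ) / 2 + 1) ≤ cdf (chiSquared m) t := by
  have hK := chiSquaredConst_pos hm
  have := isProbabilityMeasure_chiSquared hm
  refine ⟨chiSquaredConst m * Real.exp (-(1 / 2)) * (1 / 2) ^ ((m : ℝ) / 2 + 1), by positivity,
    fun t ht0 ht1 => ?_⟩
  rcases ht0.eq_or_lt with rfl | ht0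
  · rw [Real.zero_rpow (by positivity), mul_zero]; exact cdf_nonneg _ _
  have h := mul_le_chiSquared_Ioc (m := m) (u := t / 2) (v := t)
    (ρ := chiSquaredConst m * (t / 2) ^ ((m : ℝ) / 2) * Real.exp (-(1 / 2))) (by positivity)
    (by
      intro x hx
      have hx0 : 0 < x := lt_trans (by positivity) hx.1
      have hx1 : x ≤ 1 := hx.2.trans ht1
      gcongr ?_ * ?_ * Real.exp ?_
      · calc (t / 2) ^ ((m : ℝ) / 2) ≤ x ^ ((m : ℝ) / 2) := by gcongr; exact hx.1.le
          _ ≤ _ := Real.rpow_le_rpow_of_exponent_ge hx0 hx1 (by linarith)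
      · linarith)
  rw [← ENNReal.ofReal_mul (by positivity)] at h
  have h2 := h.trans (measure_mono Set.Ioc_subset_Iic_self)
  rw [← ofReal_cdf, ENNReal.ofReal_le_ofReal_iff (cdf_nonneg _ _)] at h2
  refine le_trans (le_of_eq ?_) h2
  rw [Real.div_rpow ht0.le (by norm_num), Real.rpow_add ht0, Real.rpow_add (by norm_num),
    Real.rpow_one, Real.rpow_one, one_div 2, Real.inv_rpow (by norm_num)]
  ring

/-- The upper tail of the chi-square law decays at most exponentially. -/
theorem exists_exp_le_one_sub_cdf_chiSquared {m : ℕ} (hm : 1 ≤ m) :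
    ∃ c, 0 < c ∧ ∀ t, 0 ≤ t → c * Real.exp (-t) ≤ 1 - cdf (chiSquared m) t := by
  have hK := chiSquaredConst_pos hm
  have := isProbabilityMeasure_chiSquared hm
  refine ⟨chiSquaredConst m * Real.exp (-2), by positivity, fun t ht0 => ?_⟩
  have h := mul_le_chiSquared_Ioc (m := m) (u := t + 1) (v := t + 2)
    (ρ := chiSquaredConst m * Real.exp (-(t + 2))) (by positivity)
    (by
      intro x hx
      have hx1 : 1 ≤ x := by linarith [hx.1]
      have hx0 : 0 < x := by linarith
      have hm' : (1 : ℝ) ≤ m := by exact_mod_cast hm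
      -- `x ^ (m / 2 - 1) ≥ x ^ (-1 / 2) ≥ exp (-x / 2)`
      have h1 : Real.exp (-(1 / 2 * x)) ≤ x ^ ((m : ℝ) / 2 - 1) := by
        calc Real.exp (-(1 / 2 * x)) = Real.exp x ^ (-(1 / 2) : ℝ) := by
              rw [← Real.exp_mul]; ring_nf
          _ ≤ x ^ (-(1 / 2) : ℝ) :=
              Real.rpow_le_rpow_of_nonpos hx0 (by linarith [Real.add_one_le_exp x]) (by norm_num)
          _ ≤ _ := Real.rpow_le_rpow_of_exponent_le hx1 (by linarith)
      calc chiSquaredConst m * Real.exp (-(t + 2)) ≤ chiSquaredConst m * Real.exp (-x) := by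
            gcongr; exact hx.2
        _ = chiSquaredConst m * Real.exp (-(1 / 2 * x)) * Real.exp (-(1 / 2 * x)) := by
            rw [mul_assoc, ← Real.exp_add]; ring_nf
        _ ≤ _ := by gcongr)
  rw [← ENNReal.ofReal_mul (by positivity)] at h
  have hsub : Set.Ioc (t + 1) (t + 2) ⊆ (Set.Iic t)ᶜ := fun x hx => by
    simp only [Set.mem_compl_iff, Set.mem_Iic, not_le]; linarith [hx.1]
  have h2 := h.trans (measure_mono hsub)
  rw [cdf_eq_real, ← probReal_compl_eq_one_sub measurableSet_Iic, measureReal_def]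
  refine le_trans (le_of_eq ?_) ((ENNReal.ofReal_le_iff_le_toReal (measure_ne_top _ _)).1 h2)
  rw [mul_assoc, ← Real.exp_add]
  ring_nf

theorem exists_rpow_mul_exp_neg_le {p : ℝ} (hp : 0 ≤ p) :
    ∃ C, 0 < C ∧ ∀ x : ℝ, 0 < x → x ^ p * Real.exp (-(1 / 2 * x)) ≤ C := by
  obtain ⟨k, hk⟩ := exists_nat_ge p
  refine ⟨1 + k.factorial * 2 ^ k, by positivity, fun x hx => ?_⟩
  have hxk : x ^ p ≤ 1 + x ^ k := by
    rcases le_total x 1 with h | h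
    · have := Real.rpow_le_one hx.le h hp
      have : 0 ≤ x ^ k := by positivity
      linarith
    · have := Real.rpow_le_rpow_of_exponent_le h hk
      rw [Real.rpow_natCast] at this
      linarith
  have h2 : (1 / 2 * x) ^ k / k.factorial ≤ Real.exp (1 / 2 * x) :=
    Real.pow_div_factorial_le_exp _ (by positivity) k
  have h3 : 1 + x ^ k ≤ (1 + k.factorial * 2 ^ k) * Real.exp (1 / 2 * x) := by
    have h1 : 1 ≤ Real.exp (1 / 2 * x) := Real.one_le_exp (by positivity)
    have : x ^ k = (k.factorial * 2 ^ k) * ((1 / 2 * x) ^ k / k.factorial) := by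
      rw [mul_pow, one_div, inv_pow]; field_simp
    rw [this, add_mul, one_mul]
    gcongr
  rw [Real.exp_neg, ← div_eq_mul_inv, div_le_iff₀ (Real.exp_pos _)]
  exact hxk.trans h3

/-- The square root of a chi-square variable has a bounded density. -/
theorem exists_chiSquared_sqrt_near_le {m : ℕ} (hm : 1 ≤ m) :
    ∃ C, 0 ≤ C ∧ ∀ r ε : ℝ, 0 < ε →
      chiSquared m {x | |Real.sqrt x - r| ≤ ε} ≤ ENNReal.ofReal (C * ε) := by
  have hm' : (1 : ℝ) ≤ m := by exact_mod_cast hm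
  have hK := chiSquaredConst_pos hm
  obtain ⟨C, hC0, hC⟩ := exists_rpow_mul_exp_neg_le (p := ((m : ℝ) - 1) / 2) (by linarith)
  refine ⟨chiSquaredConst m * C * 4, by positivity, fun r ε hε => ?_⟩
  rcases lt_or_ge (r + ε) 0 with hneg | hneg
  · have : {x | |Real.sqrt x - r| ≤ ε} = ∅ := by
      ext x
      simp only [Set.mem_ofPred_eq, Set.mem_empty_iff_false, iff_false, not_le, lt_abs]
      left
      linarith [Real.sqrt_nonneg x]
    rw [this, measure_empty]
    exact zero_le
  set a := max (r - ε) 0 with ha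
  set b := r + ε with hb
  have ha0 : 0 ≤ a := le_max_right _ _
  have hab : a ≤ b := max_le (by linarith) hneg
  have hba : b - a ≤ 2 * ε := by have := le_max_left (r - ε) 0; linarith
  have hsq : a ^ 2 ≤ b ^ 2 := by gcongr
  have hsub : {x | |Real.sqrt x - r| ≤ ε} ⊆ (Set.Ioc (a ^ 2) (b ^ 2) ∪ {a ^ 2}) ∪ Set.Iic 0 := by
    intro x hx
    rcases le_or_gt x 0 with h0 | h0
    · exact Or.inr h0
    have hx : |Real.sqrt x - r| ≤ ε := hx
    rw [abs_le] at hx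
    have h1 : a ≤ Real.sqrt x := max_le (by linarith) (Real.sqrt_nonneg x)
    have h2 : Real.sqrt x ≤ b := by linarith
    have h1' : a ^ 2 ≤ x := by
      calc a ^ 2 ≤ Real.sqrt x ^ 2 := by gcongr
        _ = x := Real.sq_sqrt h0.le
    have h2' : x ≤ b ^ 2 := by
      calc x = Real.sqrt x ^ 2 := (Real.sq_sqrt h0.le).symm
        _ ≤ b ^ 2 := by gcongr
    rcases h1'.eq_or_lt with h | h
    · exact Or.inl (Or.inr h.symm)
    · exact Or.inl (Or.inl ⟨h, h2'⟩)
  refine (measure_mono hsub).trans ((measure_union_le _ _).trans ?_)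
  rw [show chiSquared m (Set.Iic 0) = 0 from gammaMeasure_Iic_zero _ _, add_zero]
  refine (measure_union_le _ _).trans ?_
  rw [measure_singleton, add_zero,
    chiSquared_apply measurableSet_Ioc fun x hx => lt_of_le_of_lt (sq_nonneg a) hx.1]
  have hi : IntervalIntegrable (fun x : ℝ => x ^ (-(1 / 2) : ℝ)) volume (a ^ 2) (b ^ 2) :=
    intervalIntegral.intervalIntegrable_rpow' (by norm_num)
  have hval : ∫⁻ x in Set.Ioc (a ^ 2) (b ^ 2), ENNReal.ofReal (x ^ (-(1 / 2) : ℝ)) =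
      ENNReal.ofReal (2 * (b - a)) := by
    rw [← ofReal_integral_eq_lintegral_ofReal
      ((intervalIntegrable_iff_integrableOn_Ioc_of_le hsq).1 hi)]
    · rw [← intervalIntegral.integral_of_le hsq, integral_rpow (Or.inl (by norm_num))]
      have h2 : ∀ c : ℝ, 0 ≤ c → (c ^ 2) ^ (-(1 / 2) + 1 : ℝ) = c := fun c hc => by
        rw [← Real.rpow_natCast, ← Real.rpow_mul hc]; norm_num
      rw [h2 a ha0, h2 b hneg]
      congr 1
      ring
    · filter_upwards [ae_restrict_mem measurableSet_Ioc] with x hx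
      have : 0 < x := lt_of_le_of_lt (sq_nonneg a) hx.1
      positivity
  calc _ ≤ ∫⁻ x in Set.Ioc (a ^ 2) (b ^ 2),
        ENNReal.ofReal (chiSquaredConst m * C) * ENNReal.ofReal (x ^ (-(1 / 2) : ℝ)) := by
        refine setLIntegral_mono' measurableSet_Ioc fun x hx => ?_
        have hx0 : 0 < x := lt_of_le_of_lt (sq_nonneg a) hx.1
        rw [← ENNReal.ofReal_mul (by positivity)]
        refine ENNReal.ofReal_le_ofReal ?_
        have e : x ^ ((m : ℝ) / 2 - 1) = x ^ (((m : ℝ) - 1) / 2) * x ^ (-(1 / 2) : ℝ) := by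
          rw [← Real.rpow_add hx0]; ring_nf
        calc _ = chiSquaredConst m * (x ^ (((m : ℝ) - 1) / 2) * Real.exp (-(1 / 2 * x))) *
              x ^ (-(1 / 2) : ℝ) := by rw [e]; ring
          _ ≤ _ := by gcongr; exact hC x hx0
    _ = ENNReal.ofReal (chiSquaredConst m * C) * ENNReal.ofReal (2 * (b - a)) := by
        rw [lintegral_const_mul _ (by fun_prop), hval]
    _ ≤ _ := by
        rw [← ENNReal.ofReal_mul (by positivity)]
        refine ENNReal.ofReal_le_ofReal ?_
        calc chiSquaredConst m * C * (2 * (b - a)) ≤ chiSquaredConst m * C * (2 * (2 * ε)) := by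
              gcongr
          _ = _ := by ring

theorem integrable_rpow_mul_exp_chiSquared {m : ℕ} (hm : 1 ≤ m) {θ u : ℝ} (hθ : -(1 / 2) < θ)
    (hu : -(1 / 2) < u) :
    Integrable (fun x => x ^ θ * Real.exp (-(u * x))) (chiSquared m) := by
  have hm' : (1 : ℝ) ≤ m := by exact_mod_cast hm
  refine (lintegral_ofReal_ne_top_iff_integrable (by fun_prop) ?_).1 ?_
  · filter_upwards [ae_pos_chiSquared m] with x hx
    have : 0 < x := hx
    positivity
  · rw [chiSquared, lintegral_rpow_mul_exp_gammaMeasure (by positivity) (by norm_num)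
      (by linarith) (by linarith)]
    exact ENNReal.ofReal_ne_top

/-! ### Empirical cdfs of nearly i.i.d. data -/

/-- The strong law of large numbers for a function of the observations. -/
theorem ae_tendsto_average_comp {Ω E : Type*} [MeasurableSpace Ω] [MeasurableSpace E]
    {μ : Measure Ω} {X : ℕ → Ω → E} (hindep : iIndepFun X μ)
    (hident : ∀ i, IdentDistrib (X i) (X 0) μ μ) {g : E → ℝ} (hg : Measurable g)
    (hint : Integrable (fun ω => g (X 0 ω)) μ) :
    ∀ᵐ ω ∂μ, Tendsto (fun n : ℕ => (∑ i : Fin n, g (X i ω)) / n) atTop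
      (𝓝 (∫ ω, g (X 0 ω) ∂μ)) := by
  have h := strong_law_ae_real (fun i ω => g (X i ω)) hint
    (fun i j hij => (hindep.indepFun hij).comp hg hg) (fun i => (hident i).comp hg)
  filter_upwards [h] with ω hω
  refine hω.congr fun n => ?_
  rw [Finset.sum_range]

theorem ae_tendsto_empiricalCdf {Ω : Type*} [MeasurableSpace Ω] {μ : Measure Ω}
    [IsProbabilityMeasure μ] {D : ℕ → Ω → ℝ} (hm : ∀ i, Measurable (D i)) (hindep : iIndepFun D μ)
    {R : Measure ℝ} [IsProbabilityMeasure R] (hR : ∀ i, μ.map (D i) = R) :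
    ∀ᵐ ω ∂μ, ∀ q : ℚ, Tendsto (fun n : ℕ => empiricalCdf (fun i : Fin n => D i ω) q) atTop
      (𝓝 (cdf R q)) := by
  rw [ae_all_iff]
  intro q
  have hS : MeasurableSet (Set.Iic (q : ℝ)) := measurableSet_Iic
  have hg : Measurable ((Set.Iic (q : ℝ)).indicator (1 : ℝ → ℝ)) := measurable_one.indicator hS
  have hid : ∀ i, IdentDistrib (D i) (D 0) μ μ := fun i =>
    ⟨(hm i).aemeasurable, (hm 0).aemeasurable, by rw [hR, hR]⟩
  have hint : Integrable (fun ω => (Set.Iic (q : ℝ)).indicator (1 : ℝ → ℝ) (D 0 ω)) μ := by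
    refine Integrable.of_bound (hg.comp (hm 0)).aestronglyMeasurable 1 (ae_of_all _ fun ω => ?_)
    by_cases h : D 0 ω ≤ q <;> simp [Set.indicator, h]
  have hval : ∫ ω, (Set.Iic (q : ℝ)).indicator (1 : ℝ → ℝ) (D 0 ω) ∂μ = cdf R q := by
    rw [← integral_map (hm 0).aemeasurable hg.aestronglyMeasurable, hR, cdf_eq_real,
      integral_indicator_one hS]
  have h := ae_tendsto_average_comp hindep hid hg hint
  rw [hval] at h
  filter_upwards [h] with ω hω
  refine hω.congr fun n => ?_
  simp [empiricalCdf, Set.indicator]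

theorem empiricalCdf_le_empiricalCdf {n : ℕ} {x y : Fin n → ℝ} {s t : ℝ}
    (h : ∀ i, x i ≤ s → y i ≤ t) : empiricalCdf x s ≤ empiricalCdf y t := by
  unfold empiricalCdf
  gcongr with i
  split_ifs with h1 h2
  · exact le_rfl
  · exact absurd (h i h1) h2
  · norm_num
  · exact le_rfl

/-- The row `d n` approximates the first `n` terms of `D`, uniformly up to an error which is small
relative to `1 + |D i|`. The summand `1` allows for terms of `D` near `0`. -/
def IsApproximation (d : (n : ℕ) → Fin n → ℝ) (D : ℕ → ℝ) : Prop :=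
  ∃ ε : ℕ → ℝ, Tendsto ε atTop (𝓝 0) ∧
    ∀ᶠ n in atTop, ∀ i : Fin n, |d n i - D i| ≤ ε n * (1 + |D i|)

theorem IsApproximation.tendsto_empiricalCdf {d : (n : ℕ) → Fin n → ℝ} {D : ℕ → ℝ}
    (hd : IsApproximation d D) {R : Measure ℝ}
    (hD : ∀ q : ℚ, Tendsto (fun n : ℕ => empiricalCdf (fun i : Fin n => D i) q) atTop
      (𝓝 (cdf R q))) {t : ℝ} (ht : ContinuousAt (cdf R) t) :
    Tendsto (fun n => empiricalCdf (d n) t) atTop (𝓝 (cdf R t)) := by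
  obtain ⟨ε, hε, hd⟩ := hd
  rw [tendsto_order]
  constructor
  · intro u hu
    obtain ⟨δ, hδ, h⟩ := Metric.eventually_nhds_iff.1 (ht.eventually (lt_mem_nhds hu))
    obtain ⟨q, hq1, hq2⟩ := exists_rat_btwn (show t - δ < t by linarith)
    have hqu : u < cdf R q := h (by rw [Real.dist_eq, abs_lt]; constructor <;> linarith)
    have hq0 : 0 < 1 + |(q : ℝ)| := by positivity
    filter_upwards [hd, (tendsto_order.1 (hD q)).1 u hqu,
      hε.eventually (gt_mem_nhds (show 0 < (t - q) / (1 + |(q : ℝ)|) from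
        div_pos (by linarith) hq0)), hε.eventually (gt_mem_nhds one_pos)] with n h1 h2 h3 h4
    refine h2.trans_le (empiricalCdf_le_empiricalCdf fun i hi => ?_)
    have h5 := (abs_le.1 (h1 i)).2
    rw [lt_div_iff₀ hq0] at h3
    have h6 : |D i| ≤ |(q : ℝ)| + (q - D i) := by
      have := abs_sub_abs_le_abs_sub (D i) (q : ℝ)
      rw [abs_sub_comm, abs_of_nonneg (by linarith : (0 : ℝ) ≤ q - D i)] at this
      linarith
    rcases le_total 0 (ε n) with h7 | h7
    · nlinarith [mul_le_mul_of_nonneg_left h6 h7, mul_nonneg (sub_nonneg.2 h4.le)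
        (sub_nonneg.2 hi)]
    · have : ε n * (1 + |D i|) ≤ 0 := mul_nonpos_of_nonpos_of_nonneg h7 (by positivity)
      linarith
  · intro u hu
    obtain ⟨δ, hδ, h⟩ := Metric.eventually_nhds_iff.1 (ht.eventually (gt_mem_nhds hu))
    obtain ⟨q, hq1, hq2⟩ := exists_rat_btwn (show t < t + δ by linarith)
    have hqu : cdf R q < u := h (by rw [Real.dist_eq, abs_lt]; constructor <;> linarith)
    have hq0 : 0 < 1 + |(q : ℝ)| := by positivity
    filter_upwards [hd, (tendsto_order.1 (hD q)).2 u hqu,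
      hε.eventually (gt_mem_nhds (show 0 < (q - t) / (1 + |(q : ℝ)|) from
        div_pos (by linarith) hq0)), hε.eventually (gt_mem_nhds one_pos)] with n h1 h2 h3 h4
    refine lt_of_le_of_lt (empiricalCdf_le_empiricalCdf fun i hi => ?_) h2
    by_contra! hlt
    have h5 := (abs_le.1 (h1 i)).1
    rw [lt_div_iff₀ hq0] at h3
    have h6 : |D i| ≤ |(q : ℝ)| + (D i - q) := by
      have := abs_sub_abs_le_abs_sub (D i) (q : ℝ)
      rw [abs_of_nonneg (by linarith : (0 : ℝ) ≤ D i - q)] at this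
      linarith
    rcases le_total 0 (ε n) with h7 | h7
    · nlinarith [mul_le_mul_of_nonneg_left h6 h7, mul_nonneg (sub_nonneg.2 h4.le)
        (sub_nonneg.2 hlt.le)]
    · have : ε n * (1 + |D i|) ≤ 0 := mul_nonpos_of_nonpos_of_nonneg h7 (by positivity)
      linarith

theorem ae_continuousAt_cdf (R Q : Measure ℝ) [NullSingletonClass Q] :
    ∀ᵐ t ∂Q, ContinuousAt (cdf R) t := by
  rw [ae_iff]
  exact (monotone_cdf R).countable_not_continuousAt.measure_zero Q

theorem tendsto_cdf_posteriorBase {a : ℝ} (ha : 0 < a) (H : Measure ℝ) [IsProbabilityMeasure H]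
    {d : (n : ℕ) → Fin n → ℝ} {t L : ℝ}
    (hd : Tendsto (fun n => empiricalCdf (d n) t) atTop (𝓝 L)) :
    Tendsto (fun n => cdf (posteriorBase a H (d n)) t) atTop (𝓝 L) := by
  have h1 : Tendsto (fun n : ℕ => a / (a + n)) atTop (𝓝 0) :=
    tendsto_const_nhds.div_atTop (tendsto_atTop_add_const_left _ _ tendsto_natCast_atTop_atTop)
  have h2 : Tendsto (fun n : ℕ => (n : ℝ) / (a + n)) atTop (𝓝 1) := by
    have := (tendsto_const_nhds (x := (1 : ℝ))).sub h1
    rw [sub_zero] at this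
    refine this.congr fun n => ?_
    have : a + (n : ℝ) ≠ 0 := by positivity
    field_simp
    ring
  have h := (h1.mul_const (cdf H t)).add (h2.mul hd)
  rw [zero_mul, one_mul, zero_add] at h
  exact h.congr fun n => (cdf_posteriorBase ha H (d n) t).symm

/-- A law other than the chi-square law has positive Anderson-Darling distance from it: the
chi-square law charges every interval of the positive half-line, so cdfs which agree almost
everywhere agree on `[0, ∞)`, and then also on `(-∞, 0)`, where both vanish. -/
theorem andersonDarling_chiSquared_pos {m : ℕ} (hm : 1 ≤ m) {R : Measure ℝ}
    [IsProbabilityMeasure R] (hR : R ≠ chiSquared m) : 0 < andersonDarling R (chiSquared m) := by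
  have := isProbabilityMeasure_chiSquared hm
  rw [pos_iff_ne_zero]
  intro h0
  rw [andersonDarling_eq, lintegral_eq_zero_iff (by fun_prop)] at h0
  have hae : ∀ᵐ t ∂(chiSquared m), cdf R t = cdf (chiSquared m) t := by
    filter_upwards [h0] with t ht
    simp only [Pi.zero_apply, ENNReal.div_eq_zero_iff, ENNReal.ofReal_eq_zero,
      ENNReal.ofReal_ne_top, or_false] at ht
    exact sub_eq_zero.1 (pow_eq_zero_iff two_ne_zero |>.1 (le_antisymm ht (sq_nonneg _)))
  have hnonneg : ∀ t, 0 ≤ t → cdf R t = cdf (chiSquared m) t := by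
    intro t ht
    by_contra hne
    have hcont : ContinuousWithinAt (fun s => cdf R s - cdf (chiSquared m) s) (Set.Ici t) t :=
      ((cdf R).right_continuous t).sub ((cdf (chiSquared m)).right_continuous t)
    have hev := hcont.eventually (isOpen_ne.mem_nhds (sub_ne_zero.2 hne))
    obtain ⟨u, hu, hsub⟩ := (mem_nhdsGE_iff_exists_Icc_subset).1 hev
    have hpos := chiSquared_Ioc_pos hm ht hu
    refine hpos.ne' (measure_mono_null (fun s hs => ?_) hae)
    exact sub_ne_zero.1 (hsub (Set.Ioc_subset_Icc_self hs))
  refine hR ((Measure.cdf_eq_iff R (chiSquared m)).1 (StieltjesFunction.ext fun t => ?_))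
  rcases le_total 0 t with ht | ht
  · exact hnonneg t ht
  · have h := cdf_chiSquared_of_nonpos hm ht
    rw [h]
    refine le_antisymm ?_ (cdf_nonneg R t)
    calc cdf R t ≤ cdf R 0 := monotone_cdf R ht
      _ = 0 := by rw [hnonneg 0 le_rfl, cdf_chiSquared_of_nonpos hm le_rfl]

theorem summable_one_div_add_nat_sq {a : ℝ} (ha : 0 < a) :
    Summable fun n : ℕ => 1 / (a + n) ^ 2 := by
  rw [← summable_nat_add_iff 1]
  have h : Summable fun n : ℕ => 1 / ((n + 1 : ℕ) : ℝ) ^ 2 :=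
    (summable_nat_add_iff 1).2 (Real.summable_one_div_nat_pow.2 one_lt_two)
  refine Summable.of_nonneg_of_le (fun n => by positivity) (fun n => ?_) h
  gcongr
  linarith

/-! ### Sample Mahalanobis distances -/

open scoped MatrixOrder Matrix.Norms.L2Operator in
/-- A whitening matrix: `B` with `S⁻¹ = Bᵀ B`. -/
theorem exists_transpose_mul_self_eq_inv {m : ℕ} {S : Matrix (Fin m) (Fin m) ℝ} (hS : S.PosDef) :
    ∃ B : Matrix (Fin m) (Fin m) ℝ, S⁻¹ = B.transpose * B ∧ IsUnit B.det := by
  obtain ⟨B, hB⟩ := CStarAlgebra.nonneg_iff_eq_star_mul_self.mp hS.inv.posSemidef.nonneg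
  rw [Matrix.star_eq_conjTranspose, Matrix.conjTranspose_eq_transpose_of_trivial] at hB
  refine ⟨B, hB, ?_⟩
  have h := hS.inv.det_pos
  rw [hB, Matrix.det_mul] at h
  exact isUnit_iff_ne_zero.2 (right_ne_zero_of_mul h.ne')

/-- The whitened vector `B (y - c)`. -/
noncomputable def whiten {m : ℕ} (B : Matrix (Fin m) (Fin m) ℝ) (c y : Fin m → ℝ) :
    EuclideanSpace ℝ (Fin m) :=
  WithLp.toLp 2 (B.mulVec (y - c))

theorem norm_whiten_sq {m : ℕ} (B : Matrix (Fin m) (Fin m) ℝ) (c y : Fin m → ℝ) :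
    ‖whiten B c y‖ ^ 2 =
      dotProduct (y - c) (Matrix.mulVec (B.transpose * B) (y - c)) := by
  rw [EuclideanSpace.norm_sq_eq, ← Matrix.mulVec_mulVec, Matrix.dotProduct_mulVec,
    Matrix.vecMul_transpose]
  simp [whiten, dotProduct, sq]

theorem mahalanobisSq_eq_norm_whiten_sq {m : ℕ} {S B : Matrix (Fin m) (Fin m) ℝ}
    (hB : S⁻¹ = B.transpose * B) (c y : Fin m → ℝ) :
    mahalanobisSq S c y = ‖whiten B c y‖ ^ 2 := by
  rw [norm_whiten_sq, mahalanobisSq, hB]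

theorem abs_dotProduct_mulVec_le {m : ℕ} (N : Matrix (Fin m) (Fin m) ℝ)
    (z : EuclideanSpace ℝ (Fin m)) :
    |dotProduct z (N.mulVec z)| ≤ (∑ r, ∑ s, |N r s|) * ‖z‖ ^ 2 := by
  simp only [dotProduct, Matrix.mulVec, Finset.mul_sum, Finset.sum_mul]
  refine (Finset.abs_sum_le_sum_abs _ _).trans (Finset.sum_le_sum fun r _ => ?_)
  refine (Finset.abs_sum_le_sum_abs _ _).trans (Finset.sum_le_sum fun s _ => ?_)
  have h1 := PiLp.norm_apply_le z r
  have h2 := PiLp.norm_apply_le z s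
  rw [Real.norm_eq_abs] at h1 h2
  calc |z r * (N r s * z s)| = |N r s| * (|z r| * |z s|) := by rw [abs_mul, abs_mul]; ring
    _ ≤ |N r s| * (‖z‖ * ‖z‖) := by gcongr
    _ = _ := by ring

/-- If the matrices `S n` converge to `S`, then the squared Mahalanobis distances with respect to
`S n` have uniformly small relative error. -/
theorem exists_tendsto_abs_mahalanobisSq_sub_le {m : ℕ} {S B : Matrix (Fin m) (Fin m) ℝ}
    (hS : IsUnit S.det) (hB : S⁻¹ = B.transpose * B) (hB' : IsUnit B.det)
    {T : ℕ → Matrix (Fin m) (Fin m) ℝ} (hT : Tendsto T atTop (𝓝 S)) :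
    ∃ ε : ℕ → ℝ, Tendsto ε atTop (𝓝 0) ∧ (∀ n, 0 ≤ ε n) ∧ ∀ n c y,
      |mahalanobisSq (T n) c y - ‖whiten B c y‖ ^ 2| ≤ ε n * ‖whiten B c y‖ ^ 2 := by
  let N : ℕ → Matrix (Fin m) (Fin m) ℝ := fun n => B⁻¹.transpose * ((T n)⁻¹ - S⁻¹) * B⁻¹
  have hinv : Tendsto (fun n => (T n)⁻¹) atTop (𝓝 S⁻¹) := by
    have hc : ContinuousAt Ring.inverse S.det := by
      obtain ⟨u, hu⟩ := hS
      rw [← hu]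
      exact NormedRing.inverse_continuousAt u
    exact (continuousAt_matrix_inv S hc).tendsto.comp hT
  have hN : Tendsto N atTop (𝓝 0) := by
    have h1 : Tendsto (fun n => (T n)⁻¹ - S⁻¹) atTop (𝓝 0) := by
      simpa using hinv.sub_const S⁻¹
    have hc : Continuous fun M : Matrix (Fin m) (Fin m) ℝ => B⁻¹.transpose * M * B⁻¹ := by
      fun_prop
    have := (hc.tendsto 0).comp h1
    simpa [Function.comp_def] using this
  refine ⟨fun n => ∑ r, ∑ s, |N n r s|, ?_, fun n => by positivity, fun n c y => ?_⟩
  · have hc : Continuous fun M : Matrix (Fin m) (Fin m) ℝ => ∑ r, ∑ s, |M r s| := by fun_prop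
    have := (hc.tendsto 0).comp hN
    simpa [Function.comp_def] using this
  · have hv : B⁻¹.mulVec (B.mulVec (y - c)) = y - c := by
      rw [Matrix.mulVec_mulVec, Matrix.nonsing_inv_mul _ hB', Matrix.one_mulVec]
    have h := abs_dotProduct_mulVec_le (N n) (whiten B c y)
    convert h using 2
    rw [norm_whiten_sq, mahalanobisSq, ← hB, ← dotProduct_sub, ← Matrix.sub_mulVec]
    simp only [N, whiten]
    rw [← Matrix.mulVec_mulVec, hv, ← Matrix.mulVec_mulVec,
      Matrix.dotProduct_mulVec _ B⁻¹.transpose, Matrix.vecMul_transpose, hv]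

/-- The mean of the first `n` terms of a sequence of vectors. -/
noncomputable def vecMean {E : Type*} [AddCommGroup E] [Module ℝ E] (Z : ℕ → E) (n : ℕ) : E :=
  (n : ℝ)⁻¹ • ∑ i ∈ Finset.range n, Z i

theorem whiten_sampleMean {m : ℕ} (B : Matrix (Fin m) (Fin m) ℝ) (c : Fin m → ℝ)
    (y : ℕ → Fin m → ℝ) {n : ℕ} (hn : n ≠ 0) (v : Fin m → ℝ) :
    whiten B (sampleMean fun j : Fin n => y j) v =
      whiten B c v - vecMean (fun i => whiten B c (y i)) n := by
  have hn' : (n : ℝ) ≠ 0 := by exact_mod_cast hn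
  have hmean : vecMean (fun i => whiten B c (y i)) n =
      whiten B c (sampleMean fun j : Fin n => y j) := by
    have h1 : sampleMean (fun j : Fin n => y j) - c =
        (n : ℝ)⁻¹ • ∑ i ∈ Finset.range n, (y i - c) := by
      funext r
      simp only [sampleMean, Pi.sub_apply, Pi.smul_apply, Finset.sum_apply, smul_eq_mul,
        Finset.sum_sub_distrib, Finset.sum_const, Finset.card_range, nsmul_eq_mul,
        Pi.mul_apply, Pi.natCast_apply]
      rw [Finset.sum_range]
      field_simp
    rw [whiten, h1, vecMean]
    simp only [whiten]
    rw [Matrix.mulVec_smul, WithLp.toLp_smul, Matrix.mulVec_sum, WithLp.toLp_sum]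
  rw [hmean]
  simp only [whiten]
  rw [← WithLp.toLp_sub, ← Matrix.mulVec_sub]
  congr 2
  abel

theorem sampleCov_apply_eq {m n : ℕ} (hn : n ≠ 0) (y : Fin n → Fin m → ℝ) (r s : Fin m) :
    sampleCov y r s = (n : ℝ) / ((n : ℝ) - 1) *
      ((∑ i, y i r * y i s) / n - sampleMean y r * sampleMean y s) := by
  have hn' : (n : ℝ) ≠ 0 := by exact_mod_cast hn
  have hr : ∑ i, y i r = n * sampleMean y r := by rw [sampleMean]; field_simp
  have hs : ∑ i, y i s = n * sampleMean y s := by rw [sampleMean]; field_simp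
  have : ∑ i, (y i r - sampleMean y r) * (y i s - sampleMean y s) =
      ∑ i, y i r * y i s - n * (sampleMean y r * sampleMean y s) := by
    simp only [sub_mul, mul_sub, Finset.sum_sub_distrib, ← Finset.mul_sum, ← Finset.sum_mul, hr,
      hs, Finset.sum_const, Finset.card_univ, Fintype.card_fin, nsmul_eq_mul]
    ring
  simp only [sampleCov, Matrix.of_apply]
  rw [this]
  field_simp

theorem memLp_apply_of_memLp {Ω : Type*} [MeasurableSpace Ω] {μ : Measure Ω} {m : ℕ}
    {Y : Ω → Fin m → ℝ} {p : ℝ≥0∞} (hY : Measurable Y) (h : MemLp Y p μ) (r : Fin m) :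
    MemLp (fun ω => Y ω r) p μ :=
  h.of_le ((measurable_pi_apply r).comp hY).aestronglyMeasurable
    (ae_of_all _ fun ω => norm_le_pi_norm (Y ω) r)

/-- Consistency of the sample mean and the sample covariance matrix. -/
theorem ae_tendsto_sampleMean_sampleCov {Ω : Type*} [MeasurableSpace Ω] {μ : Measure Ω}
    [IsProbabilityMeasure μ] {m : ℕ} {Y : ℕ → Ω → Fin m → ℝ} (hm : ∀ i, Measurable (Y i))
    (hindep : iIndepFun Y μ) (hident : ∀ i, IdentDistrib (Y i) (Y 0) μ μ)
    (hL2 : MemLp (Y 0) 2 μ) :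
    ∀ᵐ ω ∂μ, Tendsto (fun n => sampleMean fun j : Fin n => Y j ω) atTop
        (𝓝 (meanVector μ (Y 0))) ∧
      Tendsto (fun n => sampleCov fun j : Fin n => Y j ω) atTop (𝓝 (covMatrix μ (Y 0))) := by
  have hL := fun r => memLp_apply_of_memLp (hm 0) hL2 r
  have h1 : ∀ᵐ ω ∂μ, ∀ r, Tendsto (fun n : ℕ => (∑ i : Fin n, Y i ω r) / n) atTop
      (𝓝 (∫ ω, Y 0 ω r ∂μ)) := by
    rw [ae_all_iff]
    intro r
    exact ae_tendsto_average_comp (g := fun y => y r) hindep hident (measurable_pi_apply r)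
      ((hL r).integrable one_le_two)
  have h2 : ∀ᵐ ω ∂μ, ∀ r s, Tendsto (fun n : ℕ => (∑ i : Fin n, Y i ω r * Y i ω s) / n) atTop
      (𝓝 (∫ ω, Y 0 ω r * Y 0 ω s ∂μ)) := by
    rw [ae_all_iff]
    intro r
    rw [ae_all_iff]
    intro s
    exact ae_tendsto_average_comp (g := fun y => y r * y s) hindep hident
      ((measurable_pi_apply r).mul (measurable_pi_apply s)) ((hL r).integrable_mul (hL s))
  filter_upwards [h1, h2] with ω h1 h2
  refine ⟨tendsto_pi_nhds.2 h1, ?_⟩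
  refine tendsto_pi_nhds.2 fun r => tendsto_pi_nhds.2 fun s => ?_
  have hcov : covMatrix μ (Y 0) r s = 1 * ((∫ ω, Y 0 ω r * Y 0 ω s ∂μ) -
      (∫ ω, Y 0 ω r ∂μ) * ∫ ω, Y 0 ω s ∂μ) := by
    rw [one_mul, covMatrix, Matrix.of_apply, covariance_eq_sub (hL r) (hL s)]
    rfl
  have h3 : Tendsto (fun n : ℕ => (n : ℝ) / ((n : ℝ) - 1)) atTop (𝓝 1) := by
    have h := (tendsto_natCast_div_add_atTop (𝕜 := ℝ) (-1))
    simpa [sub_eq_add_neg] using h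
  rw [hcov]
  refine (h3.mul ((h2 r s).sub ((h1 r).mul (h1 s)))).congr' ?_
  filter_upwards [eventually_ne_atTop 0] with n hn
  rw [sampleCov_apply_eq hn]
  rfl

/-- The squared sample Mahalanobis distances have uniformly small relative error as approximations
of the squared norms of the centred whitened observations. -/
theorem exists_abs_mahalanobisSq_sample_sub_le {m : ℕ} {S B : Matrix (Fin m) (Fin m) ℝ}
    (hS : IsUnit S.det) (hB : S⁻¹ = B.transpose * B) (hB' : IsUnit B.det) (c : Fin m → ℝ)
    {y : ℕ → Fin m → ℝ} (hT : Tendsto (fun n => sampleCov fun j : Fin n => y j) atTop (𝓝 S)) :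
    ∃ ε : ℕ → ℝ, Tendsto ε atTop (𝓝 0) ∧ (∀ n, 0 ≤ ε n) ∧ ∀ (n : ℕ) (i : Fin n),
      |mahalanobisSq (sampleCov fun j : Fin n => y j) (sampleMean fun j : Fin n => y j) (y i) -
        ‖whiten B c (y i) - vecMean (fun i => whiten B c (y i)) n‖ ^ 2| ≤
      ε n * ‖whiten B c (y i) - vecMean (fun i => whiten B c (y i)) n‖ ^ 2 := by
  obtain ⟨ε, h1, h2, h3⟩ := exists_tendsto_abs_mahalanobisSq_sub_le hS hB hB' hT
  refine ⟨ε, h1, h2, fun n i => ?_⟩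
  have hn : n ≠ 0 := fun h => by subst h; exact i.elim0
  have h := h3 n (sampleMean fun j : Fin n => y j) (y i)
  rwa [whiten_sampleMean B c y hn] at h

/-- Squared distances from a vanishing sequence of centres approximate squared norms. -/
theorem isApproximation_of_norm_sub_sq {E : Type*} [NormedAddCommGroup E] {Z : ℕ → E}
    {b : ℕ → E} (hb : Tendsto b atTop (𝓝 0)) {ε : ℕ → ℝ} (hε : Tendsto ε atTop (𝓝 0))
    (hε0 : ∀ n, 0 ≤ ε n) {d : (n : ℕ) → Fin n → ℝ}
    (hd : ∀ n (i : Fin n), |d n i - ‖Z i - b n‖ ^ 2| ≤ ε n * ‖Z i - b n‖ ^ 2) :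
    IsApproximation d fun i => ‖Z i‖ ^ 2 := by
  have hρ : Tendsto (fun n => ‖b n‖) atTop (𝓝 0) := by simpa using hb.norm
  refine ⟨fun n => 2 * ε n * (1 + ‖b n‖ ^ 2) + 2 * ‖b n‖ + ‖b n‖ ^ 2, ?_, ?_⟩
  · have := (((hε.const_mul 2).mul ((hρ.pow 2).const_add 1)).add (hρ.const_mul 2)).add (hρ.pow 2)
    simpa using this
  · refine Eventually.of_forall fun n i => ?_
    have h1 := norm_sub_le (Z i) (b n)
    have h2 := abs_norm_sub_norm_le (Z i) (Z i - b n)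
    rw [sub_sub_cancel, abs_le] at h2
    set z := ‖Z i‖
    set u := ‖Z i - b n‖
    set ρ := ‖b n‖
    have hz : 0 ≤ z := norm_nonneg _
    have hu : 0 ≤ u := norm_nonneg _
    have hρ0 : 0 ≤ ρ := norm_nonneg _
    have he := hε0 n
    have h3 : u ^ 2 ≤ 2 * (1 + ρ ^ 2) * (1 + z ^ 2) := by
      have : u ^ 2 ≤ (z + ρ) ^ 2 := by gcongr
      nlinarith [sq_nonneg (z - ρ), mul_nonneg (sq_nonneg z) (sq_nonneg ρ)]
    have hzz : 2 * z ≤ 1 + z ^ 2 := by nlinarith [sq_nonneg (z - 1)]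
    have h4 : |u ^ 2 - z ^ 2| ≤ (2 * ρ + ρ ^ 2) * (1 + z ^ 2) := by
      have e : u ^ 2 - z ^ 2 = (u - z) * (u + z) := by ring
      rw [e, abs_mul, abs_of_nonneg (by positivity : 0 ≤ u + z)]
      calc |u - z| * (u + z) ≤ ρ * (2 * z + ρ) :=
            mul_le_mul (abs_le.2 ⟨by linarith, by linarith⟩) (by linarith) (by positivity) hρ0
        _ ≤ _ := by nlinarith [mul_nonneg hρ0 (sub_nonneg.2 hzz), mul_nonneg hρ0 (sq_nonneg z),
            mul_nonneg (sq_nonneg ρ) (sq_nonneg z)]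
    have habs : |z ^ 2| = z ^ 2 := abs_of_nonneg (sq_nonneg z)
    rw [habs]
    calc |d n i - z ^ 2| ≤ |d n i - u ^ 2| + |u ^ 2 - z ^ 2| := abs_sub_le _ _ _
      _ ≤ ε n * (2 * (1 + ρ ^ 2) * (1 + z ^ 2)) + (2 * ρ + ρ ^ 2) * (1 + z ^ 2) := by
        refine add_le_add ((hd n i).trans ?_) h4
        gcongr
      _ = _ := by ring

/-! ### Rates: the norm of the mean and its distance to the observations -/

theorem integrable_pow_of_integrable_pow_four {Ω : Type*} [MeasurableSpace Ω] {μ : Measure Ω}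
    [IsFiniteMeasure μ] {X : Ω → ℝ} (hX : Measurable X) (h : Integrable (fun ω => X ω ^ 4) μ)
    {k : ℕ} (hk : k ≤ 4) : Integrable (fun ω => X ω ^ k) μ := by
  refine ((integrable_const (1 : ℝ)).add h).mono' (hX.pow_const k).aestronglyMeasurable
    (ae_of_all _ fun ω => ?_)
  rw [Real.norm_eq_abs, abs_pow, Pi.add_apply]
  have h4 : X ω ^ 4 = |X ω| ^ 4 := by rw [← abs_pow, abs_of_nonneg (by positivity)]
  rw [h4]
  rcases le_total |X ω| 1 with h1 | h1
  · have := pow_le_one₀ (n := k) (abs_nonneg (X ω)) h1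
    have : 0 ≤ |X ω| ^ 4 := by positivity
    linarith
  · have := pow_le_pow_right₀ h1 hk
    linarith

/-- The fourth moment of a sum of `n` independent centred variables with a common law is of order
`n ^ 2`. -/
theorem exists_integral_sum_pow_four_le {Ω : Type*} [MeasurableSpace Ω] {μ : Measure Ω}
    [IsProbabilityMeasure μ] {W : ℕ → Ω → ℝ} (hm : ∀ i, Measurable (W i)) (hindep : iIndepFun W μ)
    (hident : ∀ i, IdentDistrib (W i) (W 0) μ μ) (hmean : ∫ ω, W 0 ω ∂μ = 0)
    (h4 : Integrable (fun ω => W 0 ω ^ 4) μ) :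
    ∃ K : ℝ, 0 ≤ K ∧ ∀ n : ℕ, Integrable (fun ω => (∑ i ∈ Finset.range n, W i ω) ^ 4) μ ∧
      ∫ ω, (∑ i ∈ Finset.range n, W i ω) ^ 4 ∂μ ≤ K * n ^ 2 := by
  set σ := ∫ ω, W 0 ω ^ 2 ∂μ with hσ
  set κ := ∫ ω, W 0 ω ^ 4 ∂μ with hκ
  have hσ0 : 0 ≤ σ := integral_nonneg fun ω => by positivity
  have hκ0 : 0 ≤ κ := integral_nonneg fun ω => by positivity
  have hpow : ∀ i k, IdentDistrib (fun ω => W i ω ^ k) (fun ω => W 0 ω ^ k) μ μ := fun i k =>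
    (hident i).comp (measurable_id.pow_const k)
  have key : ∀ n : ℕ, Integrable (fun ω => (∑ i ∈ Finset.range n, W i ω) ^ 4) μ ∧
      ∫ ω, (∑ i ∈ Finset.range n, W i ω) ^ 2 ∂μ = n * σ ∧
      ∫ ω, (∑ i ∈ Finset.range n, W i ω) ^ 4 ∂μ ≤ (6 * σ ^ 2 + κ) * n ^ 2 := by
    intro n
    induction n with
    | zero => simp
    | succ n ih =>
      obtain ⟨ih1, ih2, ih3⟩ := ih
      have hSm : Measurable fun ω => ∑ i ∈ Finset.range n, W i ω :=
        Finset.measurable_sum _ fun i _ => hm i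
      have hind : IndepFun (fun ω => ∑ i ∈ Finset.range n, W i ω) (W n) μ := by
        have := hindep.indepFun_sum_range_succ hm n
        convert this using 1
        funext ω
        simp
      set S : Ω → ℝ := fun ω => ∑ i ∈ Finset.range n, W i ω with hS
      set X := W n with hX
      have hX4 : Integrable (fun ω => X ω ^ 4) μ := (hpow n 4).integrable_iff.2 h4
      have hSk : ∀ k ≤ 4, Integrable (fun ω => S ω ^ k) μ := fun k hk =>
        integrable_pow_of_integrable_pow_four hSm ih1 hk
      have hXk : ∀ k ≤ 4, Integrable (fun ω => X ω ^ k) μ := fun k hk =>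
        integrable_pow_of_integrable_pow_four (hm n) hX4 hk
      have hindk : ∀ j k : ℕ, IndepFun (fun ω => S ω ^ j) (fun ω => X ω ^ k) μ := fun j k =>
        hind.comp (measurable_id.pow_const j) (measurable_id.pow_const k)
      have hprodint : ∀ j k : ℕ, j ≤ 4 → k ≤ 4 → Integrable (fun ω => S ω ^ j * X ω ^ k) μ :=
        fun j k hj hk => (hindk j k).integrable_mul (hSk j hj) (hXk k hk)
      have hprod : ∀ j k : ℕ, j ≤ 4 → k ≤ 4 →
          ∫ ω, S ω ^ j * X ω ^ k ∂μ = (∫ ω, S ω ^ j ∂μ) * ∫ ω, X ω ^ k ∂μ := fun j k hj hk =>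
        (hindk j k).integral_fun_mul_eq_mul_integral (hSk j hj).aestronglyMeasurable
          (hXk k hk).aestronglyMeasurable
      have hX1 : ∫ ω, X ω ^ 1 ∂μ = 0 := by
        rw [(hpow n 1).integral_eq]; simpa using hmean
      have hX2 : ∫ ω, X ω ^ 2 ∂μ = σ := (hpow n 2).integral_eq
      have hX4' : ∫ ω, X ω ^ 4 ∂μ = κ := (hpow n 4).integral_eq
      have e2 : ∀ ω, (∑ i ∈ Finset.range (n + 1), W i ω) ^ 2 =
          S ω ^ 2 + 2 * (S ω ^ 1 * X ω ^ 1) + X ω ^ 2 := fun ω => by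
        rw [Finset.sum_range_succ]; ring
      have e4 : ∀ ω, (∑ i ∈ Finset.range (n + 1), W i ω) ^ 4 =
          S ω ^ 4 + 4 * (S ω ^ 3 * X ω ^ 1) + 6 * (S ω ^ 2 * X ω ^ 2) +
            4 * (S ω ^ 1 * X ω ^ 3) + X ω ^ 4 := fun ω => by
        rw [Finset.sum_range_succ]; ring
      have hS1 : ∫ ω, S ω ^ 1 * X ω ^ 3 ∂μ = 0 := by
        have h0 : ∫ ω, S ω ^ 1 ∂μ = 0 := by
          simp only [pow_one, hS]
          rw [integral_finsetSum]
          · refine Finset.sum_eq_zero fun i _ => ?_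
            rw [(hident i).integral_eq, hmean]
          · intro i _
            have := integrable_pow_of_integrable_pow_four (hm i) ((hpow i 4).integrable_iff.2 h4)
              (show 1 ≤ 4 by norm_num)
            simpa using this
        rw [hprod 1 3 (by norm_num) (by norm_num), h0, zero_mul]
      have i31 := (hprodint 3 1 (by norm_num) (by norm_num)).const_mul 4
      have i22 := (hprodint 2 2 (by norm_num) (by norm_num)).const_mul 6
      have i13 := (hprodint 1 3 (by norm_num) (by norm_num)).const_mul 4
      have i11 := (hprodint 1 1 (by norm_num) (by norm_num)).const_mul 2
      have j1 : Integrable (fun ω => S ω ^ 4 + 4 * (S ω ^ 3 * X ω ^ 1)) μ := ih1.add i31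
      have j2 : Integrable (fun ω => S ω ^ 4 + 4 * (S ω ^ 3 * X ω ^ 1) +
          6 * (S ω ^ 2 * X ω ^ 2)) μ := j1.add i22
      have j3 : Integrable (fun ω => S ω ^ 4 + 4 * (S ω ^ 3 * X ω ^ 1) +
          6 * (S ω ^ 2 * X ω ^ 2) + 4 * (S ω ^ 1 * X ω ^ 3)) μ := j2.add i13
      have k1 : Integrable (fun ω => S ω ^ 2 + 2 * (S ω ^ 1 * X ω ^ 1)) μ :=
        (hSk 2 (by norm_num)).add i11
      refine ⟨?_, ?_, ?_⟩
      · simp_rw [e4]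
        exact j3.add hX4
      · simp_rw [e2]
        rw [integral_add k1 (hXk 2 (by norm_num)), integral_add (hSk 2 (by norm_num)) i11,
          integral_const_mul, hprod 1 1 (by norm_num) (by norm_num), hX1, ih2, hX2]
        push_cast
        ring
      · simp_rw [e4]
        rw [integral_add j3 hX4, integral_add j2 i13, integral_add j1 i22, integral_add ih1 i31,
          integral_const_mul, integral_const_mul, integral_const_mul,
          hprod 3 1 (by norm_num) (by norm_num), hX1, hprod 2 2 (by norm_num) (by norm_num), ih2,
          hX2, hS1, hX4']
        push_cast
        have hn : (0 : ℝ) ≤ n := by positivity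
        nlinarith [mul_nonneg hn (sq_nonneg σ), mul_nonneg hn hκ0, sq_nonneg σ]
  exact ⟨6 * σ ^ 2 + κ, by positivity, fun n => ⟨(key n).1, (key n).2.2⟩⟩

/-- A rate in the strong law of large numbers under a fourth moment assumption. -/
theorem ae_tendsto_sqrt_mul_average_pow_four {Ω : Type*} [MeasurableSpace Ω] {μ : Measure Ω}
    [IsProbabilityMeasure μ] {W : ℕ → Ω → ℝ} (hm : ∀ i, Measurable (W i)) (hindep : iIndepFun W μ)
    (hident : ∀ i, IdentDistrib (W i) (W 0) μ μ) (hmean : ∫ ω, W 0 ω ∂μ = 0)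
    (h4 : Integrable (fun ω => W 0 ω ^ 4) μ) :
    ∀ᵐ ω ∂μ, Tendsto (fun n : ℕ => (n : ℝ) ^ (1 / 2 : ℝ) *
      ((n : ℝ)⁻¹ * ∑ i ∈ Finset.range n, W i ω) ^ 4) atTop (𝓝 0) := by
  obtain ⟨K, hK0, hK⟩ := exists_integral_sum_pow_four_le hm hindep hident hmean h4
  have hmeas : ∀ n : ℕ, Measurable fun ω => ENNReal.ofReal ((n : ℝ) ^ (1 / 2 : ℝ) *
      ((n : ℝ)⁻¹ * ∑ i ∈ Finset.range n, W i ω) ^ 4) := fun n => by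
    have : Measurable fun ω => ∑ i ∈ Finset.range n, W i ω :=
      Finset.measurable_sum _ fun i _ => hm i
    fun_prop
  have hsum : ∑' n : ℕ, ∫⁻ ω, ENNReal.ofReal ((n : ℝ) ^ (1 / 2 : ℝ) *
      ((n : ℝ)⁻¹ * ∑ i ∈ Finset.range n, W i ω) ^ 4) ∂μ ≠ ∞ := by
    have hs : Summable fun n : ℕ => K * (n : ℝ) ^ (-(3 / 2) : ℝ) :=
      (Real.summable_nat_rpow.2 (by norm_num)).mul_left K
    refine ne_top_of_le_ne_top hs.tsum_ofReal_ne_top (ENNReal.tsum_le_tsum fun n => ?_)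
    rcases Nat.eq_zero_or_pos n with rfl | hn
    · simp
    have hn' : (0 : ℝ) < n := by exact_mod_cast hn
    have e : ∀ ω, (n : ℝ) ^ (1 / 2 : ℝ) * ((n : ℝ)⁻¹ * ∑ i ∈ Finset.range n, W i ω) ^ 4 =
        ((n : ℝ) ^ (1 / 2 : ℝ) * (n : ℝ)⁻¹ ^ 4) * (∑ i ∈ Finset.range n, W i ω) ^ 4 := fun ω => by
      ring
    simp_rw [e]
    rw [← ofReal_integral_eq_lintegral_ofReal ((hK n).1.const_mul _)
      (ae_of_all _ fun ω => by positivity), integral_const_mul]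
    refine ENNReal.ofReal_le_ofReal ?_
    calc _ ≤ (n : ℝ) ^ (1 / 2 : ℝ) * (n : ℝ)⁻¹ ^ 4 * (K * n ^ 2) := by
          gcongr
          exact (hK n).2
      _ = K * ((n : ℝ) ^ (1 / 2 : ℝ) * (n : ℝ) ^ (-2 : ℝ)) := by
          rw [Real.rpow_neg hn'.le, Real.rpow_two]
          field_simp
      _ = _ := by rw [← Real.rpow_add hn']; norm_num
  filter_upwards [ae_tendsto_zero_of_tsum_lintegral_ne_top
    (fun n => (hmeas n).aemeasurable) hsum] with ω hω
  have := (ENNReal.tendsto_toReal ENNReal.zero_ne_top).comp hω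
  refine this.congr fun n => ?_
  simp only [Function.comp]
  exact ENNReal.toReal_ofReal (by positivity)

/-- Almost surely, the mean of `n` independent centred Euclidean vectors with a common law and
finite fourth moments is eventually at most `n ^ (-1 / 8)`. -/
theorem ae_eventually_norm_vecMean_le {Ω : Type*} [MeasurableSpace Ω] {μ : Measure Ω}
    [IsProbabilityMeasure μ] {m : ℕ} {Z : ℕ → Ω → EuclideanSpace ℝ (Fin m)}
    (hm : ∀ i, Measurable (Z i)) (hindep : iIndepFun Z μ)
    (hident : ∀ i, IdentDistrib (Z i) (Z 0) μ μ) (hmean : ∀ r, ∫ ω, Z 0 ω r ∂μ = 0)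
    (h4 : Integrable (fun ω => ‖Z 0 ω‖ ^ 4) μ) :
    ∀ᵐ ω ∂μ, ∀ᶠ n : ℕ in atTop,
      ‖vecMean (fun i => Z i ω) n‖ ≤ (n : ℝ) ^ (-(1 / 8) : ℝ) := by
  have hcoord : ∀ r : Fin m, Measurable fun z : EuclideanSpace ℝ (Fin m) => z r := fun r => by
    fun_prop
  have h : ∀ᵐ ω ∂μ, ∀ r : Fin m, Tendsto (fun n : ℕ => (n : ℝ) ^ (1 / 2 : ℝ) *
      ((n : ℝ)⁻¹ * ∑ i ∈ Finset.range n, Z i ω r) ^ 4) atTop (𝓝 0) := by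
    rw [ae_all_iff]
    intro r
    refine ae_tendsto_sqrt_mul_average_pow_four (W := fun i ω => Z i ω r)
      (fun i => (hcoord r).comp (hm i)) (hindep.comp _ fun _ => hcoord r)
      (fun i => (hident i).comp (hcoord r)) (hmean r) ?_
    refine h4.mono' (((hcoord r).comp (hm 0)).pow_const 4).aestronglyMeasurable
      (ae_of_all _ fun ω => ?_)
    rw [norm_pow]
    gcongr
    exact PiLp.norm_apply_le (Z 0 ω) r
  filter_upwards [h] with ω hω
  have hsum : Tendsto (fun n : ℕ => m * ∑ r : Fin m, (n : ℝ) ^ (1 / 2 : ℝ) *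
      ((n : ℝ)⁻¹ * ∑ i ∈ Finset.range n, Z i ω r) ^ 4) atTop (𝓝 0) := by
    have := (tendsto_finsetSum Finset.univ fun r _ => hω r).const_mul (m : ℝ)
    simpa using this
  filter_upwards [hsum.eventually (gt_mem_nhds one_pos), eventually_gt_atTop 0] with n hn hn0
  have hn' : (0 : ℝ) < n := by exact_mod_cast hn0
  set v := vecMean (fun i => Z i ω) n with hv
  have hvr : ∀ r, v r = (n : ℝ)⁻¹ * ∑ i ∈ Finset.range n, Z i ω r := fun r => by
    simp [hv, vecMean]
  have h1 : ‖v‖ ^ 4 ≤ m * ∑ r, v r ^ 4 := by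
    have e : ‖v‖ ^ 4 = (∑ r, v r ^ 2) ^ 2 := by
      rw [show ‖v‖ ^ 4 = (‖v‖ ^ 2) ^ 2 by ring, EuclideanSpace.norm_sq_eq]
      simp
    rw [e]
    have := sq_sum_le_card_mul_sum_sq (s := Finset.univ) (f := fun r => v r ^ 2)
    simp only [← pow_mul, Finset.card_univ, Fintype.card_fin] at this
    simpa using this
  have h2 : (n : ℝ) ^ (1 / 2 : ℝ) * ‖v‖ ^ 4 ≤ 1 := by
    calc _ ≤ (n : ℝ) ^ (1 / 2 : ℝ) * (m * ∑ r, v r ^ 4) := by gcongr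
      _ = m * ∑ r : Fin m, (n : ℝ) ^ (1 / 2 : ℝ) *
          ((n : ℝ)⁻¹ * ∑ i ∈ Finset.range n, Z i ω r) ^ 4 := by
        simp_rw [hvr]
        rw [← Finset.mul_sum]
        ring
      _ ≤ 1 := hn.le
  have h3 : ‖v‖ ^ 4 ≤ ((n : ℝ) ^ (-(1 / 8) : ℝ)) ^ 4 := by
    have e : ((n : ℝ) ^ (-(1 / 8) : ℝ)) ^ 4 = ((n : ℝ) ^ (1 / 2 : ℝ))⁻¹ := by
      rw [← Real.rpow_natCast, ← Real.rpow_mul hn'.le, ← Real.rpow_neg hn'.le]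
      norm_num
    rw [e, ← one_div, le_div_iff₀' (by positivity)]
    exact h2
  exact le_of_pow_le_pow_left₀ (by norm_num) (by positivity) h3

/-- If `√U` has concentration function at most `c` at scale `ε` and `V` is independent of `U`,
then `√U` is within `ε` of `V` with probability at most `c`. -/
theorem measure_abs_sqrt_sub_le_of_indepFun {Ω : Type*} [MeasurableSpace Ω] {μ : Measure Ω}
    [IsProbabilityMeasure μ] {U V : Ω → ℝ} (hU : Measurable U) (hV : Measurable V)
    (hind : IndepFun V U μ) {ε : ℝ} {c : ℝ≥0∞}
    (hc : ∀ r, μ.map U {x | |Real.sqrt x - r| ≤ ε} ≤ c) :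
    μ {ω | |Real.sqrt (U ω) - V ω| ≤ ε} ≤ c := by
  have hpV : IsProbabilityMeasure (μ.map V) := Measure.isProbabilityMeasure_map hV.aemeasurable
  have hpU : IsProbabilityMeasure (μ.map U) := Measure.isProbabilityMeasure_map hU.aemeasurable
  have hS : MeasurableSet {q : ℝ × ℝ | |Real.sqrt q.2 - q.1| ≤ ε} :=
    measurableSet_le (by fun_prop) measurable_const
  have h := (indepFun_iff_map_prod_eq_prod_map_map hV.aemeasurable hU.aemeasurable).1 hind
  have e : μ {ω | |Real.sqrt (U ω) - V ω| ≤ ε} =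
      μ.map (fun ω => (V ω, U ω)) {q : ℝ × ℝ | |Real.sqrt q.2 - q.1| ≤ ε} := by
    rw [Measure.map_apply (hV.prodMk hU) hS]
    rfl
  rw [e, h, Measure.prod_apply hS]
  calc _ ≤ ∫⁻ _, c ∂(μ.map V) := lintegral_mono fun r => hc r
    _ = c := by simp

/-- If the squared norms of independent vectors have the chi-square law, then almost surely the mean
of the first `n` of them eventually stays at distance at least `n ^ (-3)` from each of these `n`
vectors. -/
theorem ae_eventually_le_norm_sub_vecMean {Ω : Type*} [MeasurableSpace Ω] {μ : Measure Ω}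
    [IsProbabilityMeasure μ] {m : ℕ} (hm1 : 1 ≤ m) {Z : ℕ → Ω → EuclideanSpace ℝ (Fin m)}
    (hm : ∀ i, Measurable (Z i)) (hindep : iIndepFun Z μ)
    (hlaw : ∀ i, μ.map (fun ω => ‖Z i ω‖ ^ 2) = chiSquared m) :
    ∀ᵐ ω ∂μ, ∀ᶠ n : ℕ in atTop, ∀ i < n,
      ((n : ℝ) ^ 3)⁻¹ ≤ ‖Z i ω - vecMean (fun i => Z i ω) n‖ := by
  obtain ⟨C, hC0, hC⟩ := exists_chiSquared_sqrt_near_le hm1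
  have hbound : ∀ n : ℕ, 2 ≤ n → ∀ i < n,
      μ {ω | ‖Z i ω - vecMean (fun i => Z i ω) n‖ < ((n : ℝ) ^ 3)⁻¹} ≤
        ENNReal.ofReal (C * (2 * ((n : ℝ) ^ 3)⁻¹)) := by
    intro n hn i hi
    have hn' : (2 : ℝ) ≤ n := by exact_mod_cast hn
    have hind := hindep.indepFun_finsetSum_of_notMem hm
      (s := (Finset.range n).erase i) (i := i) (Finset.notMem_erase i _)
    have hRm : Measurable (∑ j ∈ (Finset.range n).erase i, Z j) := by
      convert Finset.measurable_sum ((Finset.range n).erase i) fun j _ => hm j using 1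
      exact Finset.sum_fn _ _
    have hind2 := hind.comp (φ := fun v => ‖v‖ / ((n : ℝ) - 1)) (ψ := fun v => ‖v‖ ^ 2)
      (by fun_prop) (by fun_prop)
    refine le_trans (measure_mono fun ω hω => ?_)
      (measure_abs_sqrt_sub_le_of_indepFun (U := fun ω => ‖Z i ω‖ ^ 2)
        (V := fun ω => ‖(∑ j ∈ (Finset.range n).erase i, Z j) ω‖ / ((n : ℝ) - 1))
        ((hm i).norm.pow_const 2) (hRm.norm.div_const _) hind2
        (fun r => by rw [hlaw]; exact hC r (2 * ((n : ℝ) ^ 3)⁻¹) (by positivity)))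
    have hω : ‖Z i ω - vecMean (fun i => Z i ω) n‖ < ((n : ℝ) ^ 3)⁻¹ := hω
    -- `Z i - mean = (1 - 1 / n) • Z i - R / n`, where `R` is the sum of the other vectors
    have e : Z i ω - vecMean (fun i => Z i ω) n =
        (((n : ℝ) - 1) / n) • Z i ω -
          (n : ℝ)⁻¹ • (∑ j ∈ (Finset.range n).erase i, Z j) ω := by
      rw [vecMean, ← Finset.add_sum_erase _ _ (Finset.mem_range.2 hi), Finset.sum_apply, smul_add,
        sub_div, div_self (by positivity), sub_smul, one_smul, one_div]
      abel
    have h1 := abs_norm_sub_norm_le ((((n : ℝ) - 1) / n) • Z i ω)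
      ((n : ℝ)⁻¹ • (∑ j ∈ (Finset.range n).erase i, Z j) ω)
    rw [← e, norm_smul, norm_smul, Real.norm_of_nonneg (div_nonneg (by linarith) (by linarith)),
      Real.norm_of_nonneg (by positivity)] at h1
    set z := ‖Z i ω‖ with hz
    set R := ‖(∑ j ∈ (Finset.range n).erase i, Z j) ω‖ with hR
    show |Real.sqrt (z ^ 2) - R / ((n : ℝ) - 1)| ≤ 2 * ((n : ℝ) ^ 3)⁻¹
    rw [Real.sqrt_sq (norm_nonneg _)]
    have e2 : ((n : ℝ) - 1) / n * z - (n : ℝ)⁻¹ * R =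
        ((n : ℝ) - 1) / n * (z - R / ((n : ℝ) - 1)) := by
      have : (n : ℝ) - 1 ≠ 0 := by linarith
      field_simp
    rw [e2, abs_mul, abs_of_nonneg (div_nonneg (by linarith) (by linarith))] at h1
    have h2 : 1 / 2 ≤ ((n : ℝ) - 1) / n := by
      rw [div_le_div_iff₀ (by norm_num) (by linarith)]; linarith
    have h3 := mul_le_mul_of_nonneg_right h2 (abs_nonneg (z - R / ((n : ℝ) - 1)))
    linarith
  have hsum : ∑' n : ℕ, μ (⋃ i ∈ Finset.range n,
      {ω | 2 ≤ n ∧ ‖Z i ω - vecMean (fun i => Z i ω) n‖ < ((n : ℝ) ^ 3)⁻¹}) ≠ ∞ := by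
    have hs : Summable fun n : ℕ => 2 * C * (1 / (n : ℝ) ^ 2) :=
      (Real.summable_one_div_nat_pow.2 one_lt_two).mul_left (2 * C)
    refine ne_top_of_le_ne_top hs.tsum_ofReal_ne_top (ENNReal.tsum_le_tsum fun n => ?_)
    rcases lt_or_ge n 2 with hn | hn
    · simp [not_le.2 hn]
    have hn' : (2 : ℝ) ≤ n := by exact_mod_cast hn
    calc _ ≤ ∑ i ∈ Finset.range n,
          μ {ω | 2 ≤ n ∧ ‖Z i ω - vecMean (fun i => Z i ω) n‖ < ((n : ℝ) ^ 3)⁻¹} :=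
          measure_biUnion_finset_le _ _
      _ ≤ ∑ _i ∈ Finset.range n, ENNReal.ofReal (C * (2 * ((n : ℝ) ^ 3)⁻¹)) := by
          refine Finset.sum_le_sum fun i hi => ?_
          exact (measure_mono fun ω hω => hω.2).trans (hbound n hn i (Finset.mem_range.1 hi))
      _ = ENNReal.ofReal (2 * C * (1 / (n : ℝ) ^ 2)) := by
          rw [Finset.sum_const, Finset.card_range, nsmul_eq_mul, ← ENNReal.ofReal_natCast,
            ← ENNReal.ofReal_mul (by positivity)]
          congr 1
          field_simp
  filter_upwards [ae_eventually_notMem hsum] with ω hω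
  filter_upwards [hω, eventually_ge_atTop 2] with n hn hn2 i hi
  by_contra! hlt
  exact hn (Set.mem_biUnion (Finset.mem_coe.2 (Finset.mem_range.2 hi)) ⟨hn2, hlt⟩)

/-! ### Tails of the data under the null hypothesis -/

/-- Raising `c x ^ p ≤ y` to the power `γ`. -/
theorem rpow_le_of_le_rpow {x y c p γ : ℝ} (hx : 0 ≤ x) (hc : 0 < c) (hγ : 0 ≤ γ)
    (h : c * x ^ p ≤ y) : x ^ (p * γ) ≤ c ^ (-γ) * y ^ γ := by
  have hxp : 0 ≤ x ^ p := Real.rpow_nonneg hx p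
  calc x ^ (p * γ) = c ^ (-γ) * (c ^ γ * (x ^ p) ^ γ) := by
        rw [← mul_assoc, ← Real.rpow_add hc, Real.rpow_mul hx]; simp
    _ = c ^ (-γ) * (c * x ^ p) ^ γ := by rw [Real.mul_rpow hc.le hxp]
    _ ≤ c ^ (-γ) * y ^ γ := by gcongr

/-- The tails of the empirical cdfs are dominated by a power of the tails of the chi-square cdf.
Both bounds are Markov inequalities, for `D ^ (-1 / 4)` at `0` and for `exp (D / 8)` at `∞`. -/
theorem exists_empiricalCdf_tail_le {m : ℕ} (hm : 1 ≤ m) {d : (n : ℕ) → Fin n → ℝ} {D : ℕ → ℝ}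
    (hD : ∀ i, 0 < D i) (happ : IsApproximation d D)
    (hlow : ∀ᶠ n in atTop, ∀ (i : Fin n) (t : ℝ), t ≤ 1 → d n i ≤ t →
      0 < t ∧ D i ≤ 16 * t ^ (1 / 24 : ℝ)) {L₁ L₂ : ℝ}
    (h1 : ∀ᶠ n : ℕ in atTop, (∑ i : Fin n, D i ^ (-(1 / 4) : ℝ)) / n ≤ L₁)
    (h2 : ∀ᶠ n : ℕ in atTop, (∑ i : Fin n, Real.exp (D i / 8)) / n ≤ L₂) :
    ∃ C γ : ℝ, 1 ≤ C ∧ 0 < γ ∧ γ ≤ 1 ∧ ∀ᶠ n in atTop, ∀ t,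
      empiricalCdf (d n) t ≤ C * cdf (chiSquared m) t ^ γ ∧
      (n ≠ 0 → 1 - empiricalCdf (d n) t ≤ C * (1 - cdf (chiSquared m) t) ^ γ) := by
  obtain ⟨c₁, hc₁, hF₁⟩ := exists_rpow_le_cdf_chiSquared hm
  obtain ⟨c₂, hc₂, hF₂⟩ := exists_exp_le_one_sub_cdf_chiSquared hm
  obtain ⟨ε, hε, happ⟩ := happ
  have hL₁ : 0 ≤ L₁ := by
    obtain ⟨n, hn⟩ := h1.exists
    refine le_trans ?_ hn
    exact div_nonneg (Finset.sum_nonneg fun i _ => Real.rpow_nonneg (hD i).le _) (by positivity)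
  have hL₂ : 0 ≤ L₂ := by
    obtain ⟨n, hn⟩ := h2.exists
    exact le_trans (by positivity) hn
  have hp : (0 : ℝ) < (m : ℝ) / 2 + 1 := by positivity
  -- `γ` turns the lower bound `c₁ t ^ (m / 2 + 1)` of the cdf into a multiple of `t ^ (1 / 96)`,
  -- where `1 / 96` is the product of the exponents `1 / 24` and `1 / 4`
  set γ : ℝ := 1 / (96 * ((m : ℝ) / 2 + 1)) with hγ
  have hγ0 : 0 < γ := by positivity
  have hpγ : ((m : ℝ) / 2 + 1) * γ = 1 / 96 := by rw [hγ]; field_simp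
  have hγ96 : γ ≤ 1 / 96 := by
    rw [← hpγ]; nlinarith [mul_nonneg (Nat.cast_nonneg (α := ℝ) m) hγ0.le]
  have hA1 : 0 ≤ 2 * L₁ * c₁ ^ (-γ) := by positivity
  have hA2 : 0 ≤ c₁ ^ (-γ) := by positivity
  have hA3 : 0 ≤ Real.exp (1 / 16) * L₂ * c₂ ^ (-(1 / 16) : ℝ) := by positivity
  refine ⟨1 + 2 * L₁ * c₁ ^ (-γ) + c₁ ^ (-γ) + Real.exp (1 / 16) * L₂ * c₂ ^ (-(1 / 16) : ℝ), γ,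
    by linarith, hγ0, by linarith, ?_⟩
  set C := 1 + 2 * L₁ * c₁ ^ (-γ) + c₁ ^ (-γ) + Real.exp (1 / 16) * L₂ * c₂ ^ (-(1 / 16) : ℝ)
    with hC
  filter_upwards [h1, h2, happ, hlow, hε.eventually (gt_mem_nhds one_pos)] with
    n h1 h2 happ hlow hε1 t
  have hF0 := cdf_nonneg (chiSquared m) t
  have hF1 := sub_nonneg.2 (cdf_le_one (chiSquared m) t)
  have hFγ : 0 ≤ cdf (chiSquared m) t ^ γ := Real.rpow_nonneg hF0 _
  have hFγ' : 0 ≤ (1 - cdf (chiSquared m) t) ^ γ := Real.rpow_nonneg hF1 _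
  refine ⟨?_, fun hn => ?_⟩
  · rcases le_or_gt t 0 with ht | ht
    · have : empiricalCdf (d n) t = 0 := by
        rw [empiricalCdf, Finset.sum_eq_zero, zero_div]
        intro i _
        rw [if_neg]
        intro hle
        exact absurd (hlow i t (by linarith) hle).1 (not_lt.2 ht)
      rw [this]
      exact mul_nonneg (by linarith) hFγ
    rcases le_or_gt t 1 with ht1 | ht1
    · have hmarkov : empiricalCdf (d n) t ≤ 2 * t ^ (1 / 96 : ℝ) * L₁ := by
        calc empiricalCdf (d n) t
            ≤ (∑ i : Fin n, 2 * t ^ (1 / 96 : ℝ) * D i ^ (-(1 / 4) : ℝ)) / n := by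
              unfold empiricalCdf
              gcongr with i
              have hDi := hD i
              split_ifs with hle
              · have hb := (hlow i t ht1 hle).2
                have h3 : (16 * t ^ (1 / 24 : ℝ)) ^ (-(1 / 4) : ℝ) ≤ D i ^ (-(1 / 4) : ℝ) :=
                  Real.rpow_le_rpow_of_nonpos hDi hb (by norm_num)
                have h16 : (16 : ℝ) ^ (-(1 / 4) : ℝ) = 1 / 2 := by
                  rw [show (16 : ℝ) = 2 ^ (4 : ℝ) by norm_num, ← Real.rpow_mul (by norm_num)]
                  norm_num
                rw [Real.mul_rpow (by norm_num) (by positivity), ← Real.rpow_mul ht.le, h16] at h3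
                calc (1 : ℝ) = 2 * t ^ (1 / 96 : ℝ) * (1 / 2 * t ^ (1 / 24 * -(1 / 4) : ℝ)) := by
                      rw [show ∀ a b : ℝ, 2 * a * (1 / 2 * b) = a * b from fun a b => by ring,
                        ← Real.rpow_add ht]
                      norm_num
                  _ ≤ _ := by gcongr
              · positivity
          _ = 2 * t ^ (1 / 96 : ℝ) * ((∑ i : Fin n, D i ^ (-(1 / 4) : ℝ)) / n) := by
              rw [← Finset.mul_sum, mul_div_assoc]
          _ ≤ _ := by gcongr
      have h4 := rpow_le_of_le_rpow ht.le hc₁ hγ0.le (hF₁ t ht.le ht1)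
      rw [hpγ] at h4
      calc empiricalCdf (d n) t ≤ 2 * t ^ (1 / 96 : ℝ) * L₁ := hmarkov
        _ ≤ 2 * (c₁ ^ (-γ) * cdf (chiSquared m) t ^ γ) * L₁ := by gcongr
        _ = 2 * L₁ * c₁ ^ (-γ) * cdf (chiSquared m) t ^ γ := by ring
        _ ≤ _ := by gcongr; linarith
    · have h4 := rpow_le_of_le_rpow zero_le_one hc₁ hγ0.le
        ((hF₁ 1 zero_le_one le_rfl).trans (monotone_cdf (chiSquared m) ht1.le))
      rw [Real.one_rpow] at h4
      calc empiricalCdf (d n) t ≤ 1 := empiricalCdf_le_one _ _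
        _ ≤ _ := h4
        _ ≤ _ := by gcongr; linarith
  · rcases le_or_gt t 0 with ht | ht
    · rw [cdf_chiSquared_of_nonpos hm ht, sub_zero, Real.one_rpow, mul_one]
      linarith [empiricalCdf_nonneg (d n) t]
    have hmarkov : 1 - empiricalCdf (d n) t ≤ Real.exp (1 / 16) * Real.exp (-t) ^ (1 / 16 : ℝ) *
        L₂ := by
      rw [one_sub_empiricalCdf hn]
      calc _ ≤ (∑ i : Fin n, Real.exp (1 / 16) * Real.exp (-t) ^ (1 / 16 : ℝ) *
            Real.exp (D i / 8)) / n := by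
            gcongr with i
            split_ifs with hlt
            · have h5 := (abs_le.1 (happ i)).2
              rw [abs_of_pos (hD i)] at h5
              have h6 : d n i ≤ 2 * D i + 1 := by nlinarith [hD i]
              rw [← Real.exp_mul, ← Real.exp_add, ← Real.exp_add]
              exact Real.one_le_exp (by linarith)
            · positivity
        _ = Real.exp (1 / 16) * Real.exp (-t) ^ (1 / 16 : ℝ) *
            ((∑ i : Fin n, Real.exp (D i / 8)) / n) := by rw [← Finset.mul_sum, mul_div_assoc]
        _ ≤ _ := by gcongr
    have h4 := rpow_le_of_le_rpow (y := 1 - cdf (chiSquared m) t) (p := 1) (γ := 1 / 16)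
      (Real.exp_pos (-t)).le hc₂ (by norm_num) (by rw [Real.rpow_one]; exact hF₂ t ht.le)
    rw [one_mul] at h4
    have h5 : (1 - cdf (chiSquared m) t) ^ (1 / 16 : ℝ) ≤ (1 - cdf (chiSquared m) t) ^ γ := by
      rcases hF1.eq_or_lt with h0 | h0
      · rw [← h0, Real.zero_rpow (by norm_num), Real.zero_rpow hγ0.ne']
      · exact Real.rpow_le_rpow_of_exponent_ge h0 (by linarith) (by linarith)
    calc 1 - empiricalCdf (d n) t
        ≤ Real.exp (1 / 16) * Real.exp (-t) ^ (1 / 16 : ℝ) * L₂ := hmarkov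
      _ ≤ Real.exp (1 / 16) *
          (c₂ ^ (-(1 / 16) : ℝ) * (1 - cdf (chiSquared m) t) ^ γ) * L₂ := by
          gcongr
          exact h4.trans (by gcongr)
      _ = Real.exp (1 / 16) * L₂ * c₂ ^ (-(1 / 16) : ℝ) * (1 - cdf (chiSquared m) t) ^ γ := by ring
      _ ≤ _ := by gcongr; linarith

/-- What the two kinds of data have in common: `d` approximates an i.i.d. sequence `D` with law `Q`
and, if `Q` is the chi-square law, a small value `d n i ≤ t` is positive and forces `D i` to be of
order at most `t ^ (1 / 24)`. -/
structure IsAsymptoticallyIID {Ω : Type*} [MeasurableSpace Ω] (μ : Measure Ω) (m : ℕ)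
    (d : (n : ℕ) → Ω → Fin n → ℝ) (Q : Measure ℝ) (D : ℕ → Ω → ℝ) : Prop where
  measurable : ∀ i, Measurable (D i)
  indep : iIndepFun D μ
  map_eq : ∀ i, μ.map (D i) = Q
  approx : ∀ᵐ ω ∂μ, IsApproximation (fun n => d n ω) fun i => D i ω
  lower : Q = chiSquared m → ∀ᵐ ω ∂μ, ∀ᶠ n in atTop, ∀ (i : Fin n) (t : ℝ), t ≤ 1 →
    d n ω i ≤ t → 0 < t ∧ D i ω ≤ 16 * t ^ (1 / 24 : ℝ)

theorem ae_forall_pos_of_map_eq_chiSquared {Ω : Type*} [MeasurableSpace Ω] {μ : Measure Ω} {m : ℕ}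
    {D : ℕ → Ω → ℝ} (hm : ∀ i, Measurable (D i)) (hD : ∀ i, μ.map (D i) = chiSquared m) :
    ∀ᵐ ω ∂μ, ∀ i, 0 < D i ω := by
  rw [ae_all_iff]
  intro i
  have h := ae_pos_chiSquared m
  rw [← hD i] at h
  exact ae_of_ae_map (hm i).aemeasurable h

theorem IsIIDSample.exists_isAsymptoticallyIID {Ω : Type*} [MeasurableSpace Ω] {μ : Measure Ω}
    {d : (n : ℕ) → Ω → Fin n → ℝ} {Q : Measure ℝ} (h : IsIIDSample μ d Q) (m : ℕ) :
    ∃ D, IsAsymptoticallyIID μ m d Q D := by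
  obtain ⟨X, hm, hind, hmap, hd⟩ := h
  refine ⟨X, hm, hind, hmap, ae_of_all _ fun ω => ⟨0, tendsto_const_nhds, ?_⟩, fun hQ => ?_⟩
  · exact Eventually.of_forall fun n i => by simp [hd]
  · filter_upwards [ae_forall_pos_of_map_eq_chiSquared hm (hQ ▸ hmap)] with ω hω
    refine Eventually.of_forall fun n i t ht1 hle => ?_
    rw [hd] at hle
    have ht : 0 < t := (hω i).trans_le hle
    refine ⟨ht, ?_⟩
    have h1 := Real.rpow_le_rpow_of_exponent_ge ht ht1 (show (1 / 24 : ℝ) ≤ 1 by norm_num)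
    rw [Real.rpow_one] at h1
    linarith

theorem continuous_whiten {m : ℕ} (B : Matrix (Fin m) (Fin m) ℝ) (c : Fin m → ℝ) :
    Continuous (whiten B c) := by
  unfold whiten
  fun_prop

theorem tendsto_vecMean_whiten {m : ℕ} (B : Matrix (Fin m) (Fin m) ℝ) {c : Fin m → ℝ}
    {y : ℕ → Fin m → ℝ} (h : Tendsto (fun n => sampleMean fun j : Fin n => y j) atTop (𝓝 c)) :
    Tendsto (vecMean fun i => whiten B c (y i)) atTop (𝓝 0) := by
  have h0 : ∀ v, whiten B v v = 0 := fun v => by simp [whiten]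
  have h1 := ((continuous_whiten B c).tendsto c).comp h
  rw [h0] at h1
  refine h1.congr' ?_
  filter_upwards [eventually_ne_atTop 0] with n hn
  have h2 := whiten_sampleMean B c y hn (sampleMean fun j : Fin n => y j)
  rw [h0] at h2
  exact sub_eq_zero.1 h2.symm

theorem integral_whiten_apply {Ω : Type*} [MeasurableSpace Ω] {μ : Measure Ω}
    [IsProbabilityMeasure μ] {m : ℕ} {Y : Ω → Fin m → ℝ} (hY : Measurable Y) (hL2 : MemLp Y 2 μ)
    (B : Matrix (Fin m) (Fin m) ℝ) (r : Fin m) :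
    ∫ ω, whiten B (meanVector μ Y) (Y ω) r ∂μ = 0 := by
  have hi : ∀ s, Integrable (fun ω => Y ω s) μ := fun s =>
    (memLp_apply_of_memLp hY hL2 s).integrable one_le_two
  have hi' : ∀ s, Integrable (fun ω => Y ω s - meanVector μ Y s) μ := fun s =>
    (hi s).sub (integrable_const _)
  simp only [whiten, Matrix.mulVec, dotProduct, Pi.sub_apply]
  rw [integral_finsetSum _ fun s _ => (hi' s).const_mul _]
  refine Finset.sum_eq_zero fun s _ => ?_
  rw [integral_const_mul, integral_sub (hi s) (integrable_const _)]
  simp [meanVector]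

/-- Deterministic part of the lower bound for the sample Mahalanobis distances: a small distance
`d n i ≤ t` forces `n ^ (-6) ≤ 2 t`, so that the mean, of norm at most `n ^ (-1 / 8)`, is
negligible at the scale `t ^ (1 / 48)`. -/
theorem eventually_norm_sq_le_of_le {E : Type*} [NormedAddCommGroup E] [Module ℝ E] {Z : ℕ → E}
    {ε : ℕ → ℝ} (hε : Tendsto ε atTop (𝓝 0)) {d : (n : ℕ) → Fin n → ℝ}
    (hd : ∀ n (i : Fin n), |d n i - ‖Z i - vecMean Z n‖ ^ 2| ≤ ε n * ‖Z i - vecMean Z n‖ ^ 2)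
    (hsep : ∀ᶠ n : ℕ in atTop, ∀ i < n, ((n : ℝ) ^ 3)⁻¹ ≤ ‖Z i - vecMean Z n‖)
    (hmean : ∀ᶠ n : ℕ in atTop, ‖vecMean Z n‖ ≤ (n : ℝ) ^ (-(1 / 8) : ℝ)) :
    ∀ᶠ n in atTop, ∀ (i : Fin n) (t : ℝ), t ≤ 1 → d n i ≤ t →
      0 < t ∧ ‖Z i‖ ^ 2 ≤ 16 * t ^ (1 / 24 : ℝ) := by
  filter_upwards [hsep, hmean, hε.eventually (gt_mem_nhds (show (0 : ℝ) < 1 / 2 by norm_num)),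
    eventually_gt_atTop 0] with n h1 h2 h3 hn i t ht1 hle
  have hn' : (0 : ℝ) < n := by exact_mod_cast hn
  have h4 := (abs_le.1 (hd n i)).1
  have h5 := h1 i i.2
  have h6 := norm_sub_norm_le (Z i) (vecMean Z n)
  set u := ‖Z i - vecMean Z n‖ with hu
  have hupos : 0 < u := lt_of_lt_of_le (by positivity) h5
  have hut : u ^ 2 ≤ 2 * t := by nlinarith [sq_nonneg u]
  have ht : 0 < t := by nlinarith [pow_pos hupos 2]
  refine ⟨ht, ?_⟩
  have hexp : ∀ {p : ℝ}, 1 / 48 ≤ p → p ≤ 1 → (2 * t) ^ p ≤ 2 * t ^ (1 / 48 : ℝ) := by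
    intro p hp hp1
    rw [Real.mul_rpow (by norm_num) ht.le]
    refine mul_le_mul ?_ (Real.rpow_le_rpow_of_exponent_ge ht ht1 hp) (by positivity) (by norm_num)
    calc (2 : ℝ) ^ p ≤ 2 ^ (1 : ℝ) := Real.rpow_le_rpow_of_exponent_le (by norm_num) hp1
      _ = 2 := Real.rpow_one 2
  have h7 : u ≤ 2 * t ^ (1 / 48 : ℝ) := by
    calc u = (u ^ 2) ^ (1 / 2 : ℝ) := by
          rw [← Real.rpow_natCast, ← Real.rpow_mul hupos.le]; norm_num
      _ ≤ (2 * t) ^ (1 / 2 : ℝ) := by gcongr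
      _ ≤ _ := hexp (by norm_num) (by norm_num)
  have h8 : (n : ℝ) ^ (-(1 / 8) : ℝ) ≤ 2 * t ^ (1 / 48 : ℝ) := by
    have h9 : ((n : ℝ) ^ 3)⁻¹ ^ 2 ≤ 2 * t := le_trans (by gcongr) hut
    calc (n : ℝ) ^ (-(1 / 8) : ℝ) = (((n : ℝ) ^ 3)⁻¹ ^ 2) ^ (1 / 48 : ℝ) := by
          rw [← Real.rpow_natCast, ← Real.rpow_natCast, ← Real.rpow_neg hn'.le,
            ← Real.rpow_mul hn'.le, ← Real.rpow_mul hn'.le]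
          norm_num
      _ ≤ (2 * t) ^ (1 / 48 : ℝ) := by gcongr
      _ ≤ _ := hexp le_rfl (by norm_num)
  have h9 : ‖Z i‖ ≤ 4 * t ^ (1 / 48 : ℝ) := by linarith
  calc ‖Z i‖ ^ 2 ≤ (4 * t ^ (1 / 48 : ℝ)) ^ 2 := by gcongr
    _ = 16 * t ^ (1 / 24 : ℝ) := by
      rw [mul_pow, ← Real.rpow_natCast (t ^ (1 / 48 : ℝ)), ← Real.rpow_mul ht.le]
      norm_num

theorem IsMahalanobisSample.exists_isAsymptoticallyIID {Ω : Type*} [MeasurableSpace Ω]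
    {μ : Measure Ω} [IsProbabilityMeasure μ] {m : ℕ} (hm1 : 1 ≤ m)
    {d : (n : ℕ) → Ω → Fin n → ℝ} {Q : Measure ℝ} (h : IsMahalanobisSample μ m d Q) :
    ∃ D, IsAsymptoticallyIID μ m d Q D := by
  obtain ⟨Y, hm, hind, hident, hL2, hpos, hQ, hd⟩ := h
  set S := covMatrix μ (Y 0) with hS
  set c := meanVector μ (Y 0) with hc
  obtain ⟨B, hB, hB'⟩ := exists_transpose_mul_self_eq_inv hpos
  have hSdet : IsUnit S.det := isUnit_iff_ne_zero.2 hpos.det_pos.ne'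
  have hw : Measurable (whiten B c) := (continuous_whiten B c).measurable
  let Z : ℕ → Ω → EuclideanSpace ℝ (Fin m) := fun i ω => whiten B c (Y i ω)
  have hZm : ∀ i, Measurable (Z i) := fun i => hw.comp (hm i)
  have hZind : iIndepFun Z μ := hind.comp _ fun _ => hw
  have hZid : ∀ i, IdentDistrib (Z i) (Z 0) μ μ := fun i => (hident i).comp hw
  have hnsq : Measurable fun z : EuclideanSpace ℝ (Fin m) => ‖z‖ ^ 2 := by fun_prop
  have hmap : ∀ i, μ.map (fun ω => ‖Z i ω‖ ^ 2) = Q := by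
    intro i
    refine ((hZid i).comp hnsq).map_eq.trans ?_
    rw [hQ]
    congr 1
    funext ω
    exact (mahalanobisSq_eq_norm_whiten_sq hB c (Y 0 ω)).symm
  have hcons := ae_tendsto_sampleMean_sampleCov hm hind hident hL2
  refine ⟨fun i ω => ‖Z i ω‖ ^ 2, fun i => hnsq.comp (hZm i), hZind.comp _ fun _ => hnsq, hmap,
    ?_, fun hchi => ?_⟩
  · filter_upwards [hcons] with ω hω
    obtain ⟨ε, hε, hε0, hbd⟩ := exists_abs_mahalanobisSq_sample_sub_le (y := fun i => Y i ω)
      hSdet hB hB' c hω.2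
    refine isApproximation_of_norm_sub_sq (Z := fun i => Z i ω)
      (tendsto_vecMean_whiten (y := fun i => Y i ω) B hω.1) hε hε0 fun n i => ?_
    rw [hd]
    exact hbd n i
  · have hlaw : ∀ i, μ.map (fun ω => ‖Z i ω‖ ^ 2) = chiSquared m := fun i => (hmap i).trans hchi
    have h4 : Integrable (fun ω => ‖Z 0 ω‖ ^ 4) μ := by
      have h := integrable_rpow_mul_exp_chiSquared hm1 (θ := 2) (u := 0) (by norm_num)
        (by norm_num)
      have hm0 : AEMeasurable (fun ω => ‖Z 0 ω‖ ^ 2) μ := (hnsq.comp (hZm 0)).aemeasurable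
      rw [← hlaw 0, integrable_map_measure (by fun_prop) hm0] at h
      refine h.congr (ae_of_all _ fun ω => ?_)
      simp only [Function.comp, Real.rpow_two]
      simp
      ring
    filter_upwards [hcons, ae_eventually_le_norm_sub_vecMean hm1 hZm hZind hlaw,
      ae_eventually_norm_vecMean_le hZm hZind hZid
        (fun r => integral_whiten_apply (hm 0) hL2 B r) h4] with ω hω hsep hmean
    obtain ⟨ε, hε, -, hbd⟩ := exists_abs_mahalanobisSq_sample_sub_le (y := fun i => Y i ω)
      hSdet hB hB' c hω.2
    refine eventually_norm_sq_le_of_le (Z := fun i => Z i ω) hε (fun n i => ?_) hsep hmean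
    rw [hd]
    exact hbd n i

theorem IsAsymptoticallyIID.ae_ae_tendsto_cdf {Ω : Type*} [MeasurableSpace Ω] {μ : Measure Ω}
    [IsProbabilityMeasure μ] {m : ℕ} {d : (n : ℕ) → Ω → Fin n → ℝ} {Q : Measure ℝ}
    {D : ℕ → Ω → ℝ} (h : IsAsymptoticallyIID μ m d Q D) (hm : 1 ≤ m) {a : ℝ} (ha : 0 < a) :
    ∀ᵐ ω ∂μ, ∀ᵐ t ∂(chiSquared m),
      Tendsto (fun n => cdf (posteriorBase a (chiSquared m) (d n ω)) t) atTop (𝓝 (cdf Q t)) := by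
  have := isProbabilityMeasure_chiSquared hm
  have hQ : IsProbabilityMeasure Q := by
    rw [← h.map_eq 0]
    exact Measure.isProbabilityMeasure_map (h.measurable 0).aemeasurable
  filter_upwards [ae_tendsto_empiricalCdf h.measurable h.indep h.map_eq, h.approx] with ω h1 h2
  filter_upwards [ae_continuousAt_cdf Q (chiSquared m)] with t ht
  exact tendsto_cdf_posteriorBase ha _ (h2.tendsto_empiricalCdf h1 ht)

theorem IsAsymptoticallyIID.ae_exists_tail_le {Ω : Type*} [MeasurableSpace Ω] {μ : Measure Ω}
    {m : ℕ} {d : (n : ℕ) → Ω → Fin n → ℝ} {D : ℕ → Ω → ℝ}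
    (h : IsAsymptoticallyIID μ m d (chiSquared m) D) (hm : 1 ≤ m) :
    ∀ᵐ ω ∂μ, ∃ C γ : ℝ, 1 ≤ C ∧ 0 < γ ∧ γ ≤ 1 ∧ ∀ᶠ n in atTop, ∀ t,
      empiricalCdf (d n ω) t ≤ C * cdf (chiSquared m) t ^ γ ∧
      (n ≠ 0 → 1 - empiricalCdf (d n ω) t ≤ C * (1 - cdf (chiSquared m) t) ^ γ) := by
  have hid : ∀ i, IdentDistrib (D i) (D 0) μ μ := fun i =>
    ⟨(h.measurable i).aemeasurable, (h.measurable 0).aemeasurable, by rw [h.map_eq, h.map_eq]⟩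
  have hi1 : Integrable (fun ω => D 0 ω ^ (-(1 / 4) : ℝ)) μ := by
    have hi := integrable_rpow_mul_exp_chiSquared hm (θ := -(1 / 4)) (u := 0) (by norm_num)
      (by norm_num)
    rw [← h.map_eq 0, integrable_map_measure (by fun_prop) (h.measurable 0).aemeasurable] at hi
    simpa [Function.comp_def] using hi
  have hi2 : Integrable (fun ω => Real.exp (D 0 ω / 8)) μ := by
    have hi := integrable_rpow_mul_exp_chiSquared hm (θ := 0) (u := -(1 / 8)) (by norm_num)
      (by norm_num)
    rw [← h.map_eq 0, integrable_map_measure (by fun_prop) (h.measurable 0).aemeasurable] at hi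
    refine hi.congr (ae_of_all _ fun ω => ?_)
    simp only [Function.comp, Real.rpow_zero, one_mul]
    ring_nf
  filter_upwards [h.approx, h.lower rfl, ae_forall_pos_of_map_eq_chiSquared h.measurable h.map_eq,
    ae_tendsto_average_comp (g := fun x => x ^ (-(1 / 4) : ℝ)) h.indep hid (by fun_prop) hi1,
    ae_tendsto_average_comp (g := fun x => Real.exp (x / 8)) h.indep hid (by fun_prop) hi2]
    with ω h1 h2 h3 h4 h5
  exact exists_empiricalCdf_tail_le hm h3 h1 h2
    (h4.eventually_le_const (lt_add_one _)) (h5.eventually_le_const (lt_add_one _))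

/-- Consistency under the null hypothesis. -/
theorem IsAsymptoticallyIID.ae_tendsto_zero {Ω Ω' : Type*} [MeasurableSpace Ω]
    [MeasurableSpace Ω'] {μ : Measure Ω} [IsProbabilityMeasure μ] {ν : Measure Ω'}
    [IsProbabilityMeasure ν] {m : ℕ}
    {d : (n : ℕ) → Ω → Fin n → ℝ} {D : ℕ → Ω → ℝ}
    (h : IsAsymptoticallyIID μ m d (chiSquared m) D) (hm : 1 ≤ m) {a : ℝ} (ha : 0 < a) :
    ∀ᵐ ω ∂μ, ∀ P : ℕ → Ω' → Measure ℝ,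
      (∀ n, IsPosterior ν (P n) a (chiSquared m) (d n ω)) →
      ∀ᵐ ω' ∂ν, Tendsto (fun n => andersonDarling (P n ω') (chiSquared m)) atTop (𝓝 0) := by
  have := isProbabilityMeasure_chiSquared hm
  filter_upwards [h.ae_ae_tendsto_cdf hm ha, h.ae_exists_tail_le hm] with ω h1 h2 P hP
  obtain ⟨C, γ, hC, hγ0, hγ1, htail⟩ := h2
  have hprob := fun n => isProbabilityMeasure_posteriorBase ha (chiSquared m) (d n ω)
  refine ae_tendsto_andersonDarling (A := fun n : ℕ => a + n) hP (fun n => by positivity)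
    (summable_one_div_add_nat_sq ha) hC hγ0 hγ1 ?_ h1
  filter_upwards [htail] with n hn t
  have hself : ∀ x : ℝ, 0 ≤ x → x ≤ 1 → x ≤ C * x ^ γ := fun x h0 h1 => by
    rcases h0.eq_or_lt with rfl | h0
    · simp [hγ0.ne']
    · have := Real.rpow_le_rpow_of_exponent_ge h0 h1 hγ1
      rw [Real.rpow_one] at this
      nlinarith
  exact cdf_posteriorBase_tail_le ha _ _ _
    (hself _ (cdf_nonneg _ t) (cdf_le_one _ t)) (hn t).1
    (hself _ (sub_nonneg.2 (cdf_le_one _ t)) (by linarith [cdf_nonneg (chiSquared m) t])) (hn t).2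

/-- Under an alternative, the Anderson-Darling distance to the null hypothesis is asymptotically
bounded below by that of the true law. -/
theorem IsAsymptoticallyIID.ae_le_liminf {Ω Ω' : Type*} [MeasurableSpace Ω]
    [MeasurableSpace Ω'] {μ : Measure Ω} [IsProbabilityMeasure μ] {ν : Measure Ω'}
    [IsProbabilityMeasure ν] {m : ℕ}
    {d : (n : ℕ) → Ω → Fin n → ℝ} {Q : Measure ℝ}
    {D : ℕ → Ω → ℝ} (h : IsAsymptoticallyIID μ m d Q D) (hm : 1 ≤ m) {a : ℝ} (ha : 0 < a) :
    ∀ᵐ ω ∂μ, ∀ P : ℕ → Ω' → Measure ℝ,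
      (∀ n, IsPosterior ν (P n) a (chiSquared m) (d n ω)) →
      ∀ᵐ ω' ∂ν, andersonDarling Q (chiSquared m) ≤
        liminf (fun n => andersonDarling (P n ω') (chiSquared m)) atTop := by
  have := isProbabilityMeasure_chiSquared hm
  filter_upwards [h.ae_ae_tendsto_cdf hm ha] with ω h1 P hP
  have hprob := fun n => isProbabilityMeasure_posteriorBase ha (chiSquared m) (d n ω)
  exact ae_andersonDarling_le_liminf (A := fun n : ℕ => a + n) hP (fun n => by positivity)
    (summable_one_div_add_nat_sq ha) h1

theorem andersonDarling_le_liminf_lintegral {Ω : Type*} [MeasurableSpace Ω] {ν : Measure Ω}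
    [IsProbabilityMeasure ν] {P : ℕ → Ω → Measure ℝ} (hP : ∀ n, Measurable (P n))
    (hprob : ∀ n ω, IsProbabilityMeasure (P n ω)) {Q : Measure ℝ} [IsProbabilityMeasure Q]
    {c : ℝ≥0∞} (h : ∀ᵐ ω ∂ν, c ≤ liminf (fun n => andersonDarling (P n ω) Q) atTop) :
    c ≤ liminf (fun n => ∫⁻ ω, andersonDarling (P n ω) Q ∂ν) atTop := by
  calc c = ∫⁻ _, c ∂ν := by simp
    _ ≤ ∫⁻ ω, liminf (fun n => andersonDarling (P n ω) Q) atTop ∂ν := lintegral_mono_ae h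
    _ ≤ _ := lintegral_liminf_le fun n => measurable_andersonDarling (hP n) (hprob n) Q

/-- A sample of positive numbers has empirical tails dominated by those of the chi-square law. -/
theorem exists_empiricalCdf_tail_le_of_pos {m : ℕ} (hm : 1 ≤ m) {n : ℕ} {x : Fin n → ℝ}
    (hx : ∀ i, 0 < x i) :
    ∃ C : ℝ, 1 ≤ C ∧ ∀ t, empiricalCdf x t ≤ C * cdf (chiSquared m) t ∧
      (n ≠ 0 → 1 - empiricalCdf x t ≤ C * (1 - cdf (chiSquared m) t)) := by
  have hF := cdf_nonneg (chiSquared m)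
  have hF' := fun t => sub_nonneg.2 (cdf_le_one (chiSquared m) t)
  have hpos : ∀ t, 0 < t → 0 < cdf (chiSquared m) t ∧ 0 < 1 - cdf (chiSquared m) t := by
    intro t ht
    obtain ⟨c₁, hc₁, h1⟩ := exists_rpow_le_cdf_chiSquared hm
    obtain ⟨c₂, hc₂, h2⟩ := exists_exp_le_one_sub_cdf_chiSquared hm
    have hmin : 0 < min t 1 := lt_min ht one_pos
    exact ⟨lt_of_lt_of_le (by positivity) ((h1 _ hmin.le (min_le_right _ _)).trans
      (monotone_cdf _ (min_le_left _ _))), lt_of_lt_of_le (by positivity) (h2 t ht.le)⟩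
  set s₁ := ∑ i, (cdf (chiSquared m) (x i))⁻¹ with hs₁
  set s₂ := ∑ i, (1 - cdf (chiSquared m) (x i))⁻¹ with hs₂
  have hs₁0 : 0 ≤ s₁ := Finset.sum_nonneg fun i _ => inv_nonneg.2 (hF _)
  have hs₂0 : 0 ≤ s₂ := Finset.sum_nonneg fun i _ => inv_nonneg.2 (hF' _)
  refine ⟨1 + s₁ + s₂, by linarith, fun t => ⟨?_, fun hn => ?_⟩⟩
  · by_cases h : ∃ i, x i ≤ t
    · obtain ⟨i, hi⟩ := h
      have h1 : (cdf (chiSquared m) (x i))⁻¹ ≤ s₁ :=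
        Finset.single_le_sum (f := fun i => (cdf (chiSquared m) (x i))⁻¹)
          (fun i _ => inv_nonneg.2 (hF _)) (Finset.mem_univ i)
      calc empiricalCdf x t ≤ 1 := empiricalCdf_le_one x t
        _ = (cdf (chiSquared m) (x i))⁻¹ * cdf (chiSquared m) (x i) :=
          (inv_mul_cancel₀ (hpos _ (hx i)).1.ne').symm
        _ ≤ (1 + s₁ + s₂) * cdf (chiSquared m) t :=
          mul_le_mul (by linarith) (monotone_cdf _ hi) (hF _) (by linarith)
    · push Not at h
      have : empiricalCdf x t = 0 := by
        rw [empiricalCdf, Finset.sum_eq_zero fun i _ => if_neg (not_le.2 (h i)), zero_div]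
      rw [this]
      exact mul_nonneg (by linarith) (hF t)
  · by_cases h : ∃ i, t < x i
    · obtain ⟨i, hi⟩ := h
      have h1 : (1 - cdf (chiSquared m) (x i))⁻¹ ≤ s₂ :=
        Finset.single_le_sum (f := fun i => (1 - cdf (chiSquared m) (x i))⁻¹)
          (fun i _ => inv_nonneg.2 (hF' _)) (Finset.mem_univ i)
      calc 1 - empiricalCdf x t ≤ 1 := by linarith [empiricalCdf_nonneg x t]
        _ = (1 - cdf (chiSquared m) (x i))⁻¹ * (1 - cdf (chiSquared m) (x i)) :=
          (inv_mul_cancel₀ (hpos _ (hx i)).2.ne').symm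
        _ ≤ (1 + s₁ + s₂) * (1 - cdf (chiSquared m) t) :=
          mul_le_mul (by linarith) (by linarith [monotone_cdf (chiSquared m) hi.le]) (hF' _)
            (by linarith)
    · push Not at h
      rw [one_sub_empiricalCdf hn, Finset.sum_eq_zero fun i _ => if_neg (not_lt.2 (h i)), zero_div]
      exact mul_nonneg (by linarith) (hF' t)

/-- Large concentration parameter: with a fixed positive sample, the posterior converges to the
prior base measure. -/
theorem ae_tendsto_andersonDarling_of_summable {Ω' : Type*} [MeasurableSpace Ω'] {ν : Measure Ω'}
    [IsProbabilityMeasure ν] {m : ℕ} (hm : 1 ≤ m) {n : ℕ} {x : Fin n → ℝ} (hx : ∀ i, 0 < x i)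
    {a : ℕ → ℝ} (ha : ∀ k, 0 < a k) (hs : Summable fun k => 1 / a k ^ 2)
    {P : ℕ → Ω' → Measure ℝ} (hP : ∀ k, IsPosterior ν (P k) (a k) (chiSquared m) x) :
    ∀ᵐ ω' ∂ν, Tendsto (fun k => andersonDarling (P k ω') (chiSquared m)) atTop (𝓝 0) := by
  have := isProbabilityMeasure_chiSquared hm
  have hprob := fun k => isProbabilityMeasure_posteriorBase (ha k) (chiSquared m) x
  have hs' : Summable fun k => 1 / (a k + n) ^ 2 := by
    refine Summable.of_nonneg_of_le (fun k => by positivity) (fun k => ?_) hs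
    have := ha k
    gcongr
    linarith [Nat.cast_nonneg (α := ℝ) n]
  obtain ⟨C, hC, htail⟩ := exists_empiricalCdf_tail_le_of_pos hm hx
  refine ae_tendsto_andersonDarling (A := fun k => a k + n) hP
    (fun k => by have := ha k; positivity) hs' hC one_pos le_rfl ?_ ?_
  · refine Eventually.of_forall fun k t => ?_
    simp only [Real.rpow_one]
    have h0 := cdf_nonneg (chiSquared m) t
    have h1 := cdf_le_one (chiSquared m) t
    exact cdf_posteriorBase_tail_le (ha k) _ _ _ (by nlinarith) (htail t).1 (by nlinarith)
      (htail t).2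
  · refine ae_of_all _ fun t => ?_
    have hinv : Tendsto (fun k => (a k + n)⁻¹) atTop (𝓝 0) := by
      have h := hs'.tendsto_atTop_zero.sqrt
      rw [Real.sqrt_zero] at h
      refine h.congr fun k => ?_
      have := ha k
      rw [one_div, Real.sqrt_inv, Real.sqrt_sq (by positivity)]
    have h := ((hinv.const_mul (n : ℝ)).mul_const
      (empiricalCdf x t - cdf (chiSquared m) t)).add_const (cdf (chiSquared m) t)
    rw [mul_zero, zero_mul, zero_add] at h
    refine h.congr fun k => ?_
    have := ha k
    rw [cdf_posteriorBase (ha k)]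
    field_simp
    ring

theorem mainTheorem2 (m : ℕ) (hm : 1 ≤ m)
    {Ω Ω' : Type*} [MeasurableSpace Ω] [MeasurableSpace Ω']
    (μ : Measure Ω) [IsProbabilityMeasure μ] (ν : Measure Ω') [IsProbabilityMeasure ν] :
    -- (i) fixed sample, concentration parameter tending to infinity
    (∀ (n : ℕ) (x : Fin n → ℝ), (∀ i, 0 < x i) →
      ∀ a : ℕ → ℝ, (∀ k, 0 < a k) → Summable (fun k => 1 / a k ^ 2) →
      ∀ P : ℕ → Ω' → Measure ℝ, (∀ k, IsPosterior ν (P k) (a k) (chiSquared m) x) →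
        ∀ᵐ ω' ∂ν, Tendsto (fun k => andersonDarling (P k ω') (chiSquared m)) atTop (𝓝 0)) ∧
    -- (ii), (iii), (iv) fixed concentration parameter, sample size tending to infinity
    (∀ a : ℝ, 0 < a →
      ∀ (d : (n : ℕ) → Ω → Fin n → ℝ) (Ptrue : Measure ℝ),
      (IsIIDSample μ d Ptrue ∨ IsMahalanobisSample μ m d Ptrue) →
        (Ptrue = chiSquared m →
          ∀ᵐ ω ∂μ, ∀ P : ℕ → Ω' → Measure ℝ,
            (∀ n, IsPosterior ν (P n) a (chiSquared m) (d n ω)) →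
            ∀ᵐ ω' ∂ν, Tendsto (fun n => andersonDarling (P n ω') (chiSquared m)) atTop (𝓝 0)) ∧
        (Ptrue ≠ chiSquared m →
          ∀ᵐ ω ∂μ, ∀ P : ℕ → Ω' → Measure ℝ,
            (∀ n, IsPosterior ν (P n) a (chiSquared m) (d n ω)) →
            ∀ᵐ ω' ∂ν, 0 < liminf (fun n => andersonDarling (P n ω') (chiSquared m)) atTop) ∧
        (Ptrue ≠ chiSquared m →
          ∀ᵐ ω ∂μ, ∀ P : ℕ → Ω' → Measure ℝ,
            (∀ n, IsPosterior ν (P n) a (chiSquared m) (d n ω)) →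
            0 < liminf (fun n => ∫⁻ ω', andersonDarling (P n ω') (chiSquared m) ∂ν) atTop)) := by
  have hchi := isProbabilityMeasure_chiSquared hm
  refine ⟨fun n x hx a ha hs P hP => ae_tendsto_andersonDarling_of_summable hm hx ha hs hP,
    fun a ha d Ptrue hdata => ?_⟩
  obtain ⟨D, hD⟩ : ∃ D, IsAsymptoticallyIID μ m d Ptrue D :=
    hdata.elim (fun h => h.exists_isAsymptoticallyIID m)
      fun h => h.exists_isAsymptoticallyIID hm
  have hQ : IsProbabilityMeasure Ptrue := by
    rw [← hD.map_eq 0]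
    exact Measure.isProbabilityMeasure_map (hD.measurable 0).aemeasurable
  refine ⟨fun h => ?_, fun h => ?_, fun h => ?_⟩
  · subst h
    exact hD.ae_tendsto_zero hm ha
  · have hpos := andersonDarling_chiSquared_pos hm h
    filter_upwards [hD.ae_le_liminf (ν := ν) hm ha] with ω hω P hP
    filter_upwards [hω P hP] with ω' hω' using hpos.trans_le hω'
  · have hpos := andersonDarling_chiSquared_pos hm h
    filter_upwards [hD.ae_le_liminf (ν := ν) hm ha] with ω hω P hP
    exact hpos.trans_le (andersonDarling_le_liminf_lintegral (fun n => (hP n).measurable)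
      (fun n => (hP n).isProbabilityMeasure) (hω P hP))
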